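/- Let $d\ge 0$, let $\mathsf{FeatSp}\subseteq\mathbb{R}^d$ be compact, let $\mathcal{D}$ be a Borel probability distribution on $\mathsf{FeatSp}$ whose support is all of $\mathsf{FeatSp}$, and let $c>0$. **Random graphs.** For $n\ge c$, $\mathcal{G}_\mathcal{D}(n,c/n)$ is the random featured graph on $n$ nodes in which each pair of distinct nodes is joined independently with probability $c/n$, and each node independently receives a feature vector with law $\mathcal{D}$. A multi-rooted featured graph $\mathbb{G}=(G,\bar u,\chi)$ is a locally finite simple graph $G$ with a tuple $\bar u$ of nodes (roots) and a feature map $\chi:V(G)\to\mathsf{FeatSp}$; $\mathbb{G}[v]$ is $\mathbb{G}$ with $v$ appended as last root, and $\mathbb{G}\sqcup\mathbb{H}$ is the disjoint union, with the roots of $\mathbb{G}$ followed by those of $\mathbb{H}$. A rooted featured tree is such a graph with one root whose underlying graph is a tree. $\mathrm{FBP}$ is the random rooted featured tree in which every node has a Poisson number of children with mean $c$ and a feature vector with law $\mathcal{D}$, all independent. **Terms.** Terms $\tau(\bar u)$ of the language $\mathrm{Agg}[\mathrm{Mean},\mathrm{LMean},\mathrm{Sup}]$ are built from real constants, $\mathrm{val}_i(u_j)$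 (the $i$-th feature of $u_j$), $\mathrm{E}(u_i,u_j)$ and $u_i=u_j$ (with values $0,1$) by applying Lipschitz functions $F:\mathbb{R}^m\to\mathbb{R}$ to terms, and by $\mathrm{Mean}_v\,\pi(\bar u,v)$ (average over all nodes $v$), $\mathrm{LMean}_{vEu_i}\,\pi(\bar u,v)$ (average over the neighbours $v$ of $u_i$, and $0$ if there are none) and $\sup_v\pi(\bar u,v)$ (supremum over all nodes $v$). Write $[\![\tau]\!]_{\mathbb{G}}$ for the value of $\tau$ on a finite $\mathbb{G}$. **Controllers.** The controller $\lambda_\tau(\mathbb{G})$ is defined by the same recursion as $[\![\tau]\!]_{\mathbb{G}}$ for atomic terms, for $F(\pi_1,\dots,\pi_m)$ and for $\mathrm{LMean}$ (using $\lambda_\pi(\mathbb{G}[v])$ for the neighbours $v$), while $$\lambda_{\mathrm{Mean}_v\pi}(\mathbb{G})=\mathbb{E}_{\mathbb{T}\sim\mathrm{FBP}}\big[\lambda_\pi(\mathbb{G}\sqcup\mathbb{T})\big],\qquad \lambda_{\sup_v\pi}(\mathbb{G})=\max\Big\{\sup_{v\in V(G)}\lambda_\pi(\mathbb{G}[v]),\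 \sup_{\mathbb{T}}\lambda_\pi(\mathbb{G}\sqcup\mathbb{T})\Big\},$$ the last supremum being over all rooted featured trees $\mathbb{T}$. **Statement.** For every closed term $\tau$, $[\![\tau]\!]_{\mathcal{G}_\mathcal{D}(n,c/n)}$ converges in probability to $\lambda_\tau(\mathcal{G}_\mathcal{D}(n,c/n))$: for every $\delta>0$, $$\Pr\Big(\big|[\![\tau]\!]_{\mathbb{G}}-\lambda_\tau(\mathbb{G})\big|\ge\delta\Big)\longrightarrow 0\quad(n\to\infty),\qquad \mathbb{G}\sim\mathcal{G}_\mathcal{D}(n,c/n).$$ -/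

import Mathlib

open MeasureTheory ProbabilityTheory Filter Topology
open scoped NNReal ENNReal

noncomputable section

/-- Terms of the aggregate language over graphs whose nodes carry `d` real features.
`AggTerm d k` is the type of terms with free variables among `u 0, …, u (k - 1)`; the aggregates
`mean`, `lmean`, `sup` bind the last variable of their body, and `lmean i π` is the local mean of
`π` over the neighbours of `u i`. A closed term is an element of `AggTerm d 0`. -/
inductive AggTerm (d : ℕ) : ℕ → Type
  | val {k : ℕ} (i : Fin d) (j : Fin k) : AggTerm d k
  | const {k : ℕ} (a : ℝ) : AggTerm d k
  | edge {k : ℕ} (i j : Fin k) : AggTerm d k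
  | equal {k : ℕ} (i j : Fin k) : AggTerm d k
  | app {k m : ℕ} (F : (Fin m → ℝ) → ℝ) (hF : ∃ K : ℝ≥0, LipschitzWith K F)
      (π : Fin m → AggTerm d k) : AggTerm d k
  | mean {k : ℕ} (π : AggTerm d (k + 1)) : AggTerm d k
  | lmean {k : ℕ} (i : Fin k) (π : AggTerm d (k + 1)) : AggTerm d k
  | sup {k : ℕ} (π : AggTerm d (k + 1)) : AggTerm d k

/-- The value of a term on a finite graph `G` with node features `χ`, at the nodes `u`.
The local mean over an empty neighbourhood is `0` (here by `x / 0 = 0`). -/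
def AggTerm.eval {d : ℕ} {V : Type} [Fintype V] (G : SimpleGraph V) (χ : V → Fin d → ℝ) :
    {k : ℕ} → AggTerm d k → (Fin k → V) → ℝ
  | _, .val i j, u => χ (u j) i
  | _, .const a, _ => a
  | _, .edge i j, u => open Classical in if G.Adj (u i) (u j) then 1 else 0
  | _, .equal i j, u => open Classical in if u i = u j then 1 else 0
  | _, .app F _ π, u => F fun l => (π l).eval G χ u
  | _, .mean π, u => (∑ v, π.eval G χ (Fin.snoc u v)) / Fintype.card V
  | _, .lmean i π, u => open Classical in
      (∑ v ∈ G.neighborFinset (u i), π.eval G χ (Fin.snoc u v)) / G.degree (u i)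
  | _, .sup π, u => ⨆ v, π.eval G χ (Fin.snoc u v)

/-- Locally finite multi-rooted featured graphs, with `k` roots and features in `S`. -/
structure MRFG {d : ℕ} (S : Set (Fin d → ℝ)) (k : ℕ) where
  V : Type
  graph : SimpleGraph V
  finite_nbrs : ∀ v, (graph.neighborSet v).Finite
  root : Fin k → V
  feat : V → S

namespace MRFG

variable {d k l : ℕ} {S : Set (Fin d → ℝ)}

/-- The featured graph without roots given by a finite graph and its features. -/
def ofFinite {V : Type} [Finite V] (G : SimpleGraph V) (χ : V → S) : MRFG S 0 where
  V := V
  graph := G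
  finite_nbrs _ := Set.toFinite _
  root := Fin.elim0
  feat := χ

/-- `𝔾[v]`: the node `v` is appended as a new last root. -/
def addRoot (G : MRFG S k) (v : G.V) : MRFG S (k + 1) where
  V := G.V
  graph := G.graph
  finite_nbrs := G.finite_nbrs
  root := Fin.snoc G.root v
  feat := G.feat

/-- The disjoint union; the roots of `G` come first, then those of `H`. -/
def union (G : MRFG S k) (H : MRFG S l) : MRFG S (k + l) where
  V := G.V ⊕ H.V
  graph := G.graph.sum H.graph
  finite_nbrs v := by
    rcases v with v | v
    · refine ((G.finite_nbrs v).image Sum.inl).subset ?_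
      rintro (w | w) hw
      · exact ⟨w, hw, rfl⟩
      · exact absurd hw (by simp)
    · refine ((H.finite_nbrs v).image Sum.inr).subset ?_
      rintro (w | w) hw
      · exact absurd hw (by simp)
      · exact ⟨w, hw, rfl⟩
  root := Fin.append (fun i => Sum.inl (G.root i)) (fun i => Sum.inr (H.root i))
  feat := Sum.elim G.feat H.feat

/-- The neighbours of `v`, as a finite set. -/
def nbrs (G : MRFG S k) (v : G.V) : Finset G.V := (G.finite_nbrs v).toFinset

end MRFG

/-- Rooted (locally finite) featured trees with features in `S`. -/
def RootedFeaturedTree {d : ℕ} (S : Set (Fin d → ℝ)) : Type 1 :=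
  {T : MRFG S 1 // T.graph.IsTree}

/-- Nodes of a branching tree are words of naturals: `[]` is the root and `i :: w` is the
`i`-th child of `w`. Given the number `N w` of children of every potential node `w`, this says that
`w` is a node of the resulting tree. -/
def IsNode (N : List ℕ → ℕ) : List ℕ → Prop
  | [] => True
  | i :: w => i < N w ∧ IsNode N w

/-- The rooted featured tree in which the node `w` has `(ω w).1` children and feature `(ω w).2`. -/
def branchingTree {d : ℕ} {S : Set (Fin d → ℝ)} (ω : List ℕ → ℕ × S) : MRFG S 1 where
  V := {w : List ℕ // IsNode (fun w => (ω w).1) w}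
  graph :=
    { Adj := fun v w => (∃ i, v.1 = i :: w.1) ∨ (∃ i, w.1 = i :: v.1)
      symm := ⟨fun _ _ h => h.symm⟩
      loopless := ⟨fun v h => by
        rcases h with ⟨i, h⟩ | ⟨i, h⟩ <;> exact absurd (congrArg List.length h) (by simp)⟩ }
  finite_nbrs v := by
    refine Set.Finite.of_finite_image
      (f := (Subtype.val : {w : List ℕ // IsNode (fun w => (ω w).1) w} → List ℕ)) ?_
      Subtype.val_injective.injOn
    refine (((Set.finite_Iio (ω v.1).1).image (fun i => i :: v.1)).union
      (Set.finite_singleton v.1.tail)).subset ?_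
    rintro _ ⟨w, ⟨i, h⟩ | ⟨i, h⟩, rfl⟩
    · right; simp [h]
    · left
      have hw := w.2
      rw [h] at hw
      exact ⟨i, hw.1, h.symm⟩
  root := fun _ => ⟨[], trivial⟩
  feat := fun w => (ω w.1).2

/-- The law of the family of offspring numbers and features that generates the featured branching
process: offspring numbers are Poisson with mean `c`, features have law `D`, all independent.
The featured branching process is the random tree `branchingTree ω`, `ω ∼ fbpLaw c D`. -/
def fbpLaw {d : ℕ} {S : Set (Fin d → ℝ)} (c : ℝ≥0) (D : Measure S) :
    Measure (List ℕ → ℕ × S) :=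
  Measure.infinitePi fun _ => (poissonMeasure c).prod D

/-- The controller `λ_τ` of the term `τ`, a function on multi-rooted featured graphs.
In the case of `sup`, the value is the maximum of the supremum over the nodes of `G` and of the
supremum over all rooted featured trees, written as one supremum. -/
def AggTerm.controller {d : ℕ} {S : Set (Fin d → ℝ)} (c : ℝ≥0) (D : Measure S) :
    {k : ℕ} → AggTerm d k → MRFG S k → ℝ
  | _, .val i j, G => (G.feat (G.root j) : Fin d → ℝ) i
  | _, .const a, _ => a
  | _, .edge i j, G => open Classical in if G.graph.Adj (G.root i) (G.root j) then 1 else 0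
  | _, .equal i j, G => open Classical in if G.root i = G.root j then 1 else 0
  | _, .app F _ π, G => F fun l => (π l).controller c D G
  | _, .mean π, G => ∫ ω, π.controller c D (G.union (branchingTree ω)) ∂(fbpLaw c D)
  | _, .lmean i π, G =>
      (∑ v ∈ G.nbrs (G.root i), π.controller c D (G.addRoot v)) / (G.nbrs (G.root i)).card
  | _, .sup π, G =>
      sSup ((Set.range fun v : G.V => π.controller c D (G.addRoot v)) ∪
        (Set.range fun T : RootedFeaturedTree S => π.controller c D (G.union T.1)))

/-- The law of the random featured graph on `n` nodes: each edge is present with probability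
`c / n` (clipped to `1` for the finitely many `n < c`), the features of the nodes have law `D`,
all independent. -/
def randomFeaturedGraph {d : ℕ} {S : Set (Fin d → ℝ)} (c : ℝ≥0) (D : Measure S) (n : ℕ) :
    Measure (SimpleGraph (Fin n) × (Fin n → S)) :=
  (SimpleGraph.binomialRandom (Fin n) (Set.projIcc (0 : ℝ) 1 zero_le_one (c / n))).prod
    (Measure.pi fun _ => D)

end

/-! The statement is strengthened until it can be proved by induction on the term: for a term with
`k` free variables, with high probability value and controller differ by at most `δ` at all
`k`-tuples of nodes simultaneously (`AggTerm.Concentrates`). Atomic terms are exact, Lipschitz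
functions and local means pass the bound on, and only the two global aggregates use the randomness.

Let `u` be a tuple of nodes and write 𝔾 for the graph rooted at `u`. With high probability all but a
small proportion of the nodes `v` are far from `u` and have an injective universal cover up to a
given depth (`whp_ncard_not_isolated_le`). Controllers are local (`exists_locality_radius`), so for
such `v` the controller of the body π at 𝔾[v] equals its value at 𝔾 ⊔ T, where T is the cover at `v`
(`locallyEquiv_addRoot_union_cover`). A mean is therefore, up to a small error, the average over `v`
of the local function T ↦ λ_π(𝔾 ⊔ T) at the cover of `v`. For a fixed local function such averages
converge to the expectation over the branching process (`whp_average`). This is a second moment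
argument: the covers at two vertices are asymptotically independent copies of the branching process,
the offspring numbers by a Poisson limit and the features by independence.

The difficulty is that the local function itself depends on the random graph and on `u`. It is
overcome by a compactness statement (`exists_coloring`, `exists_union_representatives`): as 𝔾 ranges
over all nonempty rooted featured graphs, the functions T ↦ λ_π(𝔾 ⊔ T) are finitely many up to a
uniform error. Representatives are fixed before `n`, and the law of large numbers is applied to each
of them.

For a supremum, the trees that nearly maximise a representative form an open set, because
controllers depend continuously on offspring numbers and features (locality together with the
Lipschitz property). Open nonempty sets have positive probability, as `D` has full support. So a
positive proportion of the vertices have a nearly optimal cover, and one of them is isolated from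
`u`: the supremum over all trees is almost attained inside the graph.

The supremum over trees also dictates the notion of locality. A vertex with a tree-like ball away
from all matched vertices can be traded for a disjoint tree; so two graphs need to agree only near
the roots and near the vertices whose balls contain cycles. -/

/-! ### Balls and bounded-depth back-and-forth matchings. -/

namespace SimpleGraph

variable {V W : Type*}

/-- The ball of radius `r` around `v`: the endpoints of walks of length at most `r`. -/
def walkBall (G : SimpleGraph V) (v : V) (r : ℕ) : Set V := {x | ∃ p : G.Walk v x, p.length ≤ r}

lemma self_mem_walkBall (G : SimpleGraph V) (v : V) (r : ℕ) : v ∈ G.walkBall v r :=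
  ⟨.nil, Nat.zero_le r⟩

lemma walkBall_mono (G : SimpleGraph V) (v : V) {r s : ℕ} (h : r ≤ s) :
    G.walkBall v r ⊆ G.walkBall v s := fun _ ⟨p, hp⟩ => ⟨p, hp.trans h⟩

lemma walkBall_symm {G : SimpleGraph V} {v x : V} {r : ℕ} (h : x ∈ G.walkBall v r) :
    v ∈ G.walkBall x r := by
  obtain ⟨p, hp⟩ := h
  exact ⟨p.reverse, by simpa using hp⟩

lemma walkBall_trans {G : SimpleGraph V} {v x y : V} {r s : ℕ} (h : x ∈ G.walkBall v r)
    (h' : y ∈ G.walkBall x s) : y ∈ G.walkBall v (r + s) := by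
  obtain ⟨p, hp⟩ := h
  obtain ⟨q, hq⟩ := h'
  exact ⟨p.append q, by rw [Walk.length_append]; omega⟩

lemma Adj.mem_walkBall {G : SimpleGraph V} {x y : V} (h : G.Adj x y) : y ∈ G.walkBall x 1 :=
  ⟨h.toWalk, by simp⟩

lemma mem_walkBall_zero {G : SimpleGraph V} {v x : V} : x ∈ G.walkBall v 0 ↔ x = v := by
  constructor
  · rintro ⟨p, hp⟩
    exact (Walk.eq_of_length_eq_zero (Nat.le_zero.1 hp)).symm
  · rintro rfl
    exact self_mem_walkBall _ _ _

lemma mem_walkBall_succ {G : SimpleGraph V} {v x : V} {r : ℕ} (h : x ∈ G.walkBall v (r + 1)) :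
    x = v ∨ ∃ y, G.Adj v y ∧ x ∈ G.walkBall y r := by
  obtain ⟨p, hp⟩ := h
  cases p with
  | nil => exact .inl rfl
  | cons hadj q => exact .inr ⟨_, hadj, q, by simpa using hp⟩

lemma mem_walkBall_succ' {G : SimpleGraph V} {v x : V} {r : ℕ} (h : x ∈ G.walkBall v (r + 1)) :
    x = v ∨ ∃ y ∈ G.walkBall v r, G.Adj y x := by
  rcases mem_walkBall_succ (walkBall_symm h) with rfl | ⟨y, hy, hv⟩
  · exact .inl rfl
  · exact .inr ⟨y, walkBall_symm hv, hy.symm⟩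

/-- A section of `f` over `t` is an injective homomorphism from `H.induce t` to `G.induce s`, so
cycles would transport. Only reflection of adjacency is needed, so the lemma serves smaller balls,
summands of a union and projections of covers alike. -/
lemma isAcyclic_induce_of_subset_image {G : SimpleGraph V} {H : SimpleGraph W} {f : V → W}
    {s : Set V} {t : Set W}
    (hf : ∀ a ∈ s, ∀ b ∈ s, H.Adj (f a) (f b) → G.Adj a b) (ht : t ⊆ f '' s)
    (h : (G.induce s).IsAcyclic) : (H.induce t).IsAcyclic := by
  have ht' : ∀ y : t, ∃ x ∈ s, f x = y := fun y => ht y.2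
  choose g hg hfg using ht'
  refine h.comap (f := ⟨fun y => ⟨g y, hg y⟩, ?_⟩) ?_
  · intro a b hab
    exact hf (g a) (hg a) (g b) (hg b) (by rw [hfg a, hfg b]; exact hab)
  · intro a b hab
    have : g a = g b := congrArg Subtype.val hab
    exact Subtype.ext (by rw [← hfg a, ← hfg b, this])

lemma connected_induce_walkBall (G : SimpleGraph V) (v : V) (r : ℕ) :
    (G.induce (G.walkBall v r)).Connected := by
  have key : ∀ j (hj : j ≤ r) x (hx : x ∈ G.walkBall v j),
      (G.induce (G.walkBall v r)).Reachable ⟨v, G.self_mem_walkBall v r⟩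
        ⟨x, G.walkBall_mono v hj hx⟩ := by
    intro j
    induction j with
    | zero =>
      intro hj x hx
      obtain rfl := mem_walkBall_zero.1 hx
      exact Reachable.refl _
    | succ j ih =>
      intro hj x hx
      rcases mem_walkBall_succ' hx with rfl | ⟨y, hy, hyx⟩
      · exact Reachable.refl _
      · refine (ih (by omega) y hy).trans (Adj.reachable ?_)
        exact hyx
  rw [connected_iff]
  refine ⟨fun x y => (key r le_rfl x x.2).symm.trans (key r le_rfl y y.2), ?_⟩
  exact ⟨⟨v, G.self_mem_walkBall v r⟩⟩

/-- The pair `(x, y)` belongs to the matching `M` and, up to `r` steps, the neighbourhoods of `x`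
and `y` are exhausted by pairs of `M`. -/
def Deep (G : SimpleGraph V) (H : SimpleGraph W) (M : V → W → Prop) : ℕ → V → W → Prop
  | 0, x, y => M x y
  | r + 1, x, y => M x y ∧ (∀ x', G.Adj x x' → ∃ y', H.Adj y y' ∧ Deep G H M r x' y') ∧
      (∀ y', H.Adj y y' → ∃ x', G.Adj x x' ∧ Deep G H M r x' y')

section Deep

variable {G : SimpleGraph V} {H : SimpleGraph W} {M M' : V → W → Prop}

lemma Deep.mem {r : ℕ} {x : V} {y : W} (h : Deep G H M r x y) : M x y := by
  cases r with
  | zero => exact h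
  | succ r => exact h.1

lemma Deep.of_succ {r : ℕ} {x : V} {y : W} (h : Deep G H M (r + 1) x y) : Deep G H M r x y := by
  induction r generalizing x y with
  | zero => exact h.1
  | succ r ih =>
    refine ⟨h.1, fun x' hx' => ?_, fun y' hy' => ?_⟩
    · obtain ⟨y', hy', h'⟩ := h.2.1 x' hx'
      exact ⟨y', hy', ih h'⟩
    · obtain ⟨x', hx', h'⟩ := h.2.2 y' hy'
      exact ⟨x', hx', ih h'⟩

lemma Deep.mono {r s : ℕ} (hrs : r ≤ s) {x : V} {y : W} (h : Deep G H M s x y) :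
    Deep G H M r x y := by
  induction s, hrs using Nat.le_induction with
  | base => exact h
  | succ s _ ih => exact ih h.of_succ

lemma Deep.flip {r : ℕ} {x : V} {y : W} (h : Deep G H M r x y) :
    Deep H G (fun b a => M a b) r y x := by
  induction r generalizing x y with
  | zero => exact h
  | succ r ih =>
    refine ⟨h.1, fun y' hy' => ?_, fun x' hx' => ?_⟩
    · obtain ⟨x', hx', h'⟩ := h.2.2 y' hy'
      exact ⟨x', hx', ih h'⟩
    · obtain ⟨y', hy', h'⟩ := h.2.1 x' hx'
      exact ⟨y', hy', ih h'⟩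

/-- The maps `f` and `g` preserve edges and reach all neighbours of their images, so the
back-and-forth moves carry over one by one. The surplus depth `q` pays for matchings `N` that
contain only the images of pairs already deep of order `q`. -/
lemma Deep.imp {V' W' : Type*} {G' : SimpleGraph V'} {H' : SimpleGraph W'} {N : V' → W' → Prop}
    {f : V → V'} {g : W → W'} {q : ℕ}
    (hM : ∀ x y, Deep G H M q x y → N (f x) (g y))
    (hf : ∀ x x', G'.Adj (f x) x' → ∃ z, x' = f z ∧ G.Adj x z)
    (hg : ∀ y y', H'.Adj (g y) y' → ∃ z, y' = g z ∧ H.Adj y z)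
    (hf' : ∀ x x', G.Adj x x' → G'.Adj (f x) (f x'))
    (hg' : ∀ x x', H.Adj x x' → H'.Adj (g x) (g x'))
    {r : ℕ} {x : V} {y : W} (h : Deep G H M (q + r) x y) : Deep G' H' N r (f x) (g y) := by
  induction r generalizing x y with
  | zero => exact hM _ _ h
  | succ r ih =>
    refine ⟨hM _ _ (h.mono (by omega)), fun x' hx' => ?_, fun y' hy' => ?_⟩
    · obtain ⟨z, rfl, hz⟩ := hf _ _ hx'
      obtain ⟨y', hy', h'⟩ := h.2.1 z hz
      exact ⟨g y', hg' _ _ hy', ih h'⟩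
    · obtain ⟨z, rfl, hz⟩ := hg _ _ hy'
      obtain ⟨x', hx', h'⟩ := h.2.2 z hz
      exact ⟨f x', hf' _ _ hx', ih h'⟩

lemma Deep.of_mem_walkBall {q r : ℕ} {x v : V} {y : W} (h : Deep G H M (q + r) x y)
    (hv : v ∈ G.walkBall x r) : ∃ w, Deep G H M q v w := by
  induction r generalizing x y with
  | zero =>
    obtain rfl := mem_walkBall_zero.1 hv
    exact ⟨y, h⟩
  | succ r ih =>
    rcases mem_walkBall_succ hv with rfl | ⟨z, hz, hvz⟩
    · exact ⟨y, h.mono (by omega)⟩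
    · obtain ⟨y', -, h'⟩ := h.2.1 z hz
      exact ih h' hvz

end Deep

end SimpleGraph

/-! ### Local equivalence of rooted featured graphs. -/

open SimpleGraph hiding dist dist_comm dist_self

namespace MRFG

variable {d k l : ℕ} {S : Set (Fin d → ℝ)}

/-- The matching `M` shows that `G` and `H` agree up to radius `R` around the roots and around all
vertices whose ball of radius `R` is not a tree. -/
structure LocallyMatched (R : ℕ) (G H : MRFG S k) (M : G.V → H.V → Prop) : Prop where
  feat_eq : ∀ {x y}, M x y → G.feat x = H.feat y
  adj_iff : ∀ {x y x' y'}, M x y → M x' y' → (G.graph.Adj x x' ↔ H.graph.Adj y y')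
  eq_iff : ∀ {x y x' y'}, M x y → M x' y' → (x = x' ↔ y = y')
  root : ∀ i, Deep G.graph H.graph M R (G.root i) (H.root i)
  total_left : ∀ x, (∃ y, Deep G.graph H.graph M R x y) ∨
    (G.graph.induce (G.graph.walkBall x R)).IsAcyclic
  total_right : ∀ y, (∃ x, Deep G.graph H.graph M R x y) ∨
    (H.graph.induce (H.graph.walkBall y R)).IsAcyclic

/-- `G` and `H` cannot be distinguished by terms of locality radius `R`. -/
def LocallyEquiv (R : ℕ) (G H : MRFG S k) : Prop := ∃ M, LocallyMatched R G H M

lemma LocallyMatched.flip {R : ℕ} {G H : MRFG S k} {M : G.V → H.V → Prop}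
    (h : LocallyMatched R G H M) : LocallyMatched R H G (fun b a => M a b) where
  feat_eq hxy := (h.feat_eq hxy).symm
  adj_iff hxy hxy' := (h.adj_iff hxy hxy').symm
  eq_iff hxy hxy' := (h.eq_iff hxy hxy').symm
  root i := (h.root i).flip
  total_left y := (h.total_right y).imp_left fun ⟨x, hx⟩ => ⟨x, hx.flip⟩
  total_right x := (h.total_left x).imp_left fun ⟨y, hy⟩ => ⟨y, hy.flip⟩

lemma LocallyEquiv.symm {R : ℕ} {G H : MRFG S k} (h : LocallyEquiv R G H) :
    LocallyEquiv R H G := by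
  obtain ⟨M, hM⟩ := h
  exact ⟨_, hM.flip⟩

lemma isAcyclic_walkBall_mono {V : Type*} {G : SimpleGraph V} {x : V} {r s : ℕ} (hrs : r ≤ s)
    (h : (G.induce (G.walkBall x s)).IsAcyclic) : (G.induce (G.walkBall x r)).IsAcyclic :=
  isAcyclic_induce_of_subset_image (f := id) (fun _ _ _ _ => id)
    (by simpa using G.walkBall_mono x hrs) h

lemma LocallyMatched.mono {R R' : ℕ} (hR : R' ≤ R) {G H : MRFG S k} {M : G.V → H.V → Prop}
    (h : LocallyMatched R G H M) : LocallyMatched R' G H M where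
  feat_eq hxy := h.feat_eq hxy
  adj_iff hxy hxy' := h.adj_iff hxy hxy'
  eq_iff hxy hxy' := h.eq_iff hxy hxy'
  root i := (h.root i).mono hR
  total_left x := (h.total_left x).imp (fun ⟨y, hy⟩ => ⟨y, hy.mono hR⟩)
    (isAcyclic_walkBall_mono hR)
  total_right y := (h.total_right y).imp (fun ⟨x, hx⟩ => ⟨x, hx.mono hR⟩)
    (isAcyclic_walkBall_mono hR)

lemma LocallyEquiv.mono {R R' : ℕ} (hR : R' ≤ R) {G H : MRFG S k} (h : LocallyEquiv R G H) :
    LocallyEquiv R' G H := by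
  obtain ⟨M, hM⟩ := h
  exact ⟨M, hM.mono hR⟩

lemma LocallyMatched.addRoot {R : ℕ} {G H : MRFG S k} {M : G.V → H.V → Prop}
    (h : LocallyMatched R G H M) {x : G.V} {y : H.V} (hxy : Deep G.graph H.graph M R x y) :
    LocallyMatched R (G.addRoot x) (H.addRoot y) M where
  feat_eq hxy := h.feat_eq hxy
  adj_iff hxy hxy' := h.adj_iff hxy hxy'
  eq_iff hxy hxy' := h.eq_iff hxy hxy'
  root i := by
    induction i using Fin.lastCases with
    | last => simpa [MRFG.addRoot] using hxy
    | cast i => simpa [MRFG.addRoot] using h.root i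
  total_left := h.total_left
  total_right := h.total_right

lemma union_adj_inl {G : MRFG S k} {T : MRFG S l} {x : G.V} {z : (G.union T).V} :
    (G.union T).graph.Adj (Sum.inl x) z ↔ ∃ y, z = Sum.inl y ∧ G.graph.Adj x y := by
  rcases z with z | z <;> simp [MRFG.union]

lemma union_adj_inr {G : MRFG S k} {T : MRFG S l} {x : T.V} {z : (G.union T).V} :
    (G.union T).graph.Adj (Sum.inr x) z ↔ ∃ y, z = Sum.inr y ∧ T.graph.Adj x y := by
  rcases z with z | z <;> simp [MRFG.union]

lemma union_walkBall_inl (G : MRFG S k) (T : MRFG S l) (x : G.V) (r : ℕ) :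
    (G.union T).graph.walkBall (Sum.inl x) r ⊆ Sum.inl '' G.graph.walkBall x r := by
  induction r generalizing x with
  | zero =>
    intro z hz
    exact ⟨x, G.graph.self_mem_walkBall x 0, (mem_walkBall_zero.1 hz).symm⟩
  | succ r ih =>
    intro z hz
    rcases mem_walkBall_succ hz with rfl | ⟨y, hy, hz⟩
    · exact ⟨x, G.graph.self_mem_walkBall x _, rfl⟩
    · obtain ⟨y, rfl, hxy⟩ := union_adj_inl.1 hy
      obtain ⟨z, hz', rfl⟩ := ih y hz
      refine ⟨z, ?_, rfl⟩
      rw [add_comm]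
      exact walkBall_trans hxy.mem_walkBall hz'

lemma union_walkBall_inr (G : MRFG S k) (T : MRFG S l) (x : T.V) (r : ℕ) :
    (G.union T).graph.walkBall (Sum.inr x) r ⊆ Sum.inr '' T.graph.walkBall x r := by
  induction r generalizing x with
  | zero =>
    intro z hz
    exact ⟨x, T.graph.self_mem_walkBall x 0, (mem_walkBall_zero.1 hz).symm⟩
  | succ r ih =>
    intro z hz
    rcases mem_walkBall_succ hz with rfl | ⟨y, hy, hz⟩
    · exact ⟨x, T.graph.self_mem_walkBall x _, rfl⟩
    · obtain ⟨y, rfl, hxy⟩ := union_adj_inr.1 hy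
      obtain ⟨z, hz', rfl⟩ := ih y hz
      refine ⟨z, ?_, rfl⟩
      rw [add_comm]
      exact walkBall_trans hxy.mem_walkBall hz'

lemma union_isAcyclic_inl {G : MRFG S k} (T : MRFG S l) {x : G.V} {r : ℕ}
    (h : (G.graph.induce (G.graph.walkBall x r)).IsAcyclic) :
    ((G.union T).graph.induce ((G.union T).graph.walkBall (Sum.inl x) r)).IsAcyclic :=
  isAcyclic_induce_of_subset_image (f := Sum.inl) (fun a _ b _ hab => by simpa [union] using hab)
    (union_walkBall_inl G T x r) h

lemma union_isAcyclic_inr (G : MRFG S k) {T : MRFG S l} (hT : T.graph.IsAcyclic) (x : T.V)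
    (r : ℕ) :
    ((G.union T).graph.induce ((G.union T).graph.walkBall (Sum.inr x) r)).IsAcyclic :=
  isAcyclic_induce_of_subset_image (f := Sum.inr) (fun a _ b _ hab => by simpa [union] using hab)
    (union_walkBall_inr G T x r) (hT.induce _)

/-- The matching of two disjoint unions induced by matchings of the summands. -/
def sumMatch {V W V' W' : Type*} (M : V → W → Prop) (N : V' → W' → Prop) :
    V ⊕ V' → W ⊕ W' → Prop
  | .inl x, .inl y => M x y
  | .inr x, .inr y => N x y
  | _, _ => False

lemma LocallyMatched.union {R : ℕ} {G H : MRFG S k} {T U : MRFG S l} {M : G.V → H.V → Prop}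
    {N : T.V → U.V → Prop} (h : LocallyMatched R G H M) (h' : LocallyMatched R T U N) :
    LocallyMatched R (G.union T) (H.union U) (sumMatch M N) := by
  have hinl : ∀ {x y}, Deep G.graph H.graph M R x y →
      Deep (G.union T).graph (H.union U).graph (sumMatch M N) R (Sum.inl x) (Sum.inl y) := by
    intro x y hxy
    refine Deep.imp (q := 0) (f := Sum.inl) (g := Sum.inl) (fun _ _ h => h) ?_ ?_ ?_ ?_ 
      (by simpa using hxy)
    · exact fun x x' hx => union_adj_inl.1 hx
    · exact fun x x' hx => union_adj_inl.1 hx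
    · exact fun x x' hx => union_adj_inl.2 ⟨_, rfl, hx⟩
    · exact fun x x' hx => union_adj_inl.2 ⟨_, rfl, hx⟩
  have hinr : ∀ {x y}, Deep T.graph U.graph N R x y →
      Deep (G.union T).graph (H.union U).graph (sumMatch M N) R (Sum.inr x) (Sum.inr y) := by
    intro x y hxy
    refine Deep.imp (q := 0) (f := Sum.inr) (g := Sum.inr) (fun _ _ h => h) ?_ ?_ ?_ ?_ 
      (by simpa using hxy)
    · exact fun x x' hx => union_adj_inr.1 hx
    · exact fun x x' hx => union_adj_inr.1 hx
    · exact fun x x' hx => union_adj_inr.2 ⟨_, rfl, hx⟩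
    · exact fun x x' hx => union_adj_inr.2 ⟨_, rfl, hx⟩
  have ac : ∀ {G : MRFG S k} {T : MRFG S l} {x : T.V},
      (T.graph.induce (T.graph.walkBall x R)).IsAcyclic →
      ((G.union T).graph.induce ((G.union T).graph.walkBall (Sum.inr x) R)).IsAcyclic := by
    intro G T x h
    exact isAcyclic_induce_of_subset_image (f := Sum.inr)
      (fun a _ b _ hab => by simpa [MRFG.union] using hab) (union_walkBall_inr G T x R) h
  refine ⟨?_, ?_, ?_, ?_, ?_, ?_⟩
  · rintro (x | x) (y | y) hxy
    · exact h.feat_eq hxy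
    · exact hxy.elim
    · exact hxy.elim
    · exact h'.feat_eq hxy
  · rintro (x | x) (y | y) (x' | x') (y' | y') hxy hxy' <;>
      first
      | exact hxy.elim
      | exact hxy'.elim
      | exact h.adj_iff hxy hxy'
      | exact h'.adj_iff hxy hxy'
      | exact iff_of_false (by simp [MRFG.union]) (by simp [MRFG.union])
  · rintro (x | x) (y | y) (x' | x') (y' | y') hxy hxy' <;>
      first
      | exact hxy.elim
      | exact hxy'.elim
      | exact Sum.inl_injective.eq_iff.trans ((h.eq_iff hxy hxy').trans
          Sum.inl_injective.eq_iff.symm)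
      | exact Sum.inr_injective.eq_iff.trans ((h'.eq_iff hxy hxy').trans
          Sum.inr_injective.eq_iff.symm)
      | exact iff_of_false Sum.inl_ne_inr Sum.inl_ne_inr
      | exact iff_of_false Sum.inr_ne_inl Sum.inr_ne_inl
  · intro i
    induction i using Fin.addCases with
    | left i => simpa [MRFG.union] using hinl (h.root i)
    | right i => simpa [MRFG.union] using hinr (h'.root i)
  · rintro (x | x)
    · exact (h.total_left x).imp (fun ⟨y, hy⟩ => ⟨Sum.inl y, hinl hy⟩) (union_isAcyclic_inl T)
    · exact (h'.total_left x).imp (fun ⟨y, hy⟩ => ⟨Sum.inr y, hinr hy⟩) ac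
  · rintro (x | x)
    · exact (h.total_right x).imp (fun ⟨y, hy⟩ => ⟨Sum.inl y, hinl hy⟩) (union_isAcyclic_inl U)
    · exact (h'.total_right x).imp (fun ⟨y, hy⟩ => ⟨Sum.inr y, hinr hy⟩) ac

/-- An isomorphism of multi-rooted featured graphs is a matching. -/
lemma locallyMatched_of_iso {G H : MRFG S k} (f : G.graph ≃g H.graph)
    (hroot : ∀ i, f (G.root i) = H.root i) (hfeat : ∀ x, H.feat (f x) = G.feat x) (R : ℕ) :
    LocallyMatched R G H (fun x y => f x = y) := by
  have deep : ∀ r x, Deep G.graph H.graph (fun x y => f x = y) r x (f x) := by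
    intro r
    induction r with
    | zero => exact fun _ => rfl
    | succ r ih =>
      refine fun x => ⟨rfl, fun x' hx' => ⟨f x', f.map_adj_iff.2 hx', ih x'⟩, fun y' hy' => ?_⟩
      obtain ⟨x', rfl⟩ := f.surjective y'
      exact ⟨x', f.map_adj_iff.1 hy', ih x'⟩
  refine ⟨?_, ?_, ?_, ?_, ?_, ?_⟩
  · rintro x _ rfl
    exact (hfeat x).symm
  · rintro x _ x' _ rfl rfl
    exact f.map_adj_iff.symm
  · rintro x _ x' _ rfl rfl
    exact f.injective.eq_iff.symm
  · intro i
    simpa [hroot] using deep R (G.root i)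
  · exact fun x => .inl ⟨_, deep R x⟩
  · intro y
    obtain ⟨x, rfl⟩ := f.surjective y
    exact .inl ⟨x, deep R x⟩

lemma locallyMatched_refl (R : ℕ) (G : MRFG S k) : LocallyMatched R G G (fun x y => x = y) :=
  locallyMatched_of_iso (Iso.refl) (fun _ => rfl) (fun _ => rfl) R

lemma LocallyEquiv.union_right {R : ℕ} {G H : MRFG S k} (h : LocallyEquiv R G H) (T : MRFG S l) :
    LocallyEquiv R (G.union T) (H.union T) := by
  obtain ⟨M, hM⟩ := h
  exact ⟨_, hM.union (locallyMatched_refl R T)⟩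

/-- The ball of radius `r` around `v` with its induced structure, rooted at `v`. -/
def ballAt (G : MRFG S k) (v : G.V) (r : ℕ) : MRFG S 1 where
  V := {x // x ∈ G.graph.walkBall v r}
  graph := G.graph.induce (G.graph.walkBall v r)
  finite_nbrs x := Set.Finite.of_finite_image
    ((G.finite_nbrs x.1).subset (by rintro _ ⟨y, hy, rfl⟩; exact hy)) Subtype.val_injective.injOn
  root _ := ⟨v, G.graph.self_mem_walkBall v r⟩
  feat x := G.feat x.1

/-- A vertex that is not matched deeply has an acyclic ball, and no deeply matched vertex comes near
that ball. The tree is the ball itself: a detached copy of it next to `H` looks from its root, up to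
radius `R`, like the ball inside `G`. -/
lemma LocallyMatched.exists_of_not_deep {R : ℕ} {G H : MRFG S k} {M : G.V → H.V → Prop}
    (h : LocallyMatched (3 * R + 1) G H M) {v : G.V}
    (hv : ∀ w, ¬ Deep G.graph H.graph M R v w) :
    ∃ T : RootedFeaturedTree S, LocallyEquiv R (G.addRoot v) (H.union T.1) := by
  classical
  have hac : (G.graph.induce (G.graph.walkBall v R)).IsAcyclic := by
    rcases h.total_left v with ⟨w, hw⟩ | hac
    · exact absurd (hw.mono (by omega)) (hv w)
    · exact isAcyclic_walkBall_mono (by omega) hac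
  have htree : (G.ballAt v R).graph.IsTree := ⟨connected_induce_walkBall _ _ _, hac⟩
  refine ⟨⟨G.ballAt v R, htree⟩, ?_⟩
  -- If `x` were within one step of the ball, then `v` would be within `R + 1` steps of `x`, and
  -- walking there would leave depth `R` at `v`.
  have sep : ∀ {x y x'}, Deep G.graph H.graph M (2 * R + 1) x y → x' ∈ G.graph.walkBall v R →
      x' ∉ G.graph.walkBall x 1 := by
    intro x y x' hxy hx' hxx'
    obtain ⟨w, hw⟩ := Deep.of_mem_walkBall (q := R) (r := R + 1) (hxy.mono (by omega))
      (by simpa [add_comm] using walkBall_trans hxx' (walkBall_symm hx'))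
    exact hv w hw
  -- The old matching is cut down to depth `2 * R + 1`, so that by `sep` it neither meets nor
  -- touches the ball. Depth `R` for `M'` then costs `3 * R + 1` for `M`.
  let M' : (G.addRoot v).V → (H.union (G.ballAt v R)).V → Prop := fun x z =>
    Sum.elim (fun y => Deep G.graph H.graph M (2 * R + 1) x y)
      (fun t : (G.ballAt v R).V => t.1 = x) z
  have hinl : ∀ {r x y}, r ≤ R → Deep G.graph H.graph M (2 * R + 1 + r) x y →
      Deep (G.addRoot v).graph (H.union (G.ballAt v R)).graph M' r x (Sum.inl y) := by
    intro r x y _ hxy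
    refine Deep.imp (f := id) (g := Sum.inl) (fun _ _ h => h) ?_ ?_ ?_ ?_ hxy
    · exact fun x x' hx => ⟨x', rfl, hx⟩
    · exact fun x x' hx => union_adj_inl.1 hx
    · exact fun x x' hx => hx
    · exact fun x x' hx => union_adj_inl.2 ⟨_, rfl, hx⟩
  -- A vertex at distance at most `j` from `v` can move `R - j` more steps before leaving the ball.
  have hinr : ∀ r x (hx : x ∈ G.graph.walkBall v R) (j : ℕ), x ∈ G.graph.walkBall v j →
      j + r ≤ R →
      Deep (G.addRoot v).graph (H.union (G.ballAt v R)).graph M' r x (Sum.inr ⟨x, hx⟩) := by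
    intro r
    induction r with
    | zero => exact fun x hx j hj hjr => rfl
    | succ r ih =>
      intro x hx j hj hjr
      refine ⟨rfl, fun x' hx' => ?_, fun z hz => ?_⟩
      · have hx'j : x' ∈ G.graph.walkBall v (j + 1) := walkBall_trans hj hx'.mem_walkBall
        have hx'R := G.graph.walkBall_mono v (by omega : j + 1 ≤ R) hx'j
        exact ⟨Sum.inr ⟨x', hx'R⟩, union_adj_inr.2 ⟨_, rfl, hx'⟩, ih x' hx'R _ hx'j (by omega)⟩
      · obtain ⟨⟨x', hx'R⟩, rfl, hx'⟩ := union_adj_inr.1 hz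
        have hx' : G.graph.Adj x x' := hx'
        exact ⟨x', hx', ih x' hx'R (j + 1) (walkBall_trans hj hx'.mem_walkBall) (by omega)⟩
  refine ⟨M', ?_, ?_, ?_, ?_, ?_, ?_⟩
  · rintro x (y | ⟨t, ht⟩) hxy
    · exact h.feat_eq (Deep.mem hxy)
    · obtain rfl : t = x := hxy
      rfl
  · rintro x (y | ⟨t, ht⟩) x' (y' | ⟨t', ht'⟩) hxy hxy'
    · exact h.adj_iff (Deep.mem hxy) (Deep.mem hxy')
    · obtain rfl : t' = x' := hxy'
      exact iff_of_false (fun hadj => sep hxy ht' hadj.mem_walkBall) (by simp [MRFG.union])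
    · obtain rfl : t = x := hxy
      exact iff_of_false (fun hadj => sep hxy' ht hadj.symm.mem_walkBall) (by simp [MRFG.union])
    · obtain rfl : t = x := hxy
      obtain rfl : t' = x' := hxy'
      exact Iff.rfl
  · rintro x (y | ⟨t, ht⟩) x' (y' | ⟨t', ht'⟩) hxy hxy'
    · exact (h.eq_iff (Deep.mem hxy) (Deep.mem hxy')).trans Sum.inl_injective.eq_iff.symm
    · obtain rfl : t' = x' := hxy'
      refine iff_of_false ?_ Sum.inl_ne_inr
      rintro rfl
      exact sep hxy ht' (G.graph.self_mem_walkBall _ 1)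
    · obtain rfl : t = x := hxy
      refine iff_of_false ?_ Sum.inr_ne_inl
      rintro rfl
      exact sep hxy' ht (G.graph.self_mem_walkBall _ 1)
    · obtain rfl : t = x := hxy
      obtain rfl : t' = x' := hxy'
      exact Subtype.mk_eq_mk.symm.trans Sum.inr_injective.eq_iff.symm
  · intro i
    induction i using Fin.lastCases with
    | last =>
      have := hinr R v (G.graph.self_mem_walkBall v R) 0 (G.graph.self_mem_walkBall v 0) (by omega)
      have e : (Fin.last k) = Fin.natAdd k (0 : Fin 1) := rfl
      simp only [MRFG.addRoot, MRFG.union, Fin.snoc_last]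
      rw [e, Fin.append_right]
      exact this
    | cast i =>
      have := hinl le_rfl ((h.root i).mono (by omega))
      have e : Fin.castSucc i = Fin.castAdd 1 i := rfl
      simp only [MRFG.addRoot, MRFG.union, Fin.snoc_castSucc]
      rw [e, Fin.append_left]
      exact this
  · intro x
    rcases h.total_left x with ⟨y, hy⟩ | hac
    · exact .inl ⟨Sum.inl y, hinl le_rfl (hy.mono (by omega))⟩
    · exact .inr (isAcyclic_walkBall_mono (s := 3 * R + 1) (by omega) hac)
  · rintro (y | t)
    · rcases h.total_right y with ⟨x, hx⟩ | hac
      · exact .inl ⟨x, hinl le_rfl (hx.mono (by omega))⟩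
      · exact .inr (union_isAcyclic_inl _ (isAcyclic_walkBall_mono (by omega) hac))
    · exact .inr (union_isAcyclic_inr H htree.isAcyclic t R)

lemma LocallyMatched.exists_addRoot {R : ℕ} {G H : MRFG S k} {M : G.V → H.V → Prop}
    (h : LocallyMatched (3 * R + 1) G H M) (v : G.V) :
    (∃ w, LocallyEquiv R (G.addRoot v) (H.addRoot w)) ∨
      ∃ T : RootedFeaturedTree S, LocallyEquiv R (G.addRoot v) (H.union T.1) := by
  by_cases hv : ∃ w, Deep G.graph H.graph M R v w
  · obtain ⟨w, hw⟩ := hv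
    exact .inl ⟨w, M, (h.mono (by omega)).addRoot hw⟩
  · exact .inr (h.exists_of_not_deep (not_exists.1 hv))

lemma mem_nbrs {G : MRFG S k} {v x : G.V} : x ∈ G.nbrs v ↔ G.graph.Adj v x := by
  simp [nbrs]

end MRFG

/-! ### Locality of controllers. -/

open MRFG

/-- Every controller is local: it takes equal values on graphs that agree up to a certain radius. -/
theorem AggTerm.exists_locality_radius {d : ℕ} {S : Set (Fin d → ℝ)} (c : ℝ≥0) (D : Measure S)
    {k : ℕ} (τ : AggTerm d k) :
    ∃ R, ∀ G H : MRFG S k, LocallyEquiv R G H → τ.controller c D G = τ.controller c D H := by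
  induction τ with
  | val i j =>
    refine ⟨0, fun G H ⟨M, h⟩ => ?_⟩
    simp only [controller]
    rw [h.feat_eq (h.root j)]
  | const a => exact ⟨0, fun G H _ => rfl⟩
  | edge i j =>
    refine ⟨0, fun G H ⟨M, h⟩ => ?_⟩
    simp only [controller]
    rw [h.adj_iff (h.root i).mem (h.root j).mem]
  | equal i j =>
    refine ⟨0, fun G H ⟨M, h⟩ => ?_⟩
    simp only [controller]
    rw [h.eq_iff (h.root i).mem (h.root j).mem]
  | app F hF π ih =>
    choose R hR using ih
    refine ⟨Finset.univ.sup R, fun G H h => ?_⟩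
    simp only [controller]
    congr 1
    funext l
    exact hR l G H (h.mono (Finset.le_sup (Finset.mem_univ l)))
  | mean π ih =>
    obtain ⟨R, hR⟩ := ih
    -- The same tree is added on both sides, which costs no radius.
    refine ⟨R, fun G H h => ?_⟩
    simp only [controller]
    exact integral_congr_ae (.of_forall fun ω => hR _ _ (h.union_right _))
  | lmean i π ih =>
    obtain ⟨R, hR⟩ := ih
    -- One unit of depth is spent on moving from the root to its neighbours; the matching restricts
    -- to a bijection between the two neighbourhoods.
    refine ⟨R + 1, fun G H ⟨M, h⟩ => ?_⟩
    simp only [controller]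
    have hr := h.root i
    have key : ∀ x, G.graph.Adj (G.root i) x → ∃ y, H.graph.Adj (H.root i) y ∧
        Deep G.graph H.graph M R x y := hr.2.1
    choose f hf hf' using key
    have inj : ∀ x (hx : x ∈ G.nbrs (G.root i)) x' (hx' : x' ∈ G.nbrs (G.root i)),
        f x (mem_nbrs.1 hx) = f x' (mem_nbrs.1 hx') → x = x' := by
      intro x hx x' hx' hxx'
      exact (h.eq_iff (hf' x (mem_nbrs.1 hx)).mem (hf' x' (mem_nbrs.1 hx')).mem).2 hxx'
    have surj : ∀ y ∈ H.nbrs (H.root i), ∃ x, ∃ hx : x ∈ G.nbrs (G.root i),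
        f x (mem_nbrs.1 hx) = y := by
      intro y hy
      obtain ⟨x, hx, hxy⟩ := hr.2.2 y (mem_nbrs.1 hy)
      exact ⟨x, mem_nbrs.2 hx, (h.eq_iff (hf' x hx).mem hxy.mem).1 rfl⟩
    have maps : ∀ x (hx : x ∈ G.nbrs (G.root i)), f x (mem_nbrs.1 hx) ∈ H.nbrs (H.root i) :=
      fun x hx => mem_nbrs.2 (hf x (mem_nbrs.1 hx))
    rw [Finset.card_bij (fun x hx => f x (mem_nbrs.1 hx)) maps inj surj]
    congr 1
    refine Finset.sum_bij (fun x hx => f x (mem_nbrs.1 hx)) maps inj surj ?_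
    intro x hx
    exact hR _ _ ⟨M, (h.mono (Nat.le_succ R)).addRoot (hf' x (mem_nbrs.1 hx))⟩
  | sup π ih =>
    obtain ⟨R, hR⟩ := ih
    -- A new root of `G` is answered by a vertex of `H` or by a tree, so only the union of the two
    -- ranges is preserved, not each of them.
    refine ⟨3 * R + 1, fun G H h => ?_⟩
    have key : ∀ G H : MRFG S _, LocallyEquiv (3 * R + 1) G H →
        (Set.range fun v : G.V => π.controller c D (G.addRoot v)) ∪
          (Set.range fun T : RootedFeaturedTree S => π.controller c D (G.union T.1)) ⊆
        (Set.range fun v : H.V => π.controller c D (H.addRoot v)) ∪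
          (Set.range fun T : RootedFeaturedTree S => π.controller c D (H.union T.1)) := by
      rintro G H h _ (⟨v, rfl⟩ | ⟨T, rfl⟩)
      · obtain ⟨M, hM⟩ := h
        rcases hM.exists_addRoot v with ⟨w, hw⟩ | ⟨T, hT⟩
        · exact .inl ⟨w, (hR _ _ hw).symm⟩
        · exact .inr ⟨T, (hR _ _ hT).symm⟩
      · exact .inr ⟨T, (hR _ _ ((h.mono (by omega)).union_right T.1)).symm⟩
    simp only [controller]
    rw [(key G H h).antisymm (key H G h.symm)]

/-! ### Boundedness of controllers. -/

instance instIsProbabilityMeasureFbpLaw {d : ℕ} {S : Set (Fin d → ℝ)} (c : ℝ≥0) (D : Measure S)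
    [IsProbabilityMeasure D] : IsProbabilityMeasure (fbpLaw c D) := by
  unfold fbpLaw
  infer_instance

/-- Controllers are bounded. -/
theorem AggTerm.exists_controller_bound {d : ℕ} {S : Set (Fin d → ℝ)} (hS : IsCompact S)
    (c : ℝ≥0) (D : Measure S) [IsProbabilityMeasure D] {k : ℕ} (τ : AggTerm d k) :
    ∃ B : ℝ, 0 ≤ B ∧ ∀ G : MRFG S k, |τ.controller c D G| ≤ B := by
  induction τ with
  | val i j =>
    obtain ⟨B, hB⟩ := hS.isBounded.exists_norm_le
    refine ⟨max B 0, le_max_right _ _, fun G => ?_⟩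
    simp only [controller]
    exact ((norm_le_pi_norm (G.feat (G.root j) : Fin d → ℝ) i).trans
      (hB _ (G.feat (G.root j)).2)).trans (le_max_left _ _)
  | const a => exact ⟨|a|, abs_nonneg a, fun G => le_rfl⟩
  | edge i j =>
    refine ⟨1, zero_le_one, fun G => ?_⟩
    simp only [controller]
    split_ifs <;> simp
  | equal i j =>
    refine ⟨1, zero_le_one, fun G => ?_⟩
    simp only [controller]
    split_ifs <;> simp
  | @app k m F hF π ih =>
    obtain ⟨K, hK⟩ := hF
    choose B hB0 hB using ih
    refine ⟨|F 0| + K * ∑ l, B l, ?_, fun G => ?_⟩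
    · have := Finset.sum_nonneg fun l (_ : l ∈ Finset.univ) => hB0 l
      positivity
    simp only [controller]
    have h1 := hK.dist_le_mul (fun l => (π l).controller c D G) 0
    rw [Real.dist_eq, dist_zero_right] at h1
    have h2 : ‖fun l => (π l).controller c D G‖ ≤ ∑ l, B l := by
      refine (pi_norm_le_iff_of_nonneg (Finset.sum_nonneg fun l _ => hB0 l)).2 fun l => ?_
      exact (hB l G).trans (Finset.single_le_sum (f := B) (fun l _ => hB0 l) (Finset.mem_univ l))
    have h3 := mul_le_mul_of_nonneg_left h2 K.2
    have h4 := abs_sub_abs_le_abs_sub (F fun l => (π l).controller c D G) (F 0)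
    simp only [NNReal.val_eq_coe] at h3
    linarith
  | mean π ih =>
    obtain ⟨B, hB0, hB⟩ := ih
    refine ⟨B, hB0, fun G => ?_⟩
    simp only [controller]
    have := norm_integral_le_of_norm_le_const (μ := fbpLaw c D)
      (f := fun ω => π.controller c D (G.union (branchingTree ω)))
      (.of_forall fun ω => hB _)
    simpa using this
  | lmean i π ih =>
    obtain ⟨B, hB0, hB⟩ := ih
    refine ⟨B, hB0, fun G => ?_⟩
    simp only [controller]
    rw [abs_div, Nat.abs_cast]
    refine div_le_of_le_mul₀ (Nat.cast_nonneg _) hB0 ?_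
    refine (Finset.abs_sum_le_sum_abs _ _).trans ?_
    refine (Finset.sum_le_card_nsmul _ _ B fun v _ => hB _).trans ?_
    simp [mul_comm]
  | sup π ih =>
    obtain ⟨B, hB0, hB⟩ := ih
    refine ⟨B, hB0, fun G => ?_⟩
    simp only [controller]
    set A := (Set.range fun v : G.V => π.controller c D (G.addRoot v)) ∪
        (Set.range fun T : RootedFeaturedTree S => π.controller c D (G.union T.1)) with hA
    have hmem : ∀ a ∈ A, |a| ≤ B := by
      rintro a (⟨v, rfl⟩ | ⟨T, rfl⟩)
      · exact hB _
      · exact hB _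
    rcases A.eq_empty_or_nonempty with h | h
    · simp [h, hB0]
    · refine abs_le.2 ⟨?_, csSup_le h fun a ha => (abs_le.1 (hmem a ha)).2⟩
      obtain ⟨a, ha⟩ := h
      exact (abs_le.1 (hmem a ha)).1.trans
        (le_csSup ⟨B, fun a ha => (abs_le.1 (hmem a ha)).2⟩ ha)

/-! ### Branching trees and their truncations. -/

section BranchingTree

variable {d k : ℕ} {S : Set (Fin d → ℝ)}

/-- Every edge is a bridge: once the edge from `v` to its parent is removed, no walk leaves the set
of descendants of `v`, that is, of words with suffix `v`. -/
lemma branchingTree_isAcyclic (ω : List ℕ → ℕ × S) : (branchingTree ω).graph.IsAcyclic := by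
  rw [isAcyclic_iff_forall_adj_isBridge]
  have key : ∀ v w : (branchingTree ω).V, (∃ i, v.1 = i :: w.1) →
      ¬ ((branchingTree ω).graph \ fromEdgeSet {s(v, w)}).Reachable v w := by
    rintro v w ⟨i, hvw⟩ hr
    have inv : ∀ x y, ((branchingTree ω).graph \ fromEdgeSet {s(v, w)}).Adj x y →
        v.1 <:+ x.1 → v.1 <:+ y.1 := by
      rintro x y ⟨hxy, hne⟩ hx
      rcases hxy with ⟨j, hj⟩ | ⟨j, hj⟩
      · rw [hj, List.suffix_cons_iff] at hx
        rcases hx with hx | hx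
        · exfalso
          obtain rfl : v = x := Subtype.ext (hx.trans hj.symm)
          obtain rfl : w = y := Subtype.ext (by
            rw [hvw] at hx
            exact (List.cons.inj hx).2)
          apply hne
          simp only [fromEdgeSet_adj, Set.mem_singleton_iff, true_and]
          rintro rfl
          simpa using congrArg List.length hvw
        · exact hx
      · rw [hj]
        exact hx.trans (List.suffix_cons j x.1)
    obtain ⟨p⟩ := hr
    have : ∀ {x y} (_ : ((branchingTree ω).graph \ fromEdgeSet {s(v, w)}).Walk x y),
        v.1 <:+ x.1 → v.1 <:+ y.1 := by
      intro x y p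
      induction p with
      | nil => exact id
      | cons h _ ih => exact fun hx => ih (inv _ _ h hx)
    have hlen := (this p (List.suffix_refl _)).length_le
    rw [hvw] at hlen
    simp at hlen
  intro v w hvw
  rw [isBridge_iff]
  rcases hvw with h | h
  · exact key v w h
  · intro hr
    apply key w v h
    rw [Sym2.eq_swap]
    exact hr.symm

/-- The families `ω` and `ω'` generate the same tree with the same features up to depth `R`. -/
def AgreeUpTo (R : ℕ) (ω ω' : List ℕ → ℕ × S) : Prop :=
  ∀ w, IsNode (fun w => (ω w).1) w → w.length ≤ R →
    (ω w).2 = (ω' w).2 ∧ (w.length < R → (ω w).1 = (ω' w).1)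

lemma AgreeUpTo.isNode {R : ℕ} {ω ω' : List ℕ → ℕ × S} (h : AgreeUpTo R ω ω') {w : List ℕ}
    (hw : IsNode (fun w => (ω w).1) w) (hR : w.length ≤ R) : IsNode (fun w => (ω' w).1) w := by
  induction w with
  | nil => trivial
  | cons i w ih =>
    have hlen : w.length + 1 ≤ R := by simpa using hR
    refine ⟨?_, ih hw.2 (by omega)⟩
    have := (h w hw.2 (by omega)).2 (by omega)
    simp only [← this]
    exact hw.1

lemma AgreeUpTo.symm {R : ℕ} {ω ω' : List ℕ → ℕ × S} (h : AgreeUpTo R ω ω') :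
    AgreeUpTo R ω' ω := by
  have node : ∀ w, IsNode (fun w => (ω' w).1) w → w.length ≤ R → IsNode (fun w => (ω w).1) w := by
    intro w
    induction w with
    | nil => exact fun _ _ => trivial
    | cons i w ih =>
      intro hw hR
      have hlen : w.length + 1 ≤ R := by simpa using hR
      have hn := ih hw.2 (by omega)
      refine ⟨?_, hn⟩
      have := (h w hn (by omega)).2 (by omega)
      simp only [this]
      exact hw.1
  intro w hw hR
  exact ⟨(h w (node w hw hR) hR).1.symm, fun hlt => ((h w (node w hw hR) hR).2 hlt).symm⟩

/-- Words of length at most `R` are matched with themselves. Deeper nodes need no partner, since all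
balls in both trees are acyclic. -/
lemma AgreeUpTo.locallyEquiv {R : ℕ} {ω ω' : List ℕ → ℕ × S} (h : AgreeUpTo R ω ω') :
    LocallyEquiv R (branchingTree ω) (branchingTree ω') := by
  let M : (branchingTree ω).V → (branchingTree ω').V → Prop := fun x y =>
    x.1 = y.1 ∧ x.1.length ≤ R
  have deep : ∀ r (x : (branchingTree ω).V) (y : (branchingTree ω').V), x.1 = y.1 →
      x.1.length + r ≤ R → Deep (branchingTree ω).graph (branchingTree ω').graph M r x y := by
    intro r
    induction r with
    | zero => exact fun x y hxy hr => ⟨hxy, hr⟩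
    | succ r ih =>
      intro x y hxy hr
      refine ⟨⟨hxy, by omega⟩, ?_, ?_⟩
      · rintro x' (⟨i, hx'⟩ | ⟨i, hx'⟩)
        · have hlen : x'.1.length + 1 = x.1.length := by rw [hx']; simp
          refine ⟨⟨x'.1, h.isNode x'.2 (by omega)⟩, .inl ⟨i, hxy ▸ hx'⟩, ih _ _ rfl (by omega)⟩
        · have hlen : x'.1.length = x.1.length + 1 := by rw [hx']; simp
          refine ⟨⟨x'.1, h.isNode x'.2 (by omega)⟩, .inr ⟨i, hxy ▸ hx'⟩, ih _ _ rfl (by omega)⟩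
      · rintro x' (⟨i, hx'⟩ | ⟨i, hx'⟩)
        · have hlen : x'.1.length + 1 = y.1.length := by rw [hx']; simp
          refine ⟨⟨x'.1, h.symm.isNode x'.2 (by rw [← hxy] at hlen; omega)⟩,
            .inl ⟨i, hxy ▸ hx'⟩, ih _ _ rfl (by rw [← hxy] at hlen; dsimp only; omega)⟩
        · have hlen : x'.1.length = y.1.length + 1 := by rw [hx']; simp
          refine ⟨⟨x'.1, h.symm.isNode x'.2 (by rw [← hxy] at hlen; omega)⟩,
            .inr ⟨i, hxy ▸ hx'⟩, ih _ _ rfl (by rw [← hxy] at hlen; dsimp only; omega)⟩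
  refine ⟨M, ?_, ?_, ?_, ?_, ?_, ?_⟩
  · rintro ⟨x, hx⟩ ⟨y, hy⟩ ⟨rfl, hR⟩
    exact (h x hx hR).1
  · rintro ⟨x, hx⟩ ⟨y, hy⟩ ⟨x', hx'⟩ ⟨y', hy'⟩ ⟨rfl, hR⟩ ⟨rfl, hR'⟩
    exact Iff.rfl
  · rintro ⟨x, hx⟩ ⟨y, hy⟩ ⟨x', hx'⟩ ⟨y', hy'⟩ ⟨rfl, hR⟩ ⟨rfl, hR'⟩
    exact Subtype.mk_eq_mk.trans Subtype.mk_eq_mk.symm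
  · intro i
    exact deep R _ _ rfl (by simp [branchingTree])
  · exact fun x => .inr ((branchingTree_isAcyclic ω).induce _)
  · exact fun x => .inr ((branchingTree_isAcyclic ω').induce _)

lemma MRFG.LocallyEquiv.union_left {R l : ℕ} {T U : MRFG S l} (h : LocallyEquiv R T U)
    (G : MRFG S k) : LocallyEquiv R (G.union T) (G.union U) := by
  obtain ⟨M, hM⟩ := h
  exact ⟨_, (locallyMatched_refl R G).union hM⟩

end BranchingTree

/-! ### Lipschitz dependence on features and continuity in the branching data. -/

/-- The graph `G` with its features replaced. -/
def MRFG.withFeat {d k : ℕ} {S : Set (Fin d → ℝ)} (G : MRFG S k) (χ : G.V → S) : MRFG S k :=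
  { G with feat := χ }

section Lipschitz

variable {d : ℕ} {S : Set (Fin d → ℝ)}

lemma finite_setOf_isNode (N : List ℕ → ℕ) (R : ℕ) : {w | IsNode N w ∧ w.length ≤ R}.Finite := by
  induction R with
  | zero =>
    refine (Set.finite_singleton []).subset ?_
    rintro w ⟨-, hw⟩
    simpa using hw
  | succ R ih =>
    refine ((Set.finite_singleton []).union
      (ih.biUnion fun w _ => (Set.finite_Iio (N w)).image fun i => i :: w)).subset ?_
    rintro (_ | ⟨i, w⟩) ⟨hw, hlen⟩
    · exact .inl rfl
    · right
      simp only [Set.mem_iUnion]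
      exact ⟨w, ⟨hw.2, by simpa using hlen⟩, i, hw.1, rfl⟩

/-- By locality only the finitely many nodes of depth at most `R` matter. Close to `ω₀` their
offspring numbers are those of `ω₀`, by discreteness, and their features are nearly those of `ω₀`.
-/
lemma AggTerm.continuous_of_local_of_lipschitz {k : ℕ} {f : MRFG S (k + 1) → ℝ} {R : ℕ} {L : ℝ}
    (hR : ∀ G H, LocallyEquiv R G H → f G = f H)
    (hL : ∀ (G : MRFG S (k + 1)) (χ : G.V → S) (η : ℝ), 0 ≤ η → (∀ x, dist (G.feat x) (χ x) ≤ η) →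
      |f G - f (G.withFeat χ)| ≤ L * η) (G : MRFG S k) :
    Continuous fun ω : List ℕ → ℕ × S => f (G.union (branchingTree ω)) := by
  classical
  rw [continuous_iff_continuousAt]
  intro ω₀
  rw [ContinuousAt, Metric.tendsto_nhds]
  intro ε hε
  set W := {w | IsNode (fun w => (ω₀ w).1) w ∧ w.length ≤ R} with hW
  have hWfin : W.Finite := finite_setOf_isNode _ R
  obtain ⟨η, hη, hηL⟩ : ∃ η : ℝ, 0 < η ∧ L * η < ε := by
    refine ⟨ε / (|L| + 1), by positivity, ?_⟩
    have h1 : L * (ε / (|L| + 1)) ≤ |L| * (ε / (|L| + 1)) :=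
      mul_le_mul_of_nonneg_right (le_abs_self L) (by positivity)
    have h2 : |L| * (ε / (|L| + 1)) = ε - ε / (|L| + 1) := by field_simp; ring
    have : 0 < ε / (|L| + 1) := by positivity
    linarith
  have hev : ∀ᶠ ω in 𝓝 ω₀, ∀ w ∈ W, (ω w).1 = (ω₀ w).1 ∧ dist (ω w).2 (ω₀ w).2 < η := by
    rw [hWfin.eventually_all]
    intro w _
    have h1 : ContinuousAt (fun ω : List ℕ → ℕ × S => (ω w).1) ω₀ :=
      (continuous_fst.comp (continuous_apply w)).continuousAt
    have h2 : ContinuousAt (fun ω : List ℕ → ℕ × S => (ω w).2) ω₀ :=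
      (continuous_snd.comp (continuous_apply w)).continuousAt
    exact (h1.eventually (p := fun m => m = (ω₀ w).1) (by simp [nhds_discrete])).and
      (h2.eventually (Metric.ball_mem_nhds _ hη))
  filter_upwards [hev] with ω hω
  let χ : (branchingTree ω₀).V → S := fun w => if w.1 ∈ W then (ω w.1).2 else (ω₀ w.1).2
  -- An intermediate family: it agrees with `ω` up to depth `R`, and its tree is that of `ω₀` with
  -- other features. Locality handles the first comparison, the Lipschitz bound the second.
  let ω₁ : List ℕ → ℕ × S := fun w => ((ω₀ w).1, if w ∈ W then (ω w).2 else (ω₀ w).2)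
  have hagree : AgreeUpTo R ω₁ ω := by
    intro w hw hlen
    have hwW : w ∈ W := ⟨hw, hlen⟩
    exact ⟨by simp [ω₁, hwW], fun _ => (hω w hwW).1.symm⟩
  have e1 : f (G.union (branchingTree ω)) = f (G.union (branchingTree ω₁)) :=
    (hR _ _ (hagree.locallyEquiv.union_left G)).symm
  have e2 : G.union (branchingTree ω₁) =
      (G.union (branchingTree ω₀)).withFeat (Sum.elim G.feat χ) := rfl
  rw [e1, e2, dist_comm, Real.dist_eq]
  refine (hL _ _ η hη.le ?_).trans_lt hηL
  rintro (x | x)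
  · change dist (G.feat x) (G.feat x) ≤ η
    rw [dist_self]
    exact hη.le
  · change dist ((ω₀ x.1).2) (if x.1 ∈ W then (ω x.1).2 else (ω₀ x.1).2) ≤ η
    split_ifs with hx
    · rw [dist_comm]
      exact (hω x.1 hx).2.le
    · rw [dist_self]
      exact hη.le

lemma AggTerm.integrable_of_continuous (c : ℝ≥0) (D : Measure S) [IsProbabilityMeasure D]
    {f : (List ℕ → ℕ × S) → ℝ} (hf : Continuous f) {B : ℝ} (hB : ∀ ω, |f ω| ≤ B) :
    Integrable f (fbpLaw c D) :=
  Integrable.of_bound hf.measurable.aestronglyMeasurable B (.of_forall hB)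

lemma abs_csSup_range_sub_le {ι : Sort*} {f g : ι → ℝ} {ε B : ℝ} (hε : 0 ≤ ε)
    (hf : ∀ i, |f i| ≤ B) (hg : ∀ i, |g i| ≤ B) (h : ∀ i, |f i - g i| ≤ ε) :
    |sSup (Set.range f) - sSup (Set.range g)| ≤ ε := by
  rcases isEmpty_or_nonempty ι with hι | hι
  · simp [Set.range_eq_empty, hε]
  have key : ∀ {f g : ι → ℝ}, (∀ i, |g i| ≤ B) → (∀ i, |f i - g i| ≤ ε) →
      sSup (Set.range f) ≤ sSup (Set.range g) + ε := by
    intro f g hg h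
    refine csSup_le (Set.range_nonempty f) ?_
    rintro _ ⟨i, rfl⟩
    have h1 : g i ≤ sSup (Set.range g) :=
      le_csSup ⟨B, by rintro _ ⟨j, rfl⟩; exact (abs_le.1 (hg j)).2⟩ ⟨i, rfl⟩
    have h2 := (abs_le.1 (h i)).2
    linarith
  have h1 := key hg h
  have h2 := key hf fun i => by rw [abs_sub_comm]; exact h i
  exact abs_le.2 ⟨by linarith, by linarith⟩

/-- Controllers are Lipschitz functions of the features, for the uniform distance. -/
theorem AggTerm.exists_controller_lipschitz (hS : IsCompact S) (c : ℝ≥0) (D : Measure S)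
    [IsProbabilityMeasure D] {k : ℕ} (τ : AggTerm d k) :
    ∃ L : ℝ, 0 ≤ L ∧ ∀ (G : MRFG S k) (χ : G.V → S) (η : ℝ), 0 ≤ η →
      (∀ x, dist (G.feat x) (χ x) ≤ η) →
      |τ.controller c D G - τ.controller c D (G.withFeat χ)| ≤ L * η := by
  induction τ with
  | val i j =>
    refine ⟨1, zero_le_one, fun G χ η hη h => ?_⟩
    simp only [controller, one_mul]
    refine le_trans ?_ (h (G.root j))
    exact dist_le_pi_dist (G.feat (G.root j) : Fin d → ℝ) (χ (G.root j) : Fin d → ℝ) i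
  | const a => exact ⟨0, le_rfl, fun G χ η hη h => by simp [controller]⟩
  | edge i j =>
    refine ⟨0, le_rfl, fun G χ η hη h => ?_⟩
    rw [show (edge i j).controller c D (G.withFeat χ) = (edge i j).controller c D G from rfl]
    simp
  | equal i j =>
    refine ⟨0, le_rfl, fun G χ η hη h => ?_⟩
    rw [show (equal i j).controller c D (G.withFeat χ) = (equal i j).controller c D G from rfl]
    simp
  | app F hF π ih =>
    obtain ⟨K, hK⟩ := hF
    choose L hL0 hL using ih
    refine ⟨K * ∑ l, L l, ?_, fun G χ η hη h => ?_⟩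
    · have := Finset.sum_nonneg fun l (_ : l ∈ Finset.univ) => hL0 l
      positivity
    simp only [controller]
    refine (hK.dist_le_mul (fun l => (π l).controller c D G)
      (fun l => (π l).controller c D (G.withFeat χ))).trans ?_
    rw [mul_assoc]
    refine mul_le_mul_of_nonneg_left ?_ K.2
    refine (dist_pi_le_iff (mul_nonneg (Finset.sum_nonneg fun l _ => hL0 l) hη)).2 fun l => ?_
    exact (hL l G χ η hη h).trans (mul_le_mul_of_nonneg_right
      (Finset.single_le_sum (f := L) (fun l _ => hL0 l) (Finset.mem_univ l)) hη)
  | mean π ih =>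
    obtain ⟨L, hL0, hL⟩ := ih
    obtain ⟨R, hR⟩ := π.exists_locality_radius (S := S) c D
    obtain ⟨B, hB0, hB⟩ := π.exists_controller_bound hS c D
    refine ⟨L, hL0, fun G χ η hη h => ?_⟩
    simp only [controller]
    -- Subtracting the integrals requires measurability of the integrand. It comes from continuity,
    -- hence from the Lipschitz bound for `π` just obtained.
    have hint : ∀ G : MRFG S _, Integrable
        (fun ω => π.controller c D (G.union (branchingTree ω))) (fbpLaw c D) := fun G =>
      integrable_of_continuous c D (continuous_of_local_of_lipschitz hR hL G) fun ω => hB _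
    rw [← integral_sub (hint G) (hint (G.withFeat χ))]
    have := norm_integral_le_of_norm_le_const (μ := fbpLaw c D) (C := L * η)
      (f := fun ω => π.controller c D (G.union (branchingTree ω)) -
        π.controller c D ((G.withFeat χ).union (branchingTree ω))) (.of_forall fun ω => ?_)
    · simpa using this
    · refine hL (G.union (branchingTree ω)) (Sum.elim χ (branchingTree ω).feat) η hη ?_
      rintro (x | x)
      · exact h x
      · change dist ((branchingTree ω).feat x) ((branchingTree ω).feat x) ≤ η
        rw [dist_self]
        exact hη
  | lmean i π ih =>
    obtain ⟨L, hL0, hL⟩ := ih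
    refine ⟨L, hL0, fun G χ η hη h => ?_⟩
    simp only [controller]
    change |_ - (∑ v ∈ G.nbrs (G.root i), π.controller c D ((G.addRoot v).withFeat χ)) /
      ((G.nbrs (G.root i)).card : ℝ)| ≤ L * η
    rw [← sub_div, ← Finset.sum_sub_distrib, abs_div, Nat.abs_cast]
    refine div_le_of_le_mul₀ (Nat.cast_nonneg _) (by positivity) ?_
    refine (Finset.abs_sum_le_sum_abs _ _).trans ?_
    refine (Finset.sum_le_card_nsmul _ _ (L * η) fun v _ => hL (G.addRoot v) χ η hη h).trans ?_
    simp [mul_comm]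
  | sup π ih =>
    obtain ⟨L, hL0, hL⟩ := ih
    obtain ⟨B, hB0, hB⟩ := π.exists_controller_bound hS c D
    refine ⟨L, hL0, fun G χ η hη h => ?_⟩
    simp only [controller]
    rw [← Set.Sum.elim_range, ← Set.Sum.elim_range]
    refine abs_csSup_range_sub_le (B := B) (by positivity) ?_ ?_ ?_
    · rintro (v | T)
      · exact hB _
      · exact hB _
    · rintro (v | T)
      · exact hB _
      · exact hB _
    · rintro (v | T)
      · exact hL (G.addRoot v) χ η hη h
      · refine hL (G.union T.1) (Sum.elim χ T.1.feat) η hη ?_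
        rintro (x | x)
        · exact h x
        · change dist (T.1.feat x) (T.1.feat x) ≤ η
          rw [dist_self]
          exact hη

lemma AggTerm.continuous_controller_union_branchingTree (hS : IsCompact S) (c : ℝ≥0)
    (D : Measure S) [IsProbabilityMeasure D] {k : ℕ} (π : AggTerm d (k + 1)) (G : MRFG S k) :
    Continuous fun ω : List ℕ → ℕ × S => π.controller c D (G.union (branchingTree ω)) := by
  obtain ⟨L, hL0, hL⟩ := π.exists_controller_lipschitz hS c D
  obtain ⟨R, hR⟩ := π.exists_locality_radius (S := S) c D
  exact continuous_of_local_of_lipschitz hR hL G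

lemma AggTerm.integrable_controller_union_branchingTree (hS : IsCompact S) (c : ℝ≥0)
    (D : Measure S) [IsProbabilityMeasure D] {k : ℕ} (π : AggTerm d (k + 1)) (G : MRFG S k) :
    Integrable (fun ω => π.controller c D (G.union (branchingTree ω))) (fbpLaw c D) := by
  obtain ⟨B, hB0, hB⟩ := π.exists_controller_bound hS c D
  exact integrable_of_continuous c D (π.continuous_controller_union_branchingTree hS c D G)
    fun ω => hB _

end Lipschitz

/-! ### Disjoint unions with roots distributed over both components. -/

namespace MRFG

variable {d k : ℕ} {S : Set (Fin d → ℝ)}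

/-- The disjoint union of `G` and `H`, whose `i`-th root is that of `G` if `s i` holds, and that
of `H` otherwise. -/
def mix (s : Fin k → Bool) (G H : MRFG S k) : MRFG S k where
  V := G.V ⊕ H.V
  graph := G.graph.sum H.graph
  finite_nbrs := (G.union H).finite_nbrs
  root i := if s i then Sum.inl (G.root i) else Sum.inr (H.root i)
  feat := Sum.elim G.feat H.feat

/-- The graph `T` with its root repeated `k` times. -/
def repeatRoot (T : MRFG S 1) (k : ℕ) : MRFG S k := { T with root := fun _ => T.root 0 }

/-- Both components of a `mix` carry a full tuple of roots, but `s` selects which are used. Thus `y`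
is a dummy root and may be arbitrary; it only has to exist. -/
lemma mix_addRoot_inl (s : Fin k → Bool) (G H : MRFG S k) (x : G.V) (y : H.V) :
    (mix s G H).addRoot (Sum.inl x) = mix (Fin.snoc s true) (G.addRoot x) (H.addRoot y) := by
  simp only [addRoot, mix]
  congr 1
  funext i
  induction i using Fin.lastCases with
  | last => simp
  | cast i => simp

lemma mix_addRoot_inr (s : Fin k → Bool) (G H : MRFG S k) (x : G.V) (y : H.V) :
    (mix s G H).addRoot (Sum.inr y) = mix (Fin.snoc s false) (G.addRoot x) (H.addRoot y) := by
  simp only [addRoot, mix]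
  congr 1
  funext i
  induction i using Fin.lastCases with
  | last => simp
  | cast i => simp

lemma union_eq_mix (G : MRFG S k) (T : MRFG S 1) (x : G.V) :
    G.union T = mix (Fin.snoc (fun _ => true) false) (G.addRoot x) (T.repeatRoot (k + 1)) := by
  simp only [addRoot, mix, union, repeatRoot]
  congr 1
  funext i
  induction i using Fin.lastCases with
  | last =>
    have e : Fin.last k = Fin.natAdd k (0 : Fin 1) := rfl
    simp only [Fin.snoc_last]
    rw [e, Fin.append_right]
    simp
  | cast i =>
    have e : Fin.castSucc i = Fin.castAdd 1 i := rfl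
    simp only [Fin.snoc_castSucc]
    rw [e, Fin.append_left]
    simp

lemma mix_root_of_true {s : Fin k → Bool} {i : Fin k} (h : s i = true) (G H : MRFG S k) :
    (mix s G H).root i = Sum.inl (G.root i) := if_pos h

lemma mix_root_of_false {s : Fin k → Bool} {i : Fin k} (h : s i = false) (G H : MRFG S k) :
    (mix s G H).root i = Sum.inr (H.root i) := if_neg (by simp [h])

lemma mix_swap (s : Fin k → Bool) (G H : MRFG S k) (R : ℕ) :
    LocallyEquiv R (mix s G H) (mix (fun i => !s i) H G) := by
  refine ⟨_, locallyMatched_of_iso (Iso.sumComm) ?_ ?_ R⟩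
  · intro i
    cases h : s i
    · rw [mix_root_of_false h, mix_root_of_true (by simp [h])]
      rfl
    · rw [mix_root_of_true h, mix_root_of_false (by simp [h])]
      rfl
  · rintro (x | x) <;> rfl

lemma union_root_castSucc (G : MRFG S k) (T : MRFG S 1) (i : Fin k) :
    (G.union T).root i.castSucc = Sum.inl (G.root i) := by
  have e : Fin.castSucc i = Fin.castAdd 1 i := rfl
  simp only [union]
  rw [e, Fin.append_left]

lemma union_root_last (G : MRFG S k) (T : MRFG S 1) :
    (G.union T).root (Fin.last k) = Sum.inr (T.root 0) := by
  have e : Fin.last k = Fin.natAdd k (0 : Fin 1) := rfl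
  simp only [union]
  rw [e, Fin.append_right]

/-- The inclusion of the first summand. -/
def mixInl (s : Fin k → Bool) (G H : MRFG S k) : G.V ↪ (mix s G H).V := ⟨Sum.inl, Sum.inl_injective⟩

/-- The inclusion of the second summand. -/
def mixInr (s : Fin k → Bool) (G H : MRFG S k) : H.V ↪ (mix s G H).V := ⟨Sum.inr, Sum.inr_injective⟩

lemma mix_nbrs_of_true {s : Fin k → Bool} {i : Fin k} (h : s i = true) (G H : MRFG S k) :
    (mix s G H).nbrs ((mix s G H).root i) = (G.nbrs (G.root i)).map (mixInl s G H) := by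
  ext z
  rw [mem_nbrs, mix_root_of_true h, Finset.mem_map]
  simp only [mem_nbrs]
  rcases z with z | z
  · exact ⟨fun hz => ⟨z, hz, rfl⟩, fun ⟨y, hy, hyz⟩ => Sum.inl_injective hyz ▸ hy⟩
  · exact iff_of_false (by simp [mix]) fun ⟨y, hy, hyz⟩ => Sum.inl_ne_inr hyz

lemma mix_nbrs_of_false {s : Fin k → Bool} {i : Fin k} (h : s i = false) (G H : MRFG S k) :
    (mix s G H).nbrs ((mix s G H).root i) = (H.nbrs (H.root i)).map (mixInr s G H) := by
  ext z
  rw [mem_nbrs, mix_root_of_false h, Finset.mem_map]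
  simp only [mem_nbrs]
  rcases z with z | z
  · exact iff_of_false (by simp [mix]) fun ⟨y, hy, hyz⟩ => Sum.inr_ne_inl hyz
  · exact ⟨fun hz => ⟨z, hz, rfl⟩, fun ⟨y, hy, hyz⟩ => Sum.inr_injective hyz ▸ hy⟩

/-- The underlying graph isomorphism exchanging the last two summands. -/
def mixUnionIso (s : Fin k → Bool) (G H : MRFG S k) (T : MRFG S 1) (y : H.V) :
    ((mix s G H).union T).graph ≃g
      (mix (Fin.snoc s true) (G.union T) (H.addRoot y)).graph where
  toFun := Sum.elim (Sum.elim (fun x => Sum.inl (Sum.inl x)) Sum.inr) (fun x => Sum.inl (Sum.inr x))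
  invFun := Sum.elim (Sum.elim (fun x => Sum.inl (Sum.inl x)) Sum.inr)
    (fun x => Sum.inl (Sum.inr x))
  left_inv := by rintro ((x | x) | x) <;> rfl
  right_inv := by rintro ((x | x) | x) <;> rfl
  map_rel_iff' := by rintro ((x | x) | x) ((y | y) | y) <;> exact Iff.rfl

/-- The tree is absorbed by the first component, so that the second one remains `H`, up to the dummy
root `y`. -/
lemma mix_union (s : Fin k → Bool) (G H : MRFG S k) (T : MRFG S 1) (y : H.V) (R : ℕ) :
    LocallyEquiv R ((mix s G H).union T) (mix (Fin.snoc s true) (G.union T) (H.addRoot y)) := by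
  refine ⟨_, locallyMatched_of_iso (mixUnionIso s G H T y) ?_ ?_ R⟩
  · intro i
    induction i using Fin.lastCases with
    | last =>
      rw [mix_root_of_true (by simp), union_root_last, union_root_last]
      rfl
    | cast i =>
      rw [union_root_castSucc]
      cases h : s i
      · rw [mix_root_of_false h, mix_root_of_false (by simpa using h)]
        simp only [addRoot, Fin.snoc_castSucc]
        rfl
      · rw [mix_root_of_true h, mix_root_of_true (by simpa using h), union_root_castSucc]
        rfl
  · rintro ((x | x) | x) <;> rfl

end MRFG

/-! ### Finitely many types of components, up to a given error. -/

section Coloring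

/-- A bounded function is constant up to `ε` on the classes of a finite colouring. -/
lemma exists_finite_coloring {X : Type*} (f : X → ℝ) {B : ℝ} (hf : ∀ x, |f x| ≤ B) {ε : ℝ}
    (hε : 0 < ε) :
    ∃ (C : Type) (_ : Finite C) (κ : X → C), ∀ x y, κ x = κ y → |f x - f y| ≤ ε := by
  refine ⟨Set.Icc ⌊-B / ε⌋ ⌊B / ε⌋, inferInstance, fun x => ⟨⌊f x / ε⌋, ?_, ?_⟩, ?_⟩
  · exact Int.floor_mono (div_le_div_of_nonneg_right (abs_le.1 (hf x)).1 hε.le)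
  · exact Int.floor_mono (div_le_div_of_nonneg_right (abs_le.1 (hf x)).2 hε.le)
  · intro x y hxy
    have h := Int.abs_sub_lt_one_of_floor_eq_floor (congrArg Subtype.val hxy)
    rw [← sub_div, abs_div, abs_of_pos hε, div_lt_one hε] at h
    exact h.le

-- Grouping the terms by colour: if `f` is nearly a function of the colour, its average depends on
-- `s` only through the colour frequencies, whatever the size of `s`.
open Classical in
lemma average_sub_sum_frequency_le {α C : Type*} [Fintype C] (s : Finset α) (κ : α → C)
    (f : α → ℝ) (r : C → ℝ) {ε : ℝ} (hε : 0 ≤ ε) (h : ∀ x ∈ s, |f x - r (κ x)| ≤ ε) :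
    |(∑ x ∈ s, f x) / s.card - ∑ a, ((s.filter fun x => κ x = a).card / s.card : ℝ) * r a| ≤ ε := by
  have e : ∑ a, ((s.filter fun x => κ x = a).card / s.card : ℝ) * r a =
      (∑ x ∈ s, r (κ x)) / s.card := by
    rw [← Finset.sum_fiberwise s κ, Finset.sum_div]
    refine Finset.sum_congr rfl fun a _ => ?_
    rw [Finset.sum_congr rfl (g := fun _ => r a)
      (fun x hx => by rw [(Finset.mem_filter.1 hx).2])]
    simp only [Finset.sum_const, nsmul_eq_mul]
    ring
  rw [e, ← sub_div, ← Finset.sum_sub_distrib, abs_div, Nat.abs_cast]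
  refine div_le_of_le_mul₀ (Nat.cast_nonneg _) hε ?_
  refine (Finset.abs_sum_le_sum_abs _ _).trans ?_
  refine (Finset.sum_le_card_nsmul _ _ ε h).trans ?_
  simp [mul_comm]

variable {d : ℕ} {S : Set (Fin d → ℝ)}

lemma AggTerm.controller_eq_of_forall_locallyEquiv (c : ℝ≥0) (D : Measure S) {k : ℕ}
    (τ : AggTerm d k) {G H : MRFG S k} (h : ∀ R, LocallyEquiv R G H) :
    τ.controller c D G = τ.controller c D H := by
  obtain ⟨R, hR⟩ := τ.exists_locality_radius (S := S) c D
  exact hR _ _ (h R)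

/-- A multi-rooted featured graph has finitely many types, up to `ε`, as a component of a larger
graph, as far as the controller of `τ` is concerned. -/
theorem AggTerm.exists_coloring (hS : IsCompact S) (c : ℝ≥0) (D : Measure S)
    [IsProbabilityMeasure D] {k : ℕ} (τ : AggTerm d k) :
    ∀ (s : Fin k → Bool) (ε : ℝ), 0 < ε →
      ∃ (C : Type) (_ : Finite C) (κ : MRFG S k → C), ∀ H H', Nonempty H.V → Nonempty H'.V →
        κ H = κ H' → ∀ G, Nonempty G.V →
          |τ.controller c D (mix s G H) - τ.controller c D (mix s G H')| ≤ ε := by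
  induction τ with
  | val i j =>
    intro s ε hε
    obtain ⟨B, hB0, hB⟩ := (AggTerm.val i j).exists_controller_bound hS c D
    obtain ⟨C, hC, κ, hκ⟩ := exists_finite_coloring _ hB hε
    refine ⟨C, hC, κ, fun H H' _ _ hHH' G _ => ?_⟩
    have := hκ _ _ hHH'
    simp only [controller] at this ⊢
    cases h : s j
    · rw [mix_root_of_false h, mix_root_of_false h]
      exact this
    · rw [mix_root_of_true h, mix_root_of_true h]
      simpa [mix] using hε.le
  | const a =>
    intro s ε hε
    exact ⟨Unit, inferInstance, fun _ => (), fun H H' _ _ _ G _ => by simpa [controller] using hε.le⟩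
  | edge i j =>
    intro s ε hε
    refine ⟨Prop, inferInstance, fun H => H.graph.Adj (H.root i) (H.root j),
      fun H H' _ _ hHH' G _ => ?_⟩
    have : (mix s G H).graph.Adj ((mix s G H).root i) ((mix s G H).root j) ↔
        (mix s G H').graph.Adj ((mix s G H').root i) ((mix s G H').root j) := by
      cases hi : s i <;> cases hj : s j <;>
        simp only [mix_root_of_false, mix_root_of_true, hi, hj] <;>
        first
        | exact Iff.rfl
        | exact iff_of_eq hHH'
    simp only [controller]
    rw [this, sub_self, abs_zero]
    exact hε.le
  | equal i j =>
    intro s ε hε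
    refine ⟨Prop, inferInstance, fun H => H.root i = H.root j,
      fun H H' _ _ hHH' G _ => ?_⟩
    have : (mix s G H).root i = (mix s G H).root j ↔
        (mix s G H').root i = (mix s G H').root j := by
      cases hi : s i <;> cases hj : s j <;>
        simp only [mix_root_of_false, mix_root_of_true, hi, hj]
      · exact Sum.inr_injective.eq_iff.trans ((iff_of_eq hHH').trans Sum.inr_injective.eq_iff.symm)
      · exact iff_of_false Sum.inr_ne_inl Sum.inr_ne_inl
      · exact iff_of_false Sum.inl_ne_inr Sum.inl_ne_inr
      · exact Sum.inl_injective.eq_iff.trans Sum.inl_injective.eq_iff.symm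
    simp only [controller]
    rw [this, sub_self, abs_zero]
    exact hε.le
  | app F hF π ih =>
    intro s ε hε
    obtain ⟨K, hK⟩ := hF
    have hK1 : (0 : ℝ) < K + 1 := by positivity
    choose C hC κ hκ using fun l => ih l s (ε / (K + 1)) (by positivity)
    refine ⟨∀ l, C l, inferInstance, fun H l => κ l H, fun H H' hH hH' hHH' G hG => ?_⟩
    simp only [controller]
    refine (hK.dist_le_mul (fun l => (π l).controller c D (mix s G H))
      (fun l => (π l).controller c D (mix s G H'))).trans ?_
    have h1 : Dist.dist (fun l => (π l).controller c D (mix s G H))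
        (fun l => (π l).controller c D (mix s G H')) ≤ ε / (K + 1) :=
      (dist_pi_le_iff (by positivity)).2 fun l => hκ l H H' hH hH' (congrFun hHH' l) G hG
    refine (mul_le_mul_of_nonneg_left h1 K.2).trans ?_
    rw [NNReal.val_eq_coe, mul_div_assoc', div_le_iff₀ hK1]
    nlinarith [K.2]
  | mean π ih =>
    intro s ε hε
    obtain ⟨C, hC, κ, hκ⟩ := ih (Fin.snoc s true) ε hε
    -- The random tree joins `G`, so `H` merely receives a dummy root. Recording the colours for all
    -- dummy roots lets one find roots of `H` and `H'` with the same colour.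
    refine ⟨Set C, inferInstance, fun H => Set.range fun x => κ (H.addRoot x),
      fun H H' hH hH' hHH' G hG => ?_⟩
    obtain ⟨y⟩ := id hH
    obtain ⟨y', hy'⟩ : κ (H.addRoot y) ∈ Set.range fun x => κ (H'.addRoot x) := by
      exact hHH'.subset (Set.mem_range_self y)
    simp only [controller]
    rw [← integral_sub (π.integrable_controller_union_branchingTree hS c D _)
      (π.integrable_controller_union_branchingTree hS c D _)]
    have := norm_integral_le_of_norm_le_const (μ := fbpLaw c D) (C := ε)
      (f := fun ω => π.controller c D ((mix s G H).union (branchingTree ω)) -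
        π.controller c D ((mix s G H').union (branchingTree ω))) (.of_forall fun ω => ?_)
    · simpa using this
    · rw [π.controller_eq_of_forall_locallyEquiv c D (mix_union s G H _ y),
        π.controller_eq_of_forall_locallyEquiv c D (mix_union s G H' _ y')]
      exact hκ _ _ hH hH' hy'.symm _ ⟨Sum.inl hG.some⟩
  | lmean i π ih =>
    intro s ε hε
    cases hi : s i
    -- Here the local mean runs over neighbours in `H`. Degrees are unbounded, but the frequencies
    -- of the colours among the neighbours lie in the unit interval; the colour of `H` records them
    -- up to a small mesh.
    · obtain ⟨C, hC, κ, hκ⟩ := ih (Fin.snoc s false) (ε / 3) (by positivity)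
      obtain ⟨B, hB0, hB⟩ := π.exists_controller_bound hS c D
      have := Fintype.ofFinite C
      classical
      let freq : C → MRFG S _ → ℝ := fun a H =>
        (((H.nbrs (H.root i)).filter fun x => κ (H.addRoot x) = a).card /
          (H.nbrs (H.root i)).card : ℝ)
      have hfreq : ∀ a H, |freq a H| ≤ 1 := by
        intro a H
        rw [abs_of_nonneg (by positivity)]
        exact div_le_one_of_le₀ (by exact_mod_cast Finset.card_filter_le _ _) (by positivity)
      -- The mesh makes the errors of all frequencies, each weighted by at most `B`, add up to at
      -- most `ε / 3`.
      have hη : 0 < ε / (3 * (B + 1) * (Fintype.card C + 1)) := by positivity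
      choose C' hC' κ' hκ' using fun a => exists_finite_coloring (freq a) (hfreq a) hη
      refine ⟨∀ a, C' a, inferInstance, fun H a => κ' a H, fun H H' hH hH' hHH' G hG => ?_⟩
      obtain ⟨g⟩ := hG
      -- The value next to `G` of one component of colour `a`. It depends on `G` but not on `H`, so
      -- it is common to the averages for `H` and `H'`.
      let rep : C → ℝ := fun a =>
        if h : ∃ K : MRFG S _, Nonempty K.V ∧ κ K = a then
          π.controller c D (mix (Fin.snoc s false) (G.addRoot g) h.choose) else 0
      have hrepB : ∀ a, |rep a| ≤ B := by
        intro a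
        simp only [rep]
        split_ifs
        · exact hB _
        · simpa using hB0
      have hrep : ∀ K : MRFG S _, Nonempty K.V →
          |π.controller c D (mix (Fin.snoc s false) (G.addRoot g) K) - rep (κ K)| ≤ ε / 3 := by
        intro K hK
        have h : ∃ K' : MRFG S _, Nonempty K'.V ∧ κ K' = κ K := ⟨K, hK, rfl⟩
        simp only [rep, dif_pos h]
        exact hκ _ _ hK h.choose_spec.1 h.choose_spec.2.symm _ ⟨g⟩
      have key : ∀ H : MRFG S _, Nonempty H.V →
          |(lmean i π).controller c D (mix s G H) - ∑ a, freq a H * rep a| ≤ ε / 3 := by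
        intro H hH
        have e : (lmean i π).controller c D (mix s G H) = (∑ y ∈ H.nbrs (H.root i),
            π.controller c D (mix (Fin.snoc s false) (G.addRoot g) (H.addRoot y))) /
              (H.nbrs (H.root i)).card := by
          simp only [controller]
          rw [mix_nbrs_of_false hi, Finset.card_map, Finset.sum_map]
          congr 1
          refine Finset.sum_congr rfl fun y _ => ?_
          rw [← mix_addRoot_inr s G H g y]
          rfl
        rw [e]
        exact average_sub_sum_frequency_le _ _ _ _ (by positivity) fun y _ => hrep _ hH
      have hsum : |∑ a, freq a H * rep a - ∑ a, freq a H' * rep a| ≤ ε / 3 := by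
        rw [← Finset.sum_sub_distrib]
        refine (Finset.abs_sum_le_sum_abs _ _).trans ?_
        refine (Finset.sum_le_card_nsmul _ _
          (ε / (3 * (B + 1) * (Fintype.card C + 1)) * B) fun a _ => ?_).trans ?_
        · rw [← sub_mul, abs_mul]
          exact mul_le_mul (hκ' a _ _ (congrFun hHH' a)) (hrepB a) (abs_nonneg _) hη.le
        · rw [nsmul_eq_mul, Finset.card_univ]
          have h1 : (0 : ℝ) ≤ Fintype.card C := Nat.cast_nonneg _
          rw [div_mul_eq_mul_div, mul_div_assoc', div_le_div_iff₀ (by positivity) (by norm_num)]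
          have h2 : (Fintype.card C : ℝ) * B ≤ (B + 1) * (Fintype.card C + 1) := by nlinarith
          nlinarith
      have h1 := abs_le.1 (key H hH)
      have h2 := abs_le.1 (key H' hH')
      have h3 := abs_le.1 hsum
      exact abs_le.2 ⟨by linarith [h1.1, h2.2, h3.1], by linarith [h1.2, h2.1, h3.2]⟩
    · obtain ⟨C, hC, κ, hκ⟩ := ih (Fin.snoc s true) ε hε
      refine ⟨Set C, inferInstance, fun H => Set.range fun x => κ (H.addRoot x),
        fun H H' hH hH' hHH' G hG => ?_⟩
      obtain ⟨y⟩ := id hH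
      obtain ⟨y', hy'⟩ : κ (H.addRoot y) ∈ Set.range fun x => κ (H'.addRoot x) := by
        exact hHH'.subset (Set.mem_range_self y)
      have e : ∀ (H : MRFG S _) (y : H.V), (lmean i π).controller c D (mix s G H) =
          (∑ x ∈ G.nbrs (G.root i),
            π.controller c D (mix (Fin.snoc s true) (G.addRoot x) (H.addRoot y))) /
              (G.nbrs (G.root i)).card := by
        intro H y
        simp only [controller]
        rw [mix_nbrs_of_true hi, Finset.card_map, Finset.sum_map]
        congr 1
        refine Finset.sum_congr rfl fun x _ => ?_
        rw [← mix_addRoot_inl s G H x y]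
        rfl
      rw [e H y, e H' y', ← sub_div, ← Finset.sum_sub_distrib, abs_div, Nat.abs_cast]
      refine div_le_of_le_mul₀ (Nat.cast_nonneg _) hε.le ?_
      refine (Finset.abs_sum_le_sum_abs _ _).trans ?_
      refine (Finset.sum_le_card_nsmul _ _ ε fun x _ => hκ _ _ hH hH' hy'.symm _ hG).trans ?_
      simp [mul_comm]
  | sup π ih =>
    intro s ε hε
    obtain ⟨C₁, hC₁, κ₁, hκ₁⟩ := ih (Fin.snoc s true) ε hε
    obtain ⟨C₂, hC₂, κ₂, hκ₂⟩ := ih (Fin.snoc s false) ε hε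
    obtain ⟨B, hB0, hB⟩ := π.exists_controller_bound hS c D
    -- The first set serves new roots in `G` and new trees, where `H` gets a dummy root; the second
    -- serves new roots in `H`, each of which must be imitated in `H'`.
    refine ⟨Set C₁ × Set C₂, inferInstance, fun H => (Set.range fun x => κ₁ (H.addRoot x),
      Set.range fun x => κ₂ (H.addRoot x)), ?_⟩
    have key : ∀ H H' : MRFG S _, Nonempty H.V → Nonempty H'.V →
        (Set.range fun x => κ₁ (H.addRoot x)) = (Set.range fun x => κ₁ (H'.addRoot x)) →
        (Set.range fun x => κ₂ (H.addRoot x)) = (Set.range fun x => κ₂ (H'.addRoot x)) →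
        ∀ G, Nonempty G.V → (AggTerm.sup π).controller c D (mix s G H) ≤
          (AggTerm.sup π).controller c D (mix s G H') + ε := by
      intro H H' hH hH' h₁ h₂ G hG
      obtain ⟨g⟩ := id hG
      obtain ⟨y⟩ := id hH
      obtain ⟨y', hy'⟩ : κ₁ (H.addRoot y) ∈ Set.range fun x => κ₁ (H'.addRoot x) := by
        rw [← h₁]
        exact ⟨y, rfl⟩
      simp only [controller]
      have hbdd : BddAbove ((Set.range fun v => π.controller c D ((mix s G H').addRoot v)) ∪
          (Set.range fun T : RootedFeaturedTree S =>
            π.controller c D ((mix s G H').union T.1))) := by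
        refine ⟨B, ?_⟩
        rintro _ (⟨v, rfl⟩ | ⟨T, rfl⟩)
        · exact (abs_le.1 (hB _)).2
        · exact (abs_le.1 (hB _)).2
      refine csSup_le ⟨_, .inl ⟨Sum.inl g, rfl⟩⟩ ?_
      rintro _ (⟨x | x, rfl⟩ | ⟨T, rfl⟩)
      · have h := hκ₁ _ _ hH hH' hy'.symm (G.addRoot x) hG
        rw [← mix_addRoot_inl, ← mix_addRoot_inl] at h
        have h' := le_csSup hbdd (.inl ⟨Sum.inl x, rfl⟩)
        have h'' := (abs_le.1 h).2
        dsimp only at h' ⊢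
        linarith
      · obtain ⟨x', hx'⟩ : κ₂ (H.addRoot x) ∈ Set.range fun x => κ₂ (H'.addRoot x) := by
          rw [← h₂]
          exact ⟨x, rfl⟩
        have h := hκ₂ _ _ hH hH' hx'.symm (G.addRoot g) hG
        rw [← mix_addRoot_inr, ← mix_addRoot_inr] at h
        have h' := le_csSup hbdd (.inl ⟨Sum.inr x', rfl⟩)
        have h'' := (abs_le.1 h).2
        dsimp only at h' ⊢
        linarith
      · have h := hκ₁ _ _ hH hH' hy'.symm (G.union T.1) ⟨Sum.inl g⟩
        rw [← π.controller_eq_of_forall_locallyEquiv c D (mix_union s G H _ y),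
          ← π.controller_eq_of_forall_locallyEquiv c D (mix_union s G H' _ y')] at h
        have h' := le_csSup hbdd (.inr ⟨T, rfl⟩)
        have h'' := (abs_le.1 h).2
        dsimp only at h' ⊢
        linarith
    intro H H' hH hH' hHH' G hG
    have h₁ := congrArg Prod.fst hHH'
    have h₂ := congrArg Prod.snd hHH'
    have a := key H H' hH hH' h₁ h₂ G hG
    have b := key H' H hH' hH h₁.symm h₂.symm G hG
    exact abs_le.2 ⟨by linarith, by linarith⟩

end Coloring

/-! ### Universal covers. -/

section Cover

variable {V : Type*}

open Classical in
/-- The universal cover at `v` of the graph with neighbourhoods `nb`. The word `w` codes a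
non-backtracking walk from `v`; the value at `w` is the endpoint of that walk, with its neighbours
other than the previous vertex. -/
noncomputable def coverAux (nb : V → Finset V) (v : V) : List ℕ → V × Finset V
  | [] => (v, nb v)
  | i :: w => ((coverAux nb v w).2.toList.getD i v,
      (nb ((coverAux nb v w).2.toList.getD i v)).erase (coverAux nb v w).1)

/-- The vertex under the node `w` of the universal cover. -/
noncomputable def coverPos (nb : V → Finset V) (v : V) (w : List ℕ) : V := (coverAux nb v w).1

/-- The vertices under the children of the node `w` of the universal cover. -/
noncomputable def coverChildren (nb : V → Finset V) (v : V) (w : List ℕ) : Finset V :=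
  (coverAux nb v w).2

/-- `w` is a node of the universal cover. -/
def IsCoverNode (nb : V → Finset V) (v : V) (w : List ℕ) : Prop :=
  IsNode (fun w => (coverChildren nb v w).card) w

/-- The universal cover is injective up to depth `R`. -/
def CoverInjective (nb : V → Finset V) (v : V) (R : ℕ) : Prop :=
  ∀ w w', IsCoverNode nb v w → IsCoverNode nb v w' → w.length ≤ R → w'.length ≤ R →
    coverPos nb v w = coverPos nb v w' → w = w'

variable {nb : V → Finset V} {v : V}

lemma coverPos_nil : coverPos nb v [] = v := rfl

lemma coverChildren_nil : coverChildren nb v [] = nb v := rfl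

lemma coverPos_cons (i : ℕ) (w : List ℕ) :
    coverPos nb v (i :: w) = (coverChildren nb v w).toList.getD i v := rfl

open Classical in
lemma coverChildren_cons (i : ℕ) (w : List ℕ) :
    coverChildren nb v (i :: w) = (nb (coverPos nb v (i :: w))).erase (coverPos nb v w) := rfl

lemma Finset.getD_toList_mem {α : Type*} (s : Finset α) {i : ℕ} (hi : i < s.card) (a : α) :
    s.toList.getD i a ∈ s := by
  rw [List.getD_eq_getElem _ _ (by simpa using hi), ← Finset.mem_toList]
  exact List.getElem_mem _

lemma Finset.getD_toList_injective {α : Type*} (s : Finset α) {i j : ℕ} (hi : i < s.card)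
    (hj : j < s.card) {a : α} (h : s.toList.getD i a = s.toList.getD j a) : i = j := by
  rw [List.getD_eq_getElem _ _ (by simpa using hi),
    List.getD_eq_getElem _ _ (by simpa using hj)] at h
  exact (List.Nodup.getElem_inj_iff s.nodup_toList).1 h

lemma Finset.exists_getD_toList_eq {α : Type*} {s : Finset α} {x : α} (hx : x ∈ s) (a : α) :
    ∃ i < s.card, s.toList.getD i a = x := by
  obtain ⟨i, hi, rfl⟩ := List.getElem_of_mem (Finset.mem_toList.2 hx)
  exact ⟨i, by simpa using hi, List.getD_eq_getElem _ _ _⟩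

variable {G : SimpleGraph V}

lemma IsCoverNode.adj (hnb : ∀ x y, y ∈ nb x ↔ G.Adj x y) {i : ℕ} {w : List ℕ}
    (h : IsCoverNode nb v (i :: w)) : G.Adj (coverPos nb v w) (coverPos nb v (i :: w)) := by
  classical
  rw [← hnb]
  have h1 : coverPos nb v (i :: w) ∈ coverChildren nb v w := Finset.getD_toList_mem _ h.1 _
  cases w with
  | nil => exact h1
  | cons j w =>
    rw [coverChildren_cons] at h1
    exact Finset.mem_of_mem_erase h1

/-- The only neighbour erased from the children of a node is the vertex under its parent. -/
lemma IsCoverNode.mem_nb (hnb : ∀ x y, y ∈ nb x ↔ G.Adj x y) {w : List ℕ}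
    (h : IsCoverNode nb v w) {y : V} :
    G.Adj (coverPos nb v w) y ↔ (∃ i, IsCoverNode nb v (i :: w) ∧ y = coverPos nb v (i :: w)) ∨
      ∃ i w', w = i :: w' ∧ y = coverPos nb v w' := by
  classical
  constructor
  · intro hy
    rw [← hnb] at hy
    by_cases hc : y ∈ coverChildren nb v w
    · left
      obtain ⟨i, hi, hiy⟩ := Finset.exists_getD_toList_eq hc v
      exact ⟨i, ⟨hi, h⟩, hiy.symm⟩
    · right
      cases w with
      | nil => exact absurd hy hc
      | cons j w =>
        refine ⟨j, w, rfl, ?_⟩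
        rw [coverChildren_cons, Finset.mem_erase, not_and'] at hc
        exact not_not.1 (hc hy)
  · rintro (⟨i, hi, rfl⟩ | ⟨i, w', rfl, rfl⟩)
    · exact hi.adj hnb
    · exact (h.adj hnb).symm

lemma IsCoverNode.mem_walkBall (hnb : ∀ x y, y ∈ nb x ↔ G.Adj x y) {w : List ℕ}
    (h : IsCoverNode nb v w) : coverPos nb v w ∈ G.walkBall v w.length := by
  induction w with
  | nil => exact G.self_mem_walkBall v 0
  | cons i w ih => exact walkBall_trans (ih h.2) (h.adj hnb).mem_walkBall

lemma exists_isCoverNode_of_mem_walkBall (hnb : ∀ x y, y ∈ nb x ↔ G.Adj x y) {r : ℕ} {x : V}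
    (hx : x ∈ G.walkBall v r) :
    ∃ w, IsCoverNode nb v w ∧ w.length ≤ r ∧ coverPos nb v w = x := by
  induction r generalizing x with
  | zero =>
    obtain rfl := mem_walkBall_zero.1 hx
    exact ⟨[], trivial, le_rfl, rfl⟩
  | succ r ih =>
    rcases mem_walkBall_succ' hx with rfl | ⟨y, hy, hyx⟩
    · exact ⟨[], trivial, Nat.zero_le _, rfl⟩
    · obtain ⟨w, hw, hwr, rfl⟩ := ih hy
      rcases (hw.mem_nb hnb).1 hyx with ⟨i, hi, rfl⟩ | ⟨i, w', rfl, rfl⟩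
      · exact ⟨i :: w, hi, by simpa using hwr, rfl⟩
      · exact ⟨w', hw.2, by simp at hwr; omega, rfl⟩

lemma CoverInjective.mono {R R' : ℕ} (hR : R' ≤ R) (h : CoverInjective nb v R) :
    CoverInjective nb v R' := fun w w' hw hw' hl hl' =>
  h w w' hw hw' (hl.trans hR) (hl'.trans hR)

/-- A neighbour lies under a child or under the parent, and injectivity identifies that node with
`w'`. The child may have depth `R + 1`, hence the extra level. -/
lemma CoverInjective.adj_iff (hnb : ∀ x y, y ∈ nb x ↔ G.Adj x y) {R : ℕ}
    (h : CoverInjective nb v (R + 1)) {w w' : List ℕ} (hw : IsCoverNode nb v w)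
    (hw' : IsCoverNode nb v w') (hl : w.length ≤ R) (hl' : w'.length ≤ R) :
    G.Adj (coverPos nb v w) (coverPos nb v w') ↔ (∃ i, w = i :: w') ∨ ∃ i, w' = i :: w := by
  rw [hw.mem_nb hnb]
  constructor
  · rintro (⟨i, hi, he⟩ | ⟨i, w'', rfl, he⟩)
    · exact .inr ⟨i, h _ _ hw' hi (by omega) (by simpa using hl) he⟩
    · have := h _ _ hw' hw.2 (by omega) (by simp at hl; omega) he
      exact .inl ⟨i, by rw [this]⟩
  · rintro (⟨i, rfl⟩ | ⟨i, rfl⟩)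
    · exact .inr ⟨i, w', rfl, rfl⟩
    · exact .inl ⟨i, hw', rfl⟩

/-- Geodesics from `v` through `y` and through `z` are both paths to `x`, hence equal, and have the
same penultimate vertex. -/
lemma SimpleGraph.IsTree.eq_of_adj_of_dist (hG : G.IsTree) {v x y z : V} (hy : G.Adj x y)
    (hz : G.Adj x z) (hy' : G.dist v y + 1 = G.dist v x) (hz' : G.dist v z + 1 = G.dist v x) :
    y = z := by
  obtain ⟨p, hp⟩ := hG.connected.exists_walk_length_eq_dist v y
  obtain ⟨q, hq⟩ := hG.connected.exists_walk_length_eq_dist v z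
  have hp' : (p.concat hy.symm).IsPath :=
    Walk.isPath_of_length_eq_dist _ (by rw [Walk.length_concat, hp, hy'])
  have hq' : (q.concat hz.symm).IsPath :=
    Walk.isPath_of_length_eq_dist _ (by rw [Walk.length_concat, hq, hz'])
  have h := congrArg Subtype.val ((hG.isAcyclic.subsingleton_path v x).elim ⟨_, hp'⟩ ⟨_, hq'⟩)
  have := congrArg Walk.penultimate h
  simpa using this

lemma SimpleGraph.IsTree.dist_coverPos (hG : G.IsTree) (hnb : ∀ x y, y ∈ nb x ↔ G.Adj x y)
    {w : List ℕ} (h : IsCoverNode nb v w) : G.dist v (coverPos nb v w) = w.length := by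
  classical
  induction w with
  | nil => simp [coverPos_nil]
  | cons i w ih =>
    have hw := ih h.2
    rcases hG.dist_eq_dist_add_one_of_adj v (h.adj hnb) with h1 | h1
    -- A new vertex closer to `v` would be the unique closer neighbour, which is the vertex under
    -- the parent; but that one was erased.
    · exfalso
      cases w with
      | nil =>
        rw [coverPos_nil] at h1
        simp at h1
      | cons j w =>
        have hj : IsCoverNode nb v (j :: w) := h.2
        have hw' : G.dist v (coverPos nb v w) + 1 = G.dist v (coverPos nb v (j :: w)) := by
          have := hG.dist_eq_dist_add_one_of_adj v (hj.adj hnb)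
          obtain ⟨p, hp⟩ := IsCoverNode.mem_walkBall hnb hj.2
          have := dist_le p
          simp only [List.length_cons] at hw
          omega
        have e := hG.eq_of_adj_of_dist (h.adj hnb) (hj.adj hnb).symm h1.symm hw'
        have hm : coverPos nb v (i :: j :: w) ∈ coverChildren nb v (j :: w) :=
          Finset.getD_toList_mem _ h.1 _
        rw [coverChildren_cons, Finset.mem_erase] at hm
        exact hm.1 e
    · rw [h1, hw]
      rfl

/-- The depth of a node is the distance of its vertex from `v`, and parents lie over the unique
closer neighbour; so the word is recovered from the vertex letter by letter. -/
lemma SimpleGraph.IsTree.coverInjective (hG : G.IsTree) (hnb : ∀ x y, y ∈ nb x ↔ G.Adj x y)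
    (v : V) (R : ℕ) : CoverInjective nb v R := by
  intro w w' hw hw' _ _ he
  have hlen : w.length = w'.length := by
    rw [← hG.dist_coverPos hnb hw, ← hG.dist_coverPos hnb hw', he]
  clear * - hw hw' he hlen hG hnb
  induction w generalizing w' with
  | nil => exact (List.length_eq_zero_iff.1 hlen.symm).symm
  | cons i w ih =>
    cases w' with
    | nil => simp at hlen
    | cons j w' =>
      have e : coverPos nb v w = coverPos nb v w' := by
        refine hG.eq_of_adj_of_dist (v := v) (hw.adj hnb).symm (he ▸ (hw'.adj hnb).symm) ?_ ?_
        · rw [hG.dist_coverPos hnb hw, hG.dist_coverPos hnb hw.2]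
          rfl
        · rw [he, hG.dist_coverPos hnb hw', hG.dist_coverPos hnb hw'.2]
          rfl
      obtain rfl := ih w' hw.2 hw'.2 e (by simpa using hlen)
      obtain rfl := Finset.getD_toList_injective _ hw.1 hw'.1 he
      rfl

end Cover

/-! ### Replacing a tree-like neighbourhood by a disjoint tree. -/

namespace MRFG

variable {d k : ℕ} {S : Set (Fin d → ℝ)}

/-- The offspring numbers and features of the universal cover of `G` at `v`. -/
noncomputable def cover (G : MRFG S k) (v : G.V) : List ℕ → ℕ × S := fun w =>
  ((coverChildren G.nbrs v w).card, G.feat (coverPos G.nbrs v w))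

lemma isAcyclic_of_coverInjective {G : MRFG S k} {v : G.V} {R : ℕ}
    (h : CoverInjective G.nbrs v (R + 1)) :
    (G.graph.induce (G.graph.walkBall v R)).IsAcyclic := by
  refine isAcyclic_induce_of_subset_image (G := (branchingTree (G.cover v)).graph)
    (f := fun w => coverPos G.nbrs v w.1) (s := {w | w.1.length ≤ R}) ?_ ?_
    ((branchingTree_isAcyclic _).induce _)
  · intro a ha b hb hab
    exact (h.adj_iff (fun _ _ => mem_nbrs) a.2 b.2 ha hb).1 hab
  · intro x hx
    obtain ⟨w, hw, hwR, rfl⟩ := exists_isCoverNode_of_mem_walkBall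
      (nb := G.nbrs) (fun _ _ => mem_nbrs) hx
    exact ⟨⟨w, hw⟩, hwR, rfl⟩

/-- If `v` is far from the roots and has a tree-like neighbourhood, then adding the root `v` is
locally the same as adding a disjoint copy of the universal cover at `v`. -/
lemma locallyEquiv_addRoot_union_cover {G : MRFG S k} {v : G.V} {R : ℕ}
    (h : CoverInjective G.nbrs v (3 * R + 2))
    (hroot : ∀ i, G.root i ∉ G.graph.walkBall v (2 * R + 1)) :
    LocallyEquiv R (G.addRoot v) (G.union (branchingTree (G.cover v))) := by
  have hnb : ∀ x y, y ∈ G.nbrs x ↔ G.graph.Adj x y := fun _ _ => mem_nbrs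
  have hR1 : CoverInjective G.nbrs v (R + 1) := h.mono (by omega)
  -- Vertices outside the ball of radius `R + 1` match themselves, those within radius `R` match
  -- their node in the cover. The shell at distance `R + 1` stays unmatched, so that no edge joins
  -- the two parts.
  let M : (G.addRoot v).V → (G.union (branchingTree (G.cover v))).V → Prop := fun x z =>
    Sum.elim (fun y : G.V => x = y ∧ x ∉ G.graph.walkBall v (R + 1))
      (fun w : (branchingTree (G.cover v)).V => coverPos G.nbrs v w.1 = x ∧ w.1.length ≤ R) z
  have hinl : ∀ r (x : G.V), x ∉ G.graph.walkBall v (R + 1 + r) →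
      Deep (G.addRoot v).graph (G.union (branchingTree (G.cover v))).graph M r x (Sum.inl x) := by
    intro r
    induction r with
    | zero => exact fun x hx => ⟨rfl, hx⟩
    | succ r ih =>
      intro x hx
      have hnext : ∀ y, G.graph.Adj x y → y ∉ G.graph.walkBall v (R + 1 + r) :=
        fun y hy hyv => hx (walkBall_trans (s := 1) hyv hy.symm.mem_walkBall)
      refine ⟨⟨rfl, fun hx' => hx (G.graph.walkBall_mono v (by omega) hx')⟩, fun y hy => ?_,
        fun z hz => ?_⟩
      · exact ⟨Sum.inl y, union_adj_inl.2 ⟨y, rfl, hy⟩, ih y (hnext y hy)⟩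
      · obtain ⟨y, rfl, hy⟩ := union_adj_inl.1 hz
        exact ⟨y, hy, ih y (hnext y hy)⟩
  have hinr : ∀ r (w : (branchingTree (G.cover v)).V), w.1.length + r ≤ R →
      Deep (G.addRoot v).graph (G.union (branchingTree (G.cover v))).graph M r
        (coverPos G.nbrs v w.1) (Sum.inr w) := by
    intro r
    induction r with
    | zero => exact fun w hw => ⟨rfl, hw⟩
    | succ r ih =>
      intro w hw
      refine ⟨⟨rfl, by omega⟩, fun y hy => ?_, fun z hz => ?_⟩
      · rcases (IsCoverNode.mem_nb hnb w.2).1 hy with ⟨i, hi, rfl⟩ | ⟨i, w', hw', rfl⟩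
        · exact ⟨Sum.inr ⟨i :: w.1, hi⟩, union_adj_inr.2 ⟨_, rfl, .inr ⟨i, rfl⟩⟩,
            ih ⟨i :: w.1, hi⟩ (by simp only [List.length_cons]; omega)⟩
        · have hn : IsCoverNode G.nbrs v (i :: w') := hw' ▸ w.2
          refine ⟨Sum.inr ⟨w', hn.2⟩, union_adj_inr.2 ⟨_, rfl, .inl ⟨i, hw'⟩⟩,
            ih ⟨w', hn.2⟩ ?_⟩
          rw [hw', List.length_cons] at hw
          dsimp only
          omega
      · obtain ⟨⟨w', hn⟩, rfl, hadj⟩ := union_adj_inr.1 hz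
        refine ⟨coverPos G.nbrs v w', ?_, ih ⟨w', hn⟩ ?_⟩
        · rcases hadj with ⟨i, hi⟩ | ⟨i, hi⟩
          · exact (IsCoverNode.mem_nb hnb w.2).2 (.inr ⟨i, w', hi, rfl⟩)
          · dsimp only at hi
            subst hi
            exact (IsCoverNode.mem_nb hnb w.2).2 (.inl ⟨i, hn, rfl⟩)
        · rcases hadj with ⟨i, hi⟩ | ⟨i, hi⟩
          · rw [hi, List.length_cons] at hw
            dsimp only at hw ⊢
            omega
          · dsimp only at hi ⊢
            rw [hi, List.length_cons]
            omega
  have hpos : ∀ w : (branchingTree (G.cover v)).V, w.1.length ≤ R →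
      coverPos G.nbrs v w.1 ∈ G.graph.walkBall v R := fun w hw =>
    G.graph.walkBall_mono v hw (IsCoverNode.mem_walkBall hnb w.2)
  -- Vertices beyond radius `2 * R + 1` are matched to depth `R`. The others have their `R`-ball
  -- inside the ball of radius `3 * R + 1` around `v`, which is acyclic.
  have hac : ∀ x ∈ G.graph.walkBall v (2 * R + 1),
      (G.graph.induce (G.graph.walkBall x R)).IsAcyclic := by
    intro x hx
    refine isAcyclic_induce_of_subset_image (f := id) (fun _ _ _ _ => id) ?_
      (isAcyclic_of_coverInjective (R := 3 * R + 1) h)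
    rw [Set.image_id]
    intro y hy
    exact G.graph.walkBall_mono v (by omega) (walkBall_trans hx hy)
  refine ⟨M, ?_, ?_, ?_, ?_, ?_, ?_⟩
  · rintro x (y | w) hxy
    · obtain ⟨rfl, -⟩ := hxy
      rfl
    · obtain ⟨rfl, -⟩ := hxy
      rfl
  · rintro x (y | w) x' (y' | w') hxy hxy'
    · obtain ⟨rfl, -⟩ := hxy
      obtain ⟨rfl, -⟩ := hxy'
      exact Iff.rfl
    · obtain ⟨rfl, hx⟩ := hxy
      obtain ⟨rfl, hw'⟩ := hxy'
      refine iff_of_false (fun hadj => hx ?_) (by simp [MRFG.union])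
      exact walkBall_trans (hpos w' hw') (hadj.symm.mem_walkBall)
    · obtain ⟨rfl, hw⟩ := hxy
      obtain ⟨rfl, hx'⟩ := hxy'
      refine iff_of_false (fun hadj => hx' ?_) (by simp [MRFG.union])
      exact walkBall_trans (hpos w hw) (hadj.mem_walkBall)
    · obtain ⟨rfl, hw⟩ := hxy
      obtain ⟨rfl, hw'⟩ := hxy'
      exact hR1.adj_iff hnb w.2 w'.2 hw hw'
  · rintro x (y | w) x' (y' | w') hxy hxy'
    · obtain ⟨rfl, -⟩ := hxy
      obtain ⟨rfl, -⟩ := hxy'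
      exact Sum.inl_injective.eq_iff.symm
    · obtain ⟨rfl, hx⟩ := hxy
      obtain ⟨rfl, hw'⟩ := hxy'
      refine iff_of_false (fun he => hx ?_) Sum.inl_ne_inr
      rw [he]
      exact G.graph.walkBall_mono v (by omega) (hpos w' hw')
    · obtain ⟨rfl, hw⟩ := hxy
      obtain ⟨rfl, hx'⟩ := hxy'
      refine iff_of_false (fun he => hx' ?_) Sum.inr_ne_inl
      rw [← he]
      exact G.graph.walkBall_mono v (by omega) (hpos w hw)
    · obtain ⟨rfl, hw⟩ := hxy
      obtain ⟨rfl, hw'⟩ := hxy'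
      refine Iff.trans ?_ Sum.inr_injective.eq_iff.symm
      exact ⟨fun he => Subtype.ext (h _ _ w.2 w'.2 (by omega) (by omega) he), fun he => by rw [he]⟩
  · intro i
    induction i using Fin.lastCases with
    | last =>
      rw [union_root_last]
      have := hinr R ((branchingTree (G.cover v)).root 0) (by simp [branchingTree])
      simp only [MRFG.addRoot, Fin.snoc_last]
      exact this
    | cast i =>
      rw [union_root_castSucc]
      have := hinl R (G.root i) (by rw [show R + 1 + R = 2 * R + 1 by ring]; exact hroot i)
      simpa only [MRFG.addRoot, Fin.snoc_castSucc] using this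
  · intro x
    by_cases hx : x ∈ G.graph.walkBall v (2 * R + 1)
    · exact .inr (hac x hx)
    · exact .inl ⟨_, hinl R x (by rw [show R + 1 + R = 2 * R + 1 by ring]; exact hx)⟩
  · rintro (x | w)
    · by_cases hx : x ∈ G.graph.walkBall v (2 * R + 1)
      · exact .inr (union_isAcyclic_inl _ (hac x hx))
      · exact .inl ⟨_, hinl R x (by rw [show R + 1 + R = 2 * R + 1 by ring]; exact hx)⟩
    · exact .inr (union_isAcyclic_inr G (branchingTree_isAcyclic _) w R)

/-- A tree is locally the same as its universal cover. -/
lemma locallyEquiv_cover_of_isTree {T : MRFG S 1} (hT : T.graph.IsTree) (R : ℕ) :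
    LocallyEquiv R T (branchingTree (T.cover (T.root 0))) := by
  set v := T.root 0 with hv
  have hnb : ∀ x y, y ∈ T.nbrs x ↔ T.graph.Adj x y := fun _ _ => mem_nbrs
  let M : T.V → (branchingTree (T.cover v)).V → Prop := fun x w => coverPos T.nbrs v w.1 = x
  have hinr : ∀ r (w : (branchingTree (T.cover v)).V),
      Deep T.graph (branchingTree (T.cover v)).graph M r (coverPos T.nbrs v w.1) w := by
    intro r
    induction r with
    | zero => exact fun w => rfl
    | succ r ih =>
      intro w
      refine ⟨rfl, fun y hy => ?_, ?_⟩
      · rcases (IsCoverNode.mem_nb hnb w.2).1 hy with ⟨i, hi, rfl⟩ | ⟨i, w', hw', rfl⟩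
        · exact ⟨⟨i :: w.1, hi⟩, .inr ⟨i, rfl⟩, ih ⟨i :: w.1, hi⟩⟩
        · have hn : IsCoverNode T.nbrs v (i :: w') := hw' ▸ w.2
          exact ⟨⟨w', hn.2⟩, .inl ⟨i, hw'⟩, ih ⟨w', hn.2⟩⟩
      · rintro ⟨w', hn⟩ hadj
        refine ⟨coverPos T.nbrs v w', ?_, ih ⟨w', hn⟩⟩
        rcases hadj with ⟨i, hi⟩ | ⟨i, hi⟩
        · exact (IsCoverNode.mem_nb hnb w.2).2 (.inr ⟨i, w', hi, rfl⟩)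
        · dsimp only at hi
          subst hi
          exact (IsCoverNode.mem_nb hnb w.2).2 (.inl ⟨i, hn, rfl⟩)
  refine ⟨M, ?_, ?_, ?_, ?_, ?_, ?_⟩
  · rintro _ w rfl
    rfl
  · rintro _ w _ w' rfl rfl
    exact (hT.coverInjective hnb v (w.1.length + w'.1.length + 1)).adj_iff hnb w.2 w'.2
      (by omega) (by omega)
  · rintro _ w _ w' rfl rfl
    exact ⟨fun he => Subtype.ext (hT.coverInjective hnb v (w.1.length + w'.1.length) _ _ w.2 w'.2
      (by omega) (by omega) he), fun he => by rw [he]⟩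
  · intro i
    have := hinr R ((branchingTree (T.cover v)).root 0)
    rw [Subsingleton.elim i 0]
    exact this
  · exact fun x => .inr (hT.isAcyclic.induce _)
  · exact fun x => .inr ((branchingTree_isAcyclic _).induce _)

end MRFG

/-! ### Prescribed edges and non-edges in the binomial random graph. -/

section BinomialRandom

lemma measurableSet_simpleGraph {V : Type*} [Finite V] (s : Set (SimpleGraph V)) :
    MeasurableSet s := by
  have h : s = SimpleGraph.Adj ⁻¹' (SimpleGraph.Adj '' s) :=
    (Set.preimage_image_eq s fun G H h => SimpleGraph.ext h).symm
  rw [h]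
  exact measurable_adj (Set.toFinite (SimpleGraph.Adj '' s)).measurableSet

instance instDiscreteMeasurableSpaceSimpleGraph {V : Type*} [Finite V] :
    DiscreteMeasurableSpace (SimpleGraph V) := ⟨measurableSet_simpleGraph⟩

/-- A lower bound for the probability that certain edges are present and others are absent. -/
lemma le_binomialRandom {V : Type*} [Finite V] (p : unitInterval) {E F : Finset (Sym2 V)}
    (hEF : Disjoint E F) (hE : ∀ e ∈ E, ¬ e.IsDiag) :
    (p : ℝ) ^ E.card * (1 - p : ℝ) ^ F.card ≤ (binomialRandom V p).real
      {G | (∀ e ∈ E, e ∈ G.edgeSet) ∧ ∀ e ∈ F, e ∉ G.edgeSet} := by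
  classical
  have key : (unitInterval.toNNReal p : ℝ≥0∞) ^ E.card *
      (unitInterval.toNNReal (unitInterval.symm p) : ℝ≥0∞) ^ F.card ≤ binomialRandom V p
      {G | (∀ e ∈ E, e ∈ G.edgeSet) ∧ ∀ e ∈ F, e ∉ G.edgeSet} := by
    rw [binomialRandom_eq_map, Measure.map_apply measurable_fromEdgeSet
      (measurableSet_simpleGraph _), setBernoulli_apply']
    have hsub : Set.pi ((E ∪ F : Finset (Sym2 V)) : Set (Sym2 V))
        (fun e => if e ∈ E then ({True} : Set Prop) else {False}) ⊆
        (fun q : Sym2 V → Prop => {i | q i}) ⁻¹' (fromEdgeSet ⁻¹'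
          {G | (∀ e ∈ E, e ∈ G.edgeSet) ∧ ∀ e ∈ F, e ∉ G.edgeSet}) := by
      intro q hq
      refine ⟨fun e he => ?_, fun e he => ?_⟩
      · have := hq e (by simp [he])
        simp only [he, if_true, Set.mem_singleton_iff] at this
        simp only [edgeSet_fromEdgeSet, Set.mem_sdiff]
        exact ⟨by simpa using this, by simpa using hE e he⟩
      · have := hq e (by simp [he])
        simp only [Finset.disjoint_right.1 hEF he, if_false, Set.mem_singleton_iff] at this
        simp [edgeSet_fromEdgeSet, this]
    refine le_trans ?_ (measure_mono hsub)
    rw [Measure.infinitePi_pi _ fun e _ => by measurability, Finset.prod_union hEF]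
    refine mul_le_mul' ?_ ?_
    · rw [← Finset.prod_const]
      refine Finset.prod_le_prod' fun e he => ?_
      simp [he, hE e he]
    -- Diagonal pairs are allowed in `F`. They are never edges, and this is why only an inequality
    -- is claimed.
    · rw [← Finset.prod_const]
      refine Finset.prod_le_prod' fun e he => ?_
      simp [Finset.disjoint_right.1 hEF he]
  have h2 := ENNReal.toReal_mono (measure_ne_top _ _) key
  simpa [Measure.real] using h2

end BinomialRandom

/-! ### Counting families of disjoint sets. -/

section DisjointFamilies

open Classical in
/-- There are many families of disjoint subsets of prescribed sizes of a finite set. -/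
lemma exists_disjoint_families {ι V : Type*} (N : ι → ℕ) (X : Finset V) (m : ℕ) (I : Finset ι)
    (hm : ∑ i ∈ I, N i ≤ m) :
    ∃ 𝓕 : Finset (ι → Finset V), ∏ i ∈ I, (X.card - m).choose (N i) ≤ 𝓕.card ∧
      ∀ A ∈ 𝓕, (∀ i ∉ I, A i = ∅) ∧ (∀ i ∈ I, A i ⊆ X ∧ (A i).card = N i) ∧
        ∀ i ∈ I, ∀ j ∈ I, i ≠ j → Disjoint (A i) (A j) := by
  induction I using Finset.induction_on with
  | empty => exact ⟨{fun _ => ∅}, by simp, by simp⟩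
  | insert i I hi ih =>
    rw [Finset.sum_insert hi] at hm
    obtain ⟨𝓕, hcard, h𝓕⟩ := ih (by omega)
    -- The sets are chosen one after the other; those chosen before occupy at most `m` points, so at
    -- least `X.card - m` remain for each choice.
    let T : Finset (Σ _ : ι → Finset V, Finset V) :=
      𝓕.sigma fun A => (X \ I.biUnion A).powersetCard (N i)
    have hT : ∀ x ∈ T, x.1 ∈ 𝓕 ∧ x.2 ⊆ X \ I.biUnion x.1 ∧ x.2.card = N i := by
      intro x hx
      simpa [T, Finset.mem_powersetCard] using hx
    refine ⟨T.image fun x => Function.update x.1 i x.2, ?_, ?_⟩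
    · rw [Finset.card_image_of_injOn, Finset.card_sigma, Finset.prod_insert hi]
      · calc (X.card - m).choose (N i) * ∏ j ∈ I, (X.card - m).choose (N j)
            ≤ 𝓕.card * (X.card - m).choose (N i) := by
              rw [mul_comm]
              exact Nat.mul_le_mul_right _ hcard
          _ = ∑ _A ∈ 𝓕, (X.card - m).choose (N i) := by simp
          _ ≤ _ := by
            refine Finset.sum_le_sum fun A hA => ?_
            rw [Finset.card_powersetCard]
            refine Nat.choose_le_choose _ ?_
            have h1 : (I.biUnion A).card ≤ ∑ j ∈ I, N j :=
              Finset.card_biUnion_le.trans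
                (Finset.sum_le_sum fun j hj => ((h𝓕 A hA).2.1 j hj).2.le)
            have h2 := Finset.le_card_sdiff (I.biUnion A) X
            omega
      · rintro ⟨A, B⟩ hx ⟨A', B'⟩ hx' he
        obtain ⟨hA, -, -⟩ := hT _ hx
        obtain ⟨hA', -, -⟩ := hT _ hx'
        dsimp only at he hA hA'
        have hB : B = B' := by simpa using congrFun he i
        have hAA : A = A' := by
          funext j
          by_cases hj : j = i
          · subst hj
            rw [(h𝓕 A hA).1 j hi, (h𝓕 A' hA').1 j hi]
          · simpa [hj] using congrFun he j
        rw [hAA, hB]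
    · intro A' hA'
      obtain ⟨⟨A, B⟩, hx, rfl⟩ := Finset.mem_image.1 hA'
      obtain ⟨hA, hB, hBc⟩ := hT _ hx
      dsimp only at hA hB hBc ⊢
      obtain ⟨h1, h2, h3⟩ := h𝓕 A hA
      have hne : ∀ j ∈ I, j ≠ i := fun j hj hji => hi (hji ▸ hj)
      have hdisj : ∀ j ∈ I, Disjoint B (A j) := fun j hj =>
        (Finset.disjoint_of_subset_left hB Finset.sdiff_disjoint).mono_right
          (Finset.subset_biUnion_of_mem A hj)
      refine ⟨fun j hj => ?_, fun j hj => ?_, fun j hj j' hj' hjj' => ?_⟩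
      · rw [Finset.mem_insert, not_or] at hj
        rw [Function.update_of_ne hj.1, h1 j hj.2]
      · rcases Finset.mem_insert.1 hj with rfl | hj
        · rw [Function.update_self]
          exact ⟨hB.trans Finset.sdiff_subset, hBc⟩
        · rw [Function.update_of_ne (hne j hj)]
          exact h2 j hj
      · rcases Finset.mem_insert.1 hj with hji | hj <;>
          rcases Finset.mem_insert.1 hj' with hji' | hj'
        · exact absurd (hji.trans hji'.symm) hjj'
        · rw [hji, Function.update_self, Function.update_of_ne (hne _ hj')]
          exact hdisj _ hj'
        · rw [hji', Function.update_self, Function.update_of_ne (hne _ hj)]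
          exact (hdisj _ hj).symm
        · rw [Function.update_of_ne (hne _ hj), Function.update_of_ne (hne _ hj')]
          exact h3 j hj j' hj' hjj'

end DisjointFamilies

/-! ### Probability that the covers at given vertices form a prescribed forest. -/

section Forest

/-- The nodes of depth less than `R`. -/
noncomputable def innerNodes (N : List ℕ → ℕ) (R : ℕ) : Finset (List ℕ) :=
  ((finite_setOf_isNode N R).subset (t := {w | IsNode N w ∧ w.length < R})
    fun _ hw => ⟨hw.1, hw.2.le⟩).toFinset

lemma mem_innerNodes {N : List ℕ → ℕ} {R : ℕ} {w : List ℕ} :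
    w ∈ innerNodes N R ↔ IsNode N w ∧ w.length < R := by
  simp [innerNodes]

/-- The neighbours of a vertex of a finite graph. -/
noncomputable def SimpleGraph.finNbrs {V : Type*} [Finite V] (G : SimpleGraph V) (x : V) :
    Finset V := (Set.toFinite (G.neighborSet x)).toFinset

lemma SimpleGraph.mem_finNbrs {V : Type*} [Finite V] {G : SimpleGraph V} {x y : V} :
    y ∈ G.finNbrs x ↔ G.Adj x y := by
  simp [finNbrs]

variable {β V : Type*}

/-- The universal covers of `G` at the vertices `r b` have offspring numbers `N b` up to
depth `R`, and are jointly injective up to depth `R`. -/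
def HasForest [Finite V] (G : SimpleGraph V) (r : β → V) (N : β → List ℕ → ℕ) (R : ℕ) : Prop :=
  (∀ b w, IsNode (N b) w → w.length < R → (coverChildren G.finNbrs (r b) w).card = N b w) ∧
  ∀ b b' w w', IsNode (N b) w → IsNode (N b') w' → w.length ≤ R → w'.length ≤ R →
    coverPos G.finNbrs (r b) w = coverPos G.finNbrs (r b') w' → b = b' ∧ w = w'

/-- The vertex at the node `w` of the tree with index `b`, where `A` gives the children. -/
noncomputable def forestPos (r : β → V) (A : (_ : β) × List ℕ → Finset V) (b : β) : List ℕ → V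
  | [] => r b
  | i :: w => (A ⟨b, w⟩).toList.getD i (r b)

/-- `A` is a family of disjoint sets of children for a forest of shape `N` and depth `R`. -/
structure IsForestFamily (r : β → V) (N : β → List ℕ → ℕ) (R : ℕ)
    (A : (_ : β) × List ℕ → Finset V) : Prop where
  injective : Function.Injective r
  card_eq : ∀ b w, IsNode (N b) w → w.length < R → (A ⟨b, w⟩).card = N b w
  root_notMem : ∀ b b' w, IsNode (N b) w → w.length < R → r b' ∉ A ⟨b, w⟩
  disjoint : ∀ b w b' w', IsNode (N b) w → w.length < R → IsNode (N b') w' → w'.length < R →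
    (⟨b, w⟩ : (_ : β) × List ℕ) ≠ ⟨b', w'⟩ → Disjoint (A ⟨b, w⟩) (A ⟨b', w'⟩)

/-- In `G`, the neighbours of the vertices of depth less than `R` of the forest given by `A` are
their parents and children in that forest. -/
def RealizesForest (G : SimpleGraph V) (r : β → V) (N : β → List ℕ → ℕ) (R : ℕ)
    (A : (_ : β) × List ℕ → Finset V) : Prop :=
  ∀ b w, IsNode (N b) w → w.length < R → ∀ y, G.Adj (forestPos r A b w) y ↔
    y ∈ A ⟨b, w⟩ ∨ ∃ i w', w = i :: w' ∧ y = forestPos r A b w'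

variable {r : β → V} {N : β → List ℕ → ℕ} {R : ℕ} {A : (_ : β) × List ℕ → Finset V}

namespace IsForestFamily

lemma pos_cons_mem (h : IsForestFamily r N R A) {b : β} {i : ℕ} {w : List ℕ}
    (hw : IsNode (N b) (i :: w)) (hR : w.length < R) : forestPos r A b (i :: w) ∈ A ⟨b, w⟩ :=
  Finset.getD_toList_mem _ (by rw [h.card_eq b w hw.2 hR]; exact hw.1) _

lemma exists_pos_eq (h : IsForestFamily r N R A) {b : β} {w : List ℕ}
    (hw : IsNode (N b) w) (hR : w.length < R) {x : V} (hx : x ∈ A ⟨b, w⟩) :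
    ∃ i, IsNode (N b) (i :: w) ∧ forestPos r A b (i :: w) = x := by
  obtain ⟨i, hi, hix⟩ := Finset.exists_getD_toList_eq hx (r b)
  exact ⟨i, ⟨by rw [← h.card_eq b w hw hR]; exact hi, hw⟩, hix⟩

lemma pos_injective (h : IsForestFamily r N R A) {b b' : β} {w w' : List ℕ}
    (hw : IsNode (N b) w) (hw' : IsNode (N b') w') (hR : w.length ≤ R) (hR' : w'.length ≤ R)
    (he : forestPos r A b w = forestPos r A b' w') : b = b' ∧ w = w' := by
  cases w with
  | nil =>
    cases w' with
    | nil => exact ⟨h.injective he, rfl⟩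
    | cons i' w' =>
      simp only [List.length_cons] at hR'
      have hm := h.pos_cons_mem hw' (by omega)
      rw [← he] at hm
      exact absurd hm (h.root_notMem b' b w' hw'.2 (by omega))
  | cons i w =>
    simp only [List.length_cons] at hR
    cases w' with
    | nil =>
      have hm := h.pos_cons_mem hw (by omega)
      rw [he] at hm
      exact absurd hm (h.root_notMem b b' w hw.2 (by omega))
    | cons i' w' =>
      simp only [List.length_cons] at hR'
      have hm := h.pos_cons_mem hw (by omega)
      have hm' := h.pos_cons_mem hw' (by omega)
      by_cases hne : (⟨b, w⟩ : (_ : β) × List ℕ) = ⟨b', w'⟩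
      · obtain ⟨rfl, hww⟩ := Sigma.mk.inj hne
        obtain rfl := eq_of_heq hww
        have hi := h.card_eq b w hw.2 (by omega)
        obtain rfl := Finset.getD_toList_injective (A ⟨b, w⟩) (i := i) (j := i')
          (by rw [hi]; exact hw.1) (by rw [hi]; exact hw'.1) he
        exact ⟨rfl, rfl⟩
      · exact absurd (he ▸ hm')
          (Finset.disjoint_left.1 (h.disjoint b w b' w' hw.2 (by omega) hw'.2 (by omega) hne) hm)

/-- Descending along the word, the neighbours of a vertex are its parent and the members of `A`; the
cover erases the parent, which by injectivity of positions is not itself in `A`. -/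
lemma realizes_imp [Finite V] (h : IsForestFamily r N R A) {G : SimpleGraph V}
    (hG : RealizesForest G r N R A) {b : β} {w : List ℕ} (hw : IsNode (N b) w)
    (hR : w.length ≤ R) : coverPos G.finNbrs (r b) w = forestPos r A b w ∧
      (w.length < R → coverChildren G.finNbrs (r b) w = A ⟨b, w⟩) := by
  classical
  induction w with
  | nil =>
    refine ⟨rfl, fun hlt => ?_⟩
    ext y
    rw [coverChildren_nil, mem_finNbrs]
    exact (hG b [] trivial hlt y).trans (by simp)
  | cons i w ih =>
    simp only [List.length_cons] at hR
    obtain ⟨ih1, ih2⟩ := ih hw.2 (by omega)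
    have hpos : coverPos G.finNbrs (r b) (i :: w) = forestPos r A b (i :: w) := by
      rw [coverPos_cons, ih2 (by omega)]
      rfl
    refine ⟨hpos, fun hlt => ?_⟩
    ext y
    rw [coverChildren_cons, hpos, ih1, Finset.mem_erase, mem_finNbrs, hG b (i :: w) hw hlt y]
    constructor
    · rintro ⟨hne, hy | ⟨i', w', he, rfl⟩⟩
      · exact hy
      · obtain ⟨rfl, rfl⟩ := List.cons.inj he
        exact absurd rfl hne
    · refine fun hy => ⟨?_, .inl hy⟩
      rintro rfl
      obtain ⟨j, hj, hje⟩ := h.exists_pos_eq hw hlt hy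
      simp only [List.length_cons] at hlt
      have := (h.pos_injective hj hw.2 (by simp only [List.length_cons]; omega) (by omega) hje).2
      have := congrArg List.length this
      simp only [List.length_cons] at this
      omega

lemma hasForest [Finite V] (h : IsForestFamily r N R A) {G : SimpleGraph V}
    (hG : RealizesForest G r N R A) : HasForest G r N R := by
  refine ⟨fun b w hw hR => ?_, fun b b' w w' hw hw' hR hR' he => ?_⟩
  · rw [(h.realizes_imp hG hw hR.le).2 hR, h.card_eq b w hw hR]
  · rw [(h.realizes_imp hG hw hR).1, (h.realizes_imp hG hw' hR').1] at he
    exact h.pos_injective hw hw' hR hR' he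

-- The event is implied by the presence of the parent-child pairs and the absence of all other pairs
-- at an inner vertex. The count of absent pairs is crude, at most `Fintype.card V` per inner
-- vertex, which does not matter in the limit.
open Classical in
lemma le_measureReal_realizesForest [Fintype V] [Fintype β] (h : IsForestFamily r N R A)
    (p : unitInterval) :
    (p : ℝ) ^ (∑ j ∈ Finset.univ.sigma fun b => innerNodes (N b) R, N j.1 j.2) *
      (1 - p : ℝ) ^ ((Finset.univ.sigma fun b => innerNodes (N b) R).card * Fintype.card V) ≤
      (binomialRandom V p).real {G | RealizesForest G r N R A} := by
  set I := Finset.univ.sigma fun b => innerNodes (N b) R with hI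
  have memI : ∀ {b w}, (⟨b, w⟩ : (_ : β) × List ℕ) ∈ I ↔ IsNode (N b) w ∧ w.length < R := by
    intro b w
    simp [hI, mem_innerNodes]
  let E : Finset (Sym2 V) := I.biUnion fun j =>
    (A j).image fun x => s(forestPos r A j.1 j.2, x)
  let F : Finset (Sym2 V) := I.biUnion fun j =>
    (Finset.univ.filter fun y => ¬ (y ∈ A j ∨ ∃ i w', j.2 = i :: w' ∧ y = forestPos r A j.1 w')).image
      fun y => s(forestPos r A j.1 j.2, y)
  have hEcard : E.card ≤ ∑ j ∈ I, N j.1 j.2 := by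
    refine Finset.card_biUnion_le.trans (Finset.sum_le_sum ?_)
    rintro ⟨b, w⟩ hj
    obtain ⟨h1, h2⟩ := memI.1 hj
    exact Finset.card_image_le.trans (h.card_eq b w h1 h2).le
  have hFcard : F.card ≤ I.card * Fintype.card V := by
    refine Finset.card_biUnion_le_card_mul _ _ _ fun j _ => ?_
    exact Finset.card_image_le.trans (Finset.card_le_univ _)
  have hdiag : ∀ e ∈ E, ¬ e.IsDiag := by
    intro e he
    obtain ⟨⟨b, w⟩, hj, he⟩ := Finset.mem_biUnion.1 he
    obtain ⟨x, hx, rfl⟩ := Finset.mem_image.1 he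
    obtain ⟨h1, h2⟩ := memI.1 hj
    obtain ⟨i, hi, rfl⟩ := h.exists_pos_eq h1 h2 hx
    rw [Sym2.mk_isDiag_iff]
    intro he
    have := (h.pos_injective h1 hi h2.le (by simp only [List.length_cons]; omega) he).2
    simpa using congrArg List.length this
  have hEF : Disjoint E F := by
    rw [Finset.disjoint_left]
    intro e he he'
    obtain ⟨⟨b, w⟩, hj, he⟩ := Finset.mem_biUnion.1 he
    obtain ⟨x, hx, rfl⟩ := Finset.mem_image.1 he
    obtain ⟨⟨b', w'⟩, hj', he'⟩ := Finset.mem_biUnion.1 he'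
    obtain ⟨y, hy, hxy⟩ := Finset.mem_image.1 he'
    obtain ⟨h1, h2⟩ := memI.1 hj
    obtain ⟨h1', h2'⟩ := memI.1 hj'
    have hy := (Finset.mem_filter.1 hy).2
    dsimp only at hy hxy hx
    rcases Sym2.eq_iff.1 hxy with ⟨e1, e2⟩ | ⟨e1, e2⟩
    · obtain ⟨rfl, rfl⟩ := h.pos_injective h1' h1 h2'.le h2.le e1
      exact hy (.inl (e2 ▸ hx))
    · obtain ⟨i, hi, hix⟩ := h.exists_pos_eq h1 h2 hx
      obtain ⟨rfl, rfl⟩ := h.pos_injective h1' hi h2'.le (by simp only [List.length_cons]; omega)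
        (e1.trans hix.symm)
      exact hy (.inr ⟨i, w, rfl, e2⟩)
  have hsub : {G : SimpleGraph V | (∀ e ∈ E, e ∈ G.edgeSet) ∧ ∀ e ∈ F, e ∉ G.edgeSet} ⊆
      {G | RealizesForest G r N R A} := by
    rintro G ⟨hGE, hGF⟩ b w hw hR y
    constructor
    · intro hadj
      by_contra hcon
      refine hGF s(forestPos r A b w, y) ?_ hadj
      exact Finset.mem_biUnion.2 ⟨⟨b, w⟩, memI.2 ⟨hw, hR⟩, Finset.mem_image.2
        ⟨y, Finset.mem_filter.2 ⟨Finset.mem_univ _, hcon⟩, rfl⟩⟩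
    · rintro (hy | ⟨i, w', rfl, rfl⟩)
      · exact hGE s(forestPos r A b w, y) (Finset.mem_biUnion.2 ⟨⟨b, w⟩, memI.2 ⟨hw, hR⟩,
          Finset.mem_image.2 ⟨y, hy, rfl⟩⟩)
      · simp only [List.length_cons] at hR
        have := hGE s(forestPos r A b w', forestPos r A b (i :: w')) (Finset.mem_biUnion.2
          ⟨⟨b, w'⟩, memI.2 ⟨hw.2, by omega⟩,
            Finset.mem_image.2 ⟨_, h.pos_cons_mem hw (by omega), rfl⟩⟩)
        exact SimpleGraph.Adj.symm this
  refine le_trans ?_ ((le_binomialRandom p hEF hdiag).trans (measureReal_mono hsub))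
  have hp0 : (0 : ℝ) ≤ p := p.2.1
  have hp1 : (p : ℝ) ≤ 1 := p.2.2
  exact mul_le_mul (pow_le_pow_of_le_one hp0 hp1 hEcard)
    (pow_le_pow_of_le_one (by linarith) (by linarith) hFcard) (by positivity) (by positivity)

end IsForestFamily

open Classical in
/-- A lower bound for the probability that the universal covers at given vertices have given
shapes. -/
lemma le_measureReal_hasForest [Fintype V] [Fintype β] (hr : Function.Injective r)
    (N : β → List ℕ → ℕ) (R : ℕ) (p : unitInterval) :
    ∏ j ∈ Finset.univ.sigma fun b => innerNodes (N b) R,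
      (((Fintype.card V - Fintype.card β -
          ∑ j ∈ Finset.univ.sigma fun b => innerNodes (N b) R, N j.1 j.2).choose (N j.1 j.2) : ℕ) *
        (p : ℝ) ^ N j.1 j.2 * (1 - p : ℝ) ^ Fintype.card V) ≤
      (binomialRandom V p).real {G | HasForest G r N R} := by
  set I := Finset.univ.sigma fun b => innerNodes (N b) R with hI
  have memI : ∀ {b w}, (⟨b, w⟩ : (_ : β) × List ℕ) ∈ I ↔ IsNode (N b) w ∧ w.length < R := by
    intro b w
    simp [hI, mem_innerNodes]
  obtain ⟨𝓕, hcard, h𝓕⟩ := exists_disjoint_families (fun j : (_ : β) × List ℕ => N j.1 j.2)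
    (Finset.univ \ Finset.univ.image r) (∑ j ∈ I, N j.1 j.2) I le_rfl
  have hX : Fintype.card V - Fintype.card β ≤ (Finset.univ \ Finset.univ.image r).card := by
    have h1 := Finset.le_card_sdiff (Finset.univ.image r) Finset.univ
    have h2 : (Finset.univ.image r).card ≤ Fintype.card β :=
      Finset.card_image_le.trans (by simp)
    rw [Finset.card_univ] at h1
    omega
  have hfam : ∀ A ∈ 𝓕, IsForestFamily r N R A := by
    intro A hA
    obtain ⟨-, h2, h3⟩ := h𝓕 A hA
    refine ⟨hr, fun b w hw hR => (h2 ⟨b, w⟩ (memI.2 ⟨hw, hR⟩)).2, fun b b' w hw hR hm => ?_,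
      fun b w b' w' hw hR hw' hR' hne => h3 _ (memI.2 ⟨hw, hR⟩) _ (memI.2 ⟨hw', hR'⟩) hne⟩
    have := (h2 ⟨b, w⟩ (memI.2 ⟨hw, hR⟩)).1 hm
    simp at this
  -- The family can be read off from the graph, as the children in the covers. So distinct families
  -- give disjoint events, and their probabilities add.
  have hdisj : (𝓕 : Set _).PairwiseDisjoint fun A => {G : SimpleGraph V | RealizesForest G r N R A} := by
    intro A hA A' hA' hne
    rw [Function.onFun, Set.disjoint_left]
    intro G hG hG'
    apply hne
    funext ⟨b, w⟩
    by_cases hj : (⟨b, w⟩ : (_ : β) × List ℕ) ∈ I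
    · obtain ⟨hw, hR⟩ := memI.1 hj
      rw [← ((hfam A hA).realizes_imp hG hw hR.le).2 hR,
        ← ((hfam A' hA').realizes_imp hG' hw hR.le).2 hR]
    · rw [(h𝓕 A hA).1 _ hj, (h𝓕 A' hA').1 _ hj]
  have hp0 : (0 : ℝ) ≤ p := p.2.1
  have hp1 : (0 : ℝ) ≤ 1 - p := sub_nonneg.2 p.2.2
  calc _ = ((∏ j ∈ I, (Fintype.card V - Fintype.card β -
          ∑ j ∈ I, N j.1 j.2).choose (N j.1 j.2) : ℕ) : ℝ) *
          ((p : ℝ) ^ (∑ j ∈ I, N j.1 j.2) * (1 - p : ℝ) ^ (I.card * Fintype.card V)) := by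
        rw [Finset.prod_mul_distrib, Finset.prod_mul_distrib, Finset.prod_pow_eq_pow_sum,
          Finset.prod_const, ← pow_mul, mul_comm I.card, mul_assoc]
        push_cast
        rfl
    _ ≤ (𝓕.card : ℝ) *
          ((p : ℝ) ^ (∑ j ∈ I, N j.1 j.2) * (1 - p : ℝ) ^ (I.card * Fintype.card V)) := by
        refine mul_le_mul_of_nonneg_right ?_ (by positivity)
        exact_mod_cast (Finset.prod_le_prod' fun j _ =>
          Nat.choose_le_choose _ (Nat.sub_le_sub_right hX _)).trans hcard
    _ = ∑ _A ∈ 𝓕,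
          ((p : ℝ) ^ (∑ j ∈ I, N j.1 j.2) * (1 - p : ℝ) ^ (I.card * Fintype.card V)) := by
        simp
    _ ≤ ∑ A ∈ 𝓕, (binomialRandom V p).real {G | RealizesForest G r N R A} :=
        Finset.sum_le_sum fun A hA => (hfam A hA).le_measureReal_realizesForest p
    _ = (binomialRandom V p).real (⋃ A ∈ 𝓕, {G | RealizesForest G r N R A}) :=
        (measureReal_biUnion_finset hdisj fun A _ => measurableSet_simpleGraph _).symm
    _ ≤ _ := by
        refine measureReal_mono ?_
        intro G hG
        simp only [Set.mem_iUnion] at hG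
        obtain ⟨A, hA, hG⟩ := hG
        exact (hfam A hA).hasForest hG

end Forest

/-! ### The Poisson limit. -/

section Limit

/-- The Poisson limit theorem; removing a bounded number `a` of vertices is absorbed by shifting the
index, since `n * (c / (n + a))` still tends to `c`. -/
lemma tendsto_choose_sub_mul_pow (c : ℝ≥0) (a k : ℕ) :
    Tendsto (fun n : ℕ => ((n - a).choose k : ℝ) * (c / n : ℝ) ^ k * (1 - c / n : ℝ) ^ n) atTop
      (𝓝 ((poissonMeasure c).real {k})) := by
  have h1 : Tendsto (fun n : ℕ => (1 - c / n : ℝ) ^ n) atTop (𝓝 (Real.exp (-c))) := by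
    have := Real.tendsto_one_add_div_pow_exp (-c : ℝ)
    refine this.congr fun n => ?_
    rw [neg_div, ← sub_eq_add_neg]
  have h2 : Tendsto (fun n : ℕ => (n : ℝ) * (c / (n + a : ℕ) : ℝ)) atTop (𝓝 (c : ℝ)) := by
    have h3 : Tendsto (fun n : ℕ => (n : ℝ) / (n + (a : ℝ))) atTop (𝓝 1) :=
      tendsto_natCast_div_add_atTop (a : ℝ)
    have := h3.mul_const (c : ℝ)
    rw [one_mul] at this
    refine this.congr fun n => ?_
    push_cast
    ring
  have h3 := tendsto_choose_mul_pow_atTop k h2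
  rw [poissonMeasure_real_singleton, ← tendsto_add_atTop_iff_nat a,
    show Real.exp (-c) * (c : ℝ) ^ k / (k.factorial : ℝ) =
      (c : ℝ) ^ k / (k.factorial : ℝ) * Real.exp (-c) by ring]
  refine (h3.mul ((tendsto_add_atTop_iff_nat a).2 h1)).congr fun n => ?_
  simp

/-- The shapes of the universal covers at two vertices of the sparse random graph are
asymptotically independent with the law of the branching process. -/
lemma exists_tendsto_le_measureReal_hasForest (c : ℝ≥0) (N : Bool → List ℕ → ℕ) (R : ℕ) :
    ∃ L : ℕ → ℝ, Tendsto L atTop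
        (𝓝 (∏ b, ∏ w ∈ innerNodes (N b) R, (poissonMeasure c).real {N b w})) ∧
      ∀ᶠ n : ℕ in atTop, ∀ r : Bool → Fin n, Function.Injective r → L n ≤
        (binomialRandom (Fin n) (Set.projIcc (0 : ℝ) 1 zero_le_one (c / n))).real
          {G | HasForest G r N R} := by
  refine ⟨fun n => ∏ j ∈ Finset.univ.sigma fun b => innerNodes (N b) R,
      (((n - (Fintype.card Bool +
          ∑ j ∈ Finset.univ.sigma fun b => innerNodes (N b) R, N j.1 j.2)).choose (N j.1 j.2) : ℕ) *
        (c / n : ℝ) ^ N j.1 j.2 * (1 - c / n : ℝ) ^ n), ?_, ?_⟩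
  · rw [← Finset.prod_sigma Finset.univ (fun b => innerNodes (N b) R)
      (fun j => (poissonMeasure c).real {N j.1 j.2})]
    exact tendsto_finsetProd _ fun j _ => tendsto_choose_sub_mul_pow c _ _
  · filter_upwards [eventually_ge_atTop (⌈(c : ℝ)⌉₊ + 1)] with n hn r hr
    -- From here on the edge probability is not clipped.
    have hcn : (c / n : ℝ) ≤ 1 := by
      refine div_le_one_of_le₀ ?_ (Nat.cast_nonneg n)
      exact (Nat.le_ceil _).trans (by exact_mod_cast (Nat.le_succ _).trans hn)
    have := le_measureReal_hasForest hr N R (Set.projIcc (0 : ℝ) 1 zero_le_one (c / n))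
    rw [Set.projIcc_of_mem zero_le_one ⟨by positivity, hcn⟩] at this ⊢
    simpa only [Fintype.card_fin, Nat.sub_sub] using this

end Limit

/-! ### Truncated shapes of the branching process. -/

section Shape

lemma isNode_iff_of_eq_on {N N' : List ℕ → ℕ} {R : ℕ}
    (h : ∀ w, IsNode N w → w.length < R → N' w = N w) {w : List ℕ} (hw : w.length ≤ R) :
    IsNode N' w ↔ IsNode N w := by
  induction w with
  | nil => exact Iff.rfl
  | cons i w ih =>
    simp only [List.length_cons] at hw
    have ih := ih (by omega)
    constructor
    · intro hn
      have hn' := ih.1 hn.2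
      exact ⟨by rw [← h w hn' (by omega)]; exact hn.1, hn'⟩
    · intro hn
      exact ⟨by rw [h w hn.2 (by omega)]; exact hn.1, ih.2 hn.2⟩

/-- `t` is the family of offspring numbers of a tree, truncated at depth `R`. -/
def IsShape (R : ℕ) (t : List ℕ → ℕ) : Prop := ∀ w, ¬ (IsNode t w ∧ w.length < R) → t w = 0

lemma IsShape.eq_of_eq_on {R : ℕ} {t t' : List ℕ → ℕ} (ht : IsShape R t) (ht' : IsShape R t')
    (h : ∀ w, IsNode t w → w.length < R → t' w = t w) : t = t' := by
  funext w
  by_cases hw : IsNode t w ∧ w.length < R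
  · exact (h w hw.1 hw.2).symm
  · rw [ht w hw, ht' w]
    rintro ⟨h1, h2⟩
    exact hw ⟨(isNode_iff_of_eq_on h h2.le).1 h1, h2⟩

/-- Vanishing outside the inner nodes makes shapes finitely supported. It also makes them canonical,
so that different shapes describe disjoint events. -/
lemma countable_setOf_isShape (R : ℕ) : {t | IsShape R t}.Countable := by
  refine (Set.countable_range (fun f : List ℕ →₀ ℕ => (f : List ℕ → ℕ))).mono ?_
  intro t ht
  have hfin : (Function.support t).Finite := by
    refine (innerNodes t R).finite_toSet.subset fun w hw => ?_
    by_contra hcon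
    exact hw (ht w fun h => hcon (by simpa [mem_innerNodes] using h))
  exact ⟨Finsupp.ofSupportFinite t hfin, rfl⟩

variable {d : ℕ} {S : Set (Fin d → ℝ)}

/-- The families `ω` whose tree, truncated at depth `R`, has shape `t`. -/
def shapeSet (S : Set (Fin d → ℝ)) (R : ℕ) (t : List ℕ → ℕ) : Set (List ℕ → ℕ × S) :=
  {ω | ∀ w, IsNode t w → w.length < R → (ω w).1 = t w}

lemma shapeSet_eq_pi (R : ℕ) (t : List ℕ → ℕ) :
    shapeSet S R t = Set.pi (innerNodes t R : Set (List ℕ)) fun w => {t w} ×ˢ Set.univ := by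
  ext ω
  simp [shapeSet, Set.mem_pi, mem_innerNodes]

lemma measurableSet_shapeSet (R : ℕ) (t : List ℕ → ℕ) : MeasurableSet (shapeSet S R t) := by
  rw [shapeSet_eq_pi]
  exact MeasurableSet.pi (Finset.countable_toSet _)
    fun w _ => (measurableSet_singleton _).prod MeasurableSet.univ

lemma disjoint_shapeSet {R : ℕ} {t t' : List ℕ → ℕ} (ht : IsShape R t) (ht' : IsShape R t')
    (hne : t ≠ t') : Disjoint (shapeSet S R t) (shapeSet S R t') := by
  rw [Set.disjoint_left]
  intro ω hω hω'
  refine hne (ht.eq_of_eq_on ht' fun w hw hR => ?_)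
  rw [← hω w hw hR]
  refine (hω' w ?_ hR).symm
  rw [← isNode_iff_of_eq_on (N' := fun w => (ω w).1) hω' hR.le]
  exact (isNode_iff_of_eq_on (N' := fun w => (ω w).1) hω hR.le).2 hw

open Classical in
lemma exists_isShape_mem_shapeSet (R : ℕ) (ω : List ℕ → ℕ × S) :
    ∃ t, IsShape R t ∧ ω ∈ shapeSet S R t := by
  let t : List ℕ → ℕ := fun w =>
    if IsNode (fun w => (ω w).1) w ∧ w.length < R then (ω w).1 else 0
  have key : ∀ w, w.length ≤ R → (IsNode t w ↔ IsNode (fun w => (ω w).1) w) := fun w hw =>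
    isNode_iff_of_eq_on (fun w h1 h2 => by simp [t, h1, h2]) hw
  refine ⟨t, fun w hw => ?_, fun w hw hR => ?_⟩
  · have : ¬ (IsNode (fun w => (ω w).1) w ∧ w.length < R) :=
      fun h => hw ⟨(key w h.2.le).2 h.1, h.2⟩
    simp only [t, if_neg this]
  · have : IsNode (fun w => (ω w).1) w ∧ w.length < R := ⟨(key w hR.le).1 hw, hR⟩
    simp only [t, if_pos this]

open Classical in
/-- The family with offspring numbers `t` and features `y` at the nodes of depth at most `R`. -/
noncomputable def decorate (R : ℕ) (t : List ℕ → ℕ) (s₀ : S) (y : innerNodes t (R + 1) → S) :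
    List ℕ → ℕ × S := fun w => (t w, if h : w ∈ innerNodes t (R + 1) then y ⟨w, h⟩ else s₀)

lemma agreeUpTo_decorate {R : ℕ} {t : List ℕ → ℕ} (s₀ : S) {ω : List ℕ → ℕ × S}
    (hω : ω ∈ shapeSet S R t) :
    AgreeUpTo R ω (decorate R t s₀ fun w => (ω w).2) := by
  intro w hw hR
  have hn : IsNode t w := (isNode_iff_of_eq_on (N' := fun w => (ω w).1) hω hR).1 hw
  have hmem : w ∈ innerNodes t (R + 1) := mem_innerNodes.2 ⟨hn, by omega⟩
  refine ⟨by simp [decorate, hmem], fun hlt => ?_⟩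
  exact hω w hn hlt

lemma measurable_decorate (R : ℕ) (t : List ℕ → ℕ) (s₀ : S) : Measurable (decorate R t s₀) := by
  refine measurable_pi_lambda _ fun w => ?_
  unfold decorate
  by_cases h : w ∈ innerNodes t (R + 1)
  · simp only [h, dite_true]
    exact measurable_const.prodMk (measurable_pi_apply _)
  · simp only [h, dite_false]
    exact measurable_const

variable (c : ℝ≥0) (D : Measure S) [IsProbabilityMeasure D]

lemma fbpLaw_shapeSet (R : ℕ) (t : List ℕ → ℕ) :
    fbpLaw c D (shapeSet S R t) = ∏ w ∈ innerNodes t R, poissonMeasure c {t w} := by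
  rw [shapeSet_eq_pi, fbpLaw, Measure.infinitePi_pi _
    fun w _ => (measurableSet_singleton _).prod MeasurableSet.univ]
  simp [Measure.prod_prod]

lemma fbpLaw_real_shapeSet (R : ℕ) (t : List ℕ → ℕ) :
    (fbpLaw c D).real (shapeSet S R t) =
      ∏ w ∈ innerNodes t R, (poissonMeasure c).real {t w} := by
  rw [Measure.real, fbpLaw_shapeSet, ENNReal.toReal_prod]
  rfl

/-- Finitely many shapes carry almost all of the law of the branching process. -/
lemma exists_finset_shapes (R : ℕ) {η : ℝ} (hη : 0 < η) :
    ∃ 𝒯 : Finset (List ℕ → ℕ), (∀ t ∈ 𝒯, IsShape R t) ∧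
      1 - η < ∑ t ∈ 𝒯, (fbpLaw c D).real (shapeSet S R t) := by
  have : Countable {t // IsShape R t} := (countable_setOf_isShape R).to_subtype
  have hsum : HasSum (fun t : {t // IsShape R t} => (fbpLaw c D).real (shapeSet S R t.1)) 1 := by
    have h := measure_iUnion (μ := fbpLaw c D)
      (f := fun t : {t // IsShape R t} => shapeSet S R t.1)
      (fun t t' hne => disjoint_shapeSet t.2 t'.2 fun h => hne (Subtype.ext h))
      (fun t => measurableSet_shapeSet R t.1)
    have huniv : ⋃ t : {t // IsShape R t}, shapeSet S R t.1 = Set.univ := by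
      refine Set.eq_univ_of_forall fun ω => ?_
      obtain ⟨t, ht, hω⟩ := exists_isShape_mem_shapeSet R ω
      exact Set.mem_iUnion.2 ⟨⟨t, ht⟩, hω⟩
    rw [huniv, measure_univ] at h
    have h' := ENNReal.hasSum_toReal (h ▸ ENNReal.one_ne_top)
    rwa [← ENNReal.tsum_toReal_eq fun t => measure_ne_top _ _, ← h, ENNReal.toReal_one] at h'
  obtain ⟨s, hs⟩ := (hsum.eventually (lt_mem_nhds (by linarith : 1 - η < 1))).exists
  refine ⟨s.map (Function.Embedding.subtype _), ?_, ?_⟩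
  · intro t ht
    obtain ⟨x, -, rfl⟩ := Finset.mem_map.1 ht
    exact x.2
  · rw [Finset.sum_map]
    exact hs

lemma poissonMeasure_singleton_ne_zero {c : ℝ≥0} (hc : 0 < c) (k : ℕ) :
    poissonMeasure c {k} ≠ 0 := fun h => by
  have := poissonMeasure_real_singleton_pos k hc
  rw [Measure.real, h] at this
  simp at this

/-- Given the shape of the branching process up to depth `R`, the features are independent with
law `D`. -/
lemma map_restrict_shapeSet {c : ℝ≥0} (hc : 0 < c) (R : ℕ) (t : List ℕ → ℕ) :
    ((fbpLaw c D).restrict (shapeSet S R t)).map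
      (fun ω (w : innerNodes t (R + 1)) => (ω w).2) =
      fbpLaw c D (shapeSet S R t) • Measure.pi fun _ : innerNodes t (R + 1) => D := by
  classical
  set Q := fbpLaw c D (shapeSet S R t) with hQ
  -- As `c` is positive every shape is possible, and one may normalise by `Q`. The product measure
  -- is then recognised by its values on boxes.
  have hQ0 : Q ≠ 0 := by
    rw [hQ, fbpLaw_shapeSet, Finset.prod_ne_zero_iff]
    exact fun w _ => poissonMeasure_singleton_ne_zero hc _
  have hQt : Q ≠ ∞ := measure_ne_top _ _
  have hmeas : Measurable (fun (ω : List ℕ → ℕ × S) (w : innerNodes t (R + 1)) => (ω w).2) :=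
    measurable_pi_lambda _ fun w => measurable_snd.comp (measurable_pi_apply _)
  have key : Measure.pi (fun _ : innerNodes t (R + 1) => D) =
      Q⁻¹ • ((fbpLaw c D).restrict (shapeSet S R t)).map
        (fun ω (w : innerNodes t (R + 1)) => (ω w).2) := by
    refine Measure.pi_eq fun s hs => ?_
    rw [Measure.smul_apply, Measure.map_apply hmeas (MeasurableSet.univ_pi hs),
      Measure.restrict_apply (hmeas (MeasurableSet.univ_pi hs))]
    let s' : List ℕ → Set S := fun w => if h : w ∈ innerNodes t (R + 1) then s ⟨w, h⟩ else Set.univ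
    have hs' : ∀ w, MeasurableSet (s' w) := by
      intro w
      simp only [s']
      split_ifs
      · exact hs _
      · exact MeasurableSet.univ
    have hset : (fun (ω : List ℕ → ℕ × S) (w : innerNodes t (R + 1)) => (ω w).2) ⁻¹'
        (Set.univ.pi s) ∩ shapeSet S R t = Set.pi (innerNodes t (R + 1) : Set (List ℕ))
          fun w => (if w ∈ innerNodes t R then {t w} else Set.univ) ×ˢ s' w := by
      ext ω
      simp only [Set.mem_inter_iff, Set.mem_preimage, Set.mem_pi, Set.mem_univ, true_implies,
        Set.mem_prod, Finset.mem_coe, shapeSet, Set.mem_ofPred_eq]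
      constructor
      · rintro ⟨h1, h2⟩ w hw
        refine ⟨?_, ?_⟩
        · split_ifs with hi
          · rw [mem_innerNodes] at hi
            exact h2 w hi.1 hi.2
          · trivial
        · simp only [s', dif_pos hw]
          exact h1 ⟨w, hw⟩
      · intro h
        refine ⟨fun w => ?_, fun w hw hR => ?_⟩
        · have := (h w.1 w.2).2
          simp only [s', dif_pos w.2] at this
          exact this
        · have := (h w (mem_innerNodes.2 ⟨hw, by omega⟩)).1
          rw [if_pos (mem_innerNodes.2 ⟨hw, hR⟩)] at this
          exact this
    rw [hset, fbpLaw, Measure.infinitePi_pi]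
    · simp only [Measure.prod_prod]
      rw [Finset.prod_mul_distrib]
      have h1 : ∏ w ∈ innerNodes t (R + 1),
          poissonMeasure c (if w ∈ innerNodes t R then {t w} else Set.univ) = Q := by
        rw [hQ, fbpLaw_shapeSet]
        symm
        refine (Finset.prod_congr rfl fun w hw => ?_).trans
          (Finset.prod_subset (fun w hw => ?_) fun w _ hw => ?_)
        · rw [if_pos hw]
        · rw [mem_innerNodes] at hw ⊢
          exact ⟨hw.1, by omega⟩
        · rw [if_neg hw, measure_univ]
      have h2 : ∏ w ∈ innerNodes t (R + 1), D (s' w) = ∏ w, D (s w) := by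
        rw [← Finset.prod_coe_sort]
        refine Finset.prod_congr rfl fun w _ => ?_
        simp only [s', dif_pos w.2]
      rw [h1, h2, smul_eq_mul, ← mul_assoc, ENNReal.inv_mul_cancel hQ0 hQt, one_mul]
    · intro w _
      refine MeasurableSet.prod ?_ (hs' w)
      split_ifs
      · exact measurableSet_singleton _
      · exact MeasurableSet.univ
  rw [key, smul_smul, ENNReal.mul_inv_cancel hQ0 hQt, one_smul]

/-- A function that depends only on the tree up to depth `R`. -/
def DependsUpTo (R : ℕ) (F : (List ℕ → ℕ × S) → ℝ) : Prop :=
  ∀ ω ω', AgreeUpTo R ω ω' → F ω = F ω'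

lemma setIntegral_shapeSet {c : ℝ≥0} (hc : 0 < c) {R : ℕ} {F : (List ℕ → ℕ × S) → ℝ}
    (hF : DependsUpTo R F) (hFm : Measurable F) (t : List ℕ → ℕ) (s₀ : S) :
    ∫ ω in shapeSet S R t, F ω ∂(fbpLaw c D) = (fbpLaw c D).real (shapeSet S R t) *
      ∫ y, F (decorate R t s₀ y) ∂(Measure.pi fun _ => D) := by
  have hmeas : Measurable (fun (ω : List ℕ → ℕ × S) (w : innerNodes t (R + 1)) => (ω w).2) :=
    measurable_pi_lambda _ fun w => measurable_snd.comp (measurable_pi_apply _)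
  have e1 : ∫ ω in shapeSet S R t, F ω ∂(fbpLaw c D) =
      ∫ ω in shapeSet S R t, F (decorate R t s₀ fun w => (ω w).2) ∂(fbpLaw c D) :=
    setIntegral_congr_fun (measurableSet_shapeSet R t)
      fun ω hω => hF _ _ (agreeUpTo_decorate s₀ hω)
  have hG : Measurable fun y => F (decorate R t s₀ y) := hFm.comp (measurable_decorate R t s₀)
  rw [e1, ← integral_map (φ := fun (ω : List ℕ → ℕ × S) (w : innerNodes t (R + 1)) => (ω w).2)
    (f := fun y => F (decorate R t s₀ y)) hmeas.aemeasurable hG.aestronglyMeasurable,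
    map_restrict_shapeSet D hc, integral_smul_measure]
  rfl

end Shape

/-! ### Independent features on the covers at two vertices. -/

section RandomCover

variable {d : ℕ} {S : Set (Fin d → ℝ)}

lemma map_comp_pi {J V : Type*} [Fintype J] [Fintype V] (D : Measure S) [IsProbabilityMeasure D]
    {φ : J → V} (hφ : Function.Injective φ) :
    (Measure.pi fun _ : V => D).map (fun χ j => χ (φ j)) = Measure.pi fun _ : J => D := by
  have h := (iIndepFun_pi (μ := fun _ : V => D) (X := fun _ x => x)
    fun _ => aemeasurable_id).precomp hφ
  rw [iIndepFun_iff_map_fun_eq_pi_map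
    (fun j => (measurable_pi_apply (φ j)).aemeasurable)] at h
  rw [h]
  congr 1
  funext j
  exact (measurePreserving_eval (fun _ : V => D) (φ j)).map_eq

lemma integral_mul_comp_pi {J J' V : Type*} [Fintype J] [Fintype J'] [Fintype V] (D : Measure S)
    [IsProbabilityMeasure D] {φ : J → V} {φ' : J' → V} (h : Function.Injective (Sum.elim φ φ'))
    {f : (J → S) → ℝ} {g : (J' → S) → ℝ} (hf : Measurable f) (hg : Measurable g) :
    ∫ χ : V → S, f (fun j => χ (φ j)) * g (fun j => χ (φ' j)) ∂(Measure.pi fun _ => D) =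
      (∫ y, f y ∂(Measure.pi fun _ => D)) * ∫ y, g y ∂(Measure.pi fun _ => D) := by
  have hm : Measurable fun (χ : V → S) (j : J ⊕ J') => χ (Sum.elim φ φ' j) :=
    measurable_pi_lambda _ fun j => measurable_pi_apply _
  have hm1 : Measurable fun (y : J ⊕ J' → S) (j : J) => y (.inl j) :=
    measurable_pi_lambda _ fun j => measurable_pi_apply _
  have hm2 : Measurable fun (y : J ⊕ J' → S) (j : J') => y (.inr j) :=
    measurable_pi_lambda _ fun j => measurable_pi_apply _
  have h1 := integral_map (μ := Measure.pi fun _ : V => D) hm.aemeasurable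
    (f := fun y : J ⊕ J' → S => f (fun j => y (.inl j)) * g (fun j => y (.inr j)))
    ((hf.comp hm1).mul (hg.comp hm2)).aestronglyMeasurable
  rw [map_comp_pi D h] at h1
  have h2 := (measurePreserving_sumPiEquivProdPi (X := fun _ : J ⊕ J' => S)
    fun _ => D).integral_comp' (g := fun p : (J → S) × (J' → S) => f p.1 * g p.2)
  refine h1.symm.trans (h2.trans ?_)
  exact integral_prod_mul f g

/-- The offspring numbers and features of the universal cover of a finite graph. -/
noncomputable def graphCover {V : Type} [Finite V] (G : SimpleGraph V) (χ : V → S) (v : V) :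
    List ℕ → ℕ × S := fun w =>
  ((coverChildren G.finNbrs v w).card, χ (coverPos G.finNbrs v w))

variable {V : Type} [Fintype V] {G : SimpleGraph V} {r : Bool → V} {N : Bool → List ℕ → ℕ} {R : ℕ}

lemma HasForest.mem_shapeSet (h : HasForest G r N R) (χ : V → S) (b : Bool) :
    graphCover G χ (r b) ∈ shapeSet S R (N b) := fun w hw hR => h.1 b w hw hR

lemma HasForest.isCoverNode_iff (h : HasForest G r N R) (b : Bool) {w : List ℕ}
    (hw : w.length ≤ R) : IsCoverNode G.finNbrs (r b) w ↔ IsNode (N b) w :=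
  isNode_iff_of_eq_on (fun w h1 h2 => h.1 b w h1 h2) hw

lemma HasForest.coverInjective (h : HasForest G r N R) (b : Bool) :
    CoverInjective G.finNbrs (r b) R := fun w w' hw hw' hl hl' he =>
  (h.2 b b w w' ((h.isCoverNode_iff b hl).1 hw) ((h.isCoverNode_iff b hl').1 hw') hl hl' he).2

/-- Joint injectivity makes the features read by the two factors those of distinct vertices, hence
independent. -/
lemma HasForest.integral_mul (h : HasForest G r N R) (D : Measure S) [IsProbabilityMeasure D]
    {F : (List ℕ → ℕ × S) → ℝ} (hF : DependsUpTo R F) (hFm : Measurable F) (s₀ : S) :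
    ∫ χ, F (graphCover G χ (r true)) * F (graphCover G χ (r false)) ∂(Measure.pi fun _ => D) =
      (∫ y, F (decorate R (N true) s₀ y) ∂(Measure.pi fun _ => D)) *
        ∫ y, F (decorate R (N false) s₀ y) ∂(Measure.pi fun _ => D) := by
  have e : ∀ (b : Bool) (χ : V → S), F (graphCover G χ (r b)) =
      F (decorate R (N b) s₀ fun w => χ (coverPos G.finNbrs (r b) w)) := fun b χ =>
    hF _ _ (agreeUpTo_decorate s₀ (h.mem_shapeSet χ b))
  simp only [e]
  have node : ∀ {b} (w : innerNodes (N b) (R + 1)), IsNode (N b) w ∧ w.1.length ≤ R := by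
    intro b w
    have := mem_innerNodes.1 w.2
    exact ⟨this.1, by omega⟩
  refine integral_mul_comp_pi D
    (φ := fun w : innerNodes (N true) (R + 1) => coverPos G.finNbrs (r true) w)
    (φ' := fun w : innerNodes (N false) (R + 1) => coverPos G.finNbrs (r false) w) ?_
    (hFm.comp (measurable_decorate R (N true) s₀)) (hFm.comp (measurable_decorate R (N false) s₀))
  rintro (w | w) (w' | w') he
  · exact congrArg Sum.inl (Subtype.ext
      (h.2 _ _ _ _ (node w).1 (node w').1 (node w).2 (node w').2 he).2)
  · exact absurd (h.2 _ _ _ _ (node w).1 (node w').1 (node w).2 (node w').2 he).1 (by simp)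
  · exact absurd (h.2 _ _ _ _ (node w).1 (node w').1 (node w).2 (node w').2 he).1 (by simp)
  · exact congrArg Sum.inr (Subtype.ext
      (h.2 _ _ _ _ (node w).1 (node w').1 (node w).2 (node w').2 he).2)

lemma HasForest.eq (h : HasForest G r N R) {N' : Bool → List ℕ → ℕ} (h' : HasForest G r N' R)
    (hN : ∀ b, IsShape R (N b)) (hN' : ∀ b, IsShape R (N' b)) : N = N' := by
  funext b
  refine (hN b).eq_of_eq_on (hN' b) fun w hw hR => ?_
  rw [← h.1 b w hw hR]
  exact (h'.1 b w ((h'.isCoverNode_iff b hR.le).1 ((h.isCoverNode_iff b hR.le).2 hw)) hR).symm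

end RandomCover

/-! ### The law of large numbers for local functions. -/

section SecondMoment

variable {d : ℕ} {S : Set (Fin d → ℝ)}

instance instIsProbabilityMeasureRandomFeaturedGraph (c : ℝ≥0) (D : Measure S)
    [IsProbabilityMeasure D] (n : ℕ) : IsProbabilityMeasure (randomFeaturedGraph c D n) := by
  unfold randomFeaturedGraph
  infer_instance

open Classical in
/-- The value of `F` on the universal cover at `v`, if that is injective up to depth `R`, and `0`
otherwise. -/
noncomputable def localValue {n : ℕ} (R : ℕ) (F : (List ℕ → ℕ × S) → ℝ) (v : Fin n)
    (ω : SimpleGraph (Fin n) × (Fin n → S)) : ℝ :=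
  if CoverInjective ω.1.finNbrs v R then F (graphCover ω.1 ω.2 v) else 0

lemma measurable_graphCover {V : Type} [Finite V] (G : SimpleGraph V) (v : V) :
    Measurable fun χ : V → S => graphCover G χ v :=
  measurable_pi_lambda _ fun _ => measurable_const.prodMk (measurable_pi_apply _)

lemma measurable_localValue {n : ℕ} (R : ℕ) {F : (List ℕ → ℕ × S) → ℝ} (hF : Measurable F)
    (v : Fin n) : Measurable (localValue R F v) := by
  refine measurable_from_prod_countable_right fun G => ?_
  unfold localValue
  by_cases h : CoverInjective G.finNbrs v R
  · simp only [h, if_true]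
    exact hF.comp (measurable_graphCover G v)
  · simp only [h, if_false]
    exact measurable_const

lemma abs_localValue_le {n : ℕ} {R : ℕ} {F : (List ℕ → ℕ × S) → ℝ} {B : ℝ}
    (hB : ∀ ω, |F ω| ≤ B) (v : Fin n) (ω : SimpleGraph (Fin n) × (Fin n → S)) :
    |localValue R F v ω| ≤ B := by
  unfold localValue
  split_ifs
  · exact hB _
  · simpa using (abs_nonneg _).trans (hB (graphCover ω.1 ω.2 v))

variable {c : ℝ≥0} (D : Measure S) [IsProbabilityMeasure D]

/-- The sum is the integral of `F` over the listed shapes. As `F` has mean zero, it is minus the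
integral over the rest, which has mass less than `η`. -/
lemma abs_sum_shapes_le (hc : 0 < c) {R : ℕ} {F : (List ℕ → ℕ × S) → ℝ} (hF : DependsUpTo R F)
    (hFm : Measurable F) {K η : ℝ} (hK : ∀ ω, |F ω| ≤ K)
    (hF0 : ∫ ω, F ω ∂(fbpLaw c D) = 0) (s₀ : S) {𝒯 : Finset (List ℕ → ℕ)}
    (h𝒯 : ∀ t ∈ 𝒯, IsShape R t)
    (hη : 1 - η < ∑ t ∈ 𝒯, (fbpLaw c D).real (shapeSet S R t)) :
    |∑ t ∈ 𝒯, (fbpLaw c D).real (shapeSet S R t) *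
      ∫ y, F (decorate R t s₀ y) ∂(Measure.pi fun _ => D)| ≤ K * η := by
  have hK0 : 0 ≤ K := (abs_nonneg _).trans (hK fun _ => (0, s₀))
  have hint : Integrable F (fbpLaw c D) :=
    Integrable.of_bound hFm.aestronglyMeasurable K (.of_forall hK)
  have hdisj : (𝒯 : Set (List ℕ → ℕ)).PairwiseDisjoint (shapeSet S R) :=
    fun t ht t' ht' hne => disjoint_shapeSet (h𝒯 t ht) (h𝒯 t' ht') hne
  have hms : MeasurableSet (⋃ t ∈ 𝒯, shapeSet S R t) :=
    Finset.measurableSet_biUnion _ fun t _ => measurableSet_shapeSet R t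
  have h1 : ∑ t ∈ 𝒯, (fbpLaw c D).real (shapeSet S R t) *
      ∫ y, F (decorate R t s₀ y) ∂(Measure.pi fun _ => D) =
      ∫ ω in ⋃ t ∈ 𝒯, shapeSet S R t, F ω ∂(fbpLaw c D) := by
    rw [integral_biUnion_finset _ (fun t _ => measurableSet_shapeSet R t) hdisj
      fun t _ => hint.integrableOn]
    exact Finset.sum_congr rfl fun t _ => (setIntegral_shapeSet D hc hF hFm t s₀).symm
  have h2 := integral_add_compl hms hint
  have h3 : (fbpLaw c D).real (⋃ t ∈ 𝒯, shapeSet S R t) =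
      ∑ t ∈ 𝒯, (fbpLaw c D).real (shapeSet S R t) :=
    measureReal_biUnion_finset hdisj fun t _ => measurableSet_shapeSet R t
  have h4 : |∫ ω in (⋃ t ∈ 𝒯, shapeSet S R t)ᶜ, F ω ∂(fbpLaw c D)| ≤
      K * (fbpLaw c D).real (⋃ t ∈ 𝒯, shapeSet S R t)ᶜ := by
    have := norm_setIntegral_le_of_norm_le_const (μ := fbpLaw c D) (f := F) (C := K)
      (s := (⋃ t ∈ 𝒯, shapeSet S R t)ᶜ) (measure_lt_top _ _) fun ω _ => hK ω
    exact this
  rw [probReal_compl_eq_one_sub hms, h3] at h4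
  rw [h1, eq_neg_of_add_eq_zero_left (h2.trans hF0), abs_neg]
  exact h4.trans (mul_le_mul_of_nonneg_left (by linarith) hK0)

/-- The values of a local function at two vertices are asymptotically uncorrelated. -/
lemma eventually_integral_mul_le (hc : 0 < c) {R : ℕ} {F : (List ℕ → ℕ × S) → ℝ}
    (hF : DependsUpTo R F) (hFm : Measurable F) {B : ℝ} (hB : ∀ ω, |F ω| ≤ B) {ε : ℝ}
    (hε : 0 < ε) :
    ∀ᶠ n : ℕ in atTop, ∀ v v' : Fin n, v ≠ v' →
      ∫ ω, (localValue R F v ω - ∫ ω', F ω' ∂(fbpLaw c D)) *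
        (localValue R F v' ω - ∫ ω', F ω' ∂(fbpLaw c D)) ∂(randomFeaturedGraph c D n) ≤ ε := by
  classical
  obtain ⟨s₀⟩ : Nonempty S := nonempty_of_isProbabilityMeasure D
  have hB0 : 0 ≤ B := (abs_nonneg _).trans (hB fun _ => (0, s₀))
  set m := ∫ ω', F ω' ∂(fbpLaw c D) with hm
  have hint : Integrable F (fbpLaw c D) :=
    Integrable.of_bound hFm.aestronglyMeasurable B (.of_forall hB)
  have hmB : |m| ≤ B := by
    have := norm_integral_le_of_norm_le_const (μ := fbpLaw c D) (f := F) (.of_forall hB)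
    simpa using this
  set K := 2 * B with hKdef
  let F₀ : (List ℕ → ℕ × S) → ℝ := fun ω => F ω - m
  have hF₀ : DependsUpTo R F₀ := fun ω ω' h => by simp only [F₀, hF ω ω' h]
  have hF₀m : Measurable F₀ := hFm.sub_const m
  have hF₀K : ∀ ω, |F₀ ω| ≤ K := fun ω => (abs_sub _ _).trans (by have := hB ω; linarith)
  have hF₀0 : ∫ ω, F₀ ω ∂(fbpLaw c D) = 0 := by
    simp only [F₀]
    rw [integral_sub hint (integrable_const _)]
    simp [hm]
  -- In the limit, the square of the truncated mean costs `K ^ 2 * η`, and the pairs of shapes not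
  -- listed cost `2 * K ^ 2 * η`.
  obtain ⟨η, hη0, hη1, hηε⟩ : ∃ η : ℝ, 0 < η ∧ η ≤ 1 ∧ 3 * K ^ 2 * η < ε := by
    refine ⟨min 1 (ε / (4 * (K ^ 2 + 1))), lt_min one_pos (by positivity), min_le_left _ _, ?_⟩
    have h1 : 3 * K ^ 2 * min 1 (ε / (4 * (K ^ 2 + 1))) ≤ 3 * K ^ 2 * (ε / (4 * (K ^ 2 + 1))) :=
      mul_le_mul_of_nonneg_left (min_le_right _ _) (by positivity)
    refine h1.trans_lt ?_
    rw [mul_div_assoc', div_lt_iff₀ (by positivity)]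
    nlinarith [sq_nonneg K]
  obtain ⟨𝒯, h𝒯, hsum⟩ := exists_finset_shapes (S := S) c D R hη0
  set P : (List ℕ → ℕ) → ℝ := fun t => (fbpLaw c D).real (shapeSet S R t) with hP
  let a : (List ℕ → ℕ) → ℝ := fun t => ∫ y, F₀ (decorate R t s₀ y) ∂(Measure.pi fun _ => D)
  have haK : ∀ t, |a t| ≤ K := by
    intro t
    have := norm_integral_le_of_norm_le_const (μ := Measure.pi fun _ : innerNodes t (R + 1) => D)
      (f := fun y => F₀ (decorate R t s₀ y)) (.of_forall fun y => hF₀K _)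
    simpa using this
  have hPa : |∑ t ∈ 𝒯, P t * a t| ≤ K * η :=
    abs_sum_shapes_le D hc hF₀ hF₀m hF₀K hF₀0 s₀ h𝒯 hsum
  have hP1 : ∑ t ∈ 𝒯, P t ≤ 1 := by
    have h3 : (fbpLaw c D).real (⋃ t ∈ 𝒯, shapeSet S R t) = ∑ t ∈ 𝒯, P t :=
      measureReal_biUnion_finset
        (fun t ht t' ht' hne => disjoint_shapeSet (h𝒯 t ht) (h𝒯 t' ht') hne)
        fun t _ => measurableSet_shapeSet R t
    rw [← h3]
    exact measureReal_le_one
  let pr : (List ℕ → ℕ) × (List ℕ → ℕ) → Bool → List ℕ → ℕ := fun p b => cond b p.1 p.2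
  choose L hL hLle using fun p => exists_tendsto_le_measureReal_hasForest c (pr p) R
  have hL' : ∀ p, Tendsto (L p) atTop (𝓝 (P p.1 * P p.2)) := by
    intro p
    have := hL p
    rw [Fintype.prod_bool] at this
    simp only [hP, fbpLaw_real_shapeSet]
    exact this
  have hU : Tendsto (fun n => K ^ 2 + ∑ p ∈ 𝒯 ×ˢ 𝒯, L p n * (a p.1 * a p.2 - K ^ 2)) atTop
      (𝓝 (K ^ 2 + ∑ p ∈ 𝒯 ×ˢ 𝒯, P p.1 * P p.2 * (a p.1 * a p.2 - K ^ 2))) :=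
    (tendsto_finsetSum _ fun p _ => (hL' p).mul_const _).const_add _
  have hlim : K ^ 2 + ∑ p ∈ 𝒯 ×ˢ 𝒯, P p.1 * P p.2 * (a p.1 * a p.2 - K ^ 2) < ε := by
    have e : ∑ p ∈ 𝒯 ×ˢ 𝒯, P p.1 * P p.2 * (a p.1 * a p.2 - K ^ 2) =
        (∑ t ∈ 𝒯, P t * a t) ^ 2 - K ^ 2 * (∑ t ∈ 𝒯, P t) ^ 2 := by
      rw [sq (∑ t ∈ 𝒯, P t * a t), sq (∑ t ∈ 𝒯, P t), Finset.sum_mul_sum, Finset.sum_mul_sum,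
        ← Finset.sum_product', ← Finset.sum_product', Finset.mul_sum, ← Finset.sum_sub_distrib]
      exact Finset.sum_congr rfl fun p _ => by ring
    rw [e]
    have h1 : (∑ t ∈ 𝒯, P t * a t) ^ 2 ≤ (K * η) ^ 2 := sq_le_sq' (abs_le.1 hPa).1 (abs_le.1 hPa).2
    have h2 : 1 - (∑ t ∈ 𝒯, P t) ^ 2 ≤ 2 * η := by nlinarith
    have h3 : K ^ 2 * (1 - (∑ t ∈ 𝒯, P t) ^ 2) ≤ K ^ 2 * (2 * η) :=
      mul_le_mul_of_nonneg_left h2 (sq_nonneg K)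
    have h4 : (K * η) ^ 2 ≤ K ^ 2 * η := by
      rw [mul_pow]
      exact mul_le_mul_of_nonneg_left (by nlinarith) (sq_nonneg K)
    nlinarith
  have hev : ∀ᶠ n : ℕ in atTop, ∀ p ∈ 𝒯 ×ˢ 𝒯, ∀ r : Bool → Fin n, Function.Injective r → L p n ≤
        (binomialRandom (Fin n) (Set.projIcc (0 : ℝ) 1 zero_le_one (c / n))).real
          {G | HasForest G r (pr p) R} := by
    rw [Filter.eventually_all_finset]
    exact fun p _ => hLle p
  filter_upwards [hev, hU.eventually (gt_mem_nhds hlim)] with n hn hUn v v' hne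
  refine le_trans ?_ hUn.le
  let r : Bool → Fin n := fun b => cond b v v'
  have hr : Function.Injective r := by
    rintro (_ | _) (_ | _) h
    · rfl
    · exact absurd h.symm hne
    · exact absurd h hne
    · rfl
  set μ := binomialRandom (Fin n) (Set.projIcc (0 : ℝ) 1 zero_le_one (c / n)) with hμ
  let H : (List ℕ → ℕ) × (List ℕ → ℕ) → Set (SimpleGraph (Fin n)) := fun p =>
    {G | HasForest G r (pr p) R}
  have hZ : ∀ (u : Fin n) (ω : SimpleGraph (Fin n) × (Fin n → S)), |localValue R F u ω - m| ≤ K :=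
    fun u ω => (abs_sub _ _).trans (by have := abs_localValue_le (R := R) hB u ω; linarith)
  have hZm : ∀ u : Fin n, Measurable fun ω : SimpleGraph (Fin n) × (Fin n → S) =>
      localValue R F u ω - m := fun u => (measurable_localValue R hFm u).sub_const m
  have hprod : ∀ ω, |(localValue R F v ω - m) * (localValue R F v' ω - m)| ≤ K ^ 2 := by
    intro ω
    rw [abs_mul, sq]
    exact mul_le_mul (hZ v ω) (hZ v' ω) (abs_nonneg _) ((abs_nonneg _).trans (hZ v ω))
  -- Features are integrated first. On a graph with listed shapes the integral factorises; on all
  -- other graphs, including those with cycles nearby, the trivial bound `K ^ 2` is kept.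
  have hptw : ∀ G : SimpleGraph (Fin n),
      ∫ χ, (localValue R F v (G, χ) - m) * (localValue R F v' (G, χ) - m) ∂(Measure.pi fun _ => D) ≤
      K ^ 2 + ∑ p ∈ 𝒯 ×ˢ 𝒯, (H p).indicator (fun _ => a p.1 * a p.2 - K ^ 2) G := by
    intro G
    by_cases hG : ∃ p ∈ 𝒯 ×ˢ 𝒯, G ∈ H p
    · obtain ⟨p, hp, hGp⟩ := hG
      have hpr : ∀ q ∈ 𝒯 ×ˢ 𝒯, ∀ b, IsShape R (pr q b) := by
        rintro q hq (_ | _)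
        · exact h𝒯 _ (Finset.mem_product.1 hq).2
        · exact h𝒯 _ (Finset.mem_product.1 hq).1
      rw [Finset.sum_eq_single p]
      · rw [Set.indicator_of_mem hGp]
        have h1 := HasForest.integral_mul hGp D hF₀ hF₀m s₀
        have hv : CoverInjective G.finNbrs v R := HasForest.coverInjective hGp true
        have hv' : CoverInjective G.finNbrs v' R := HasForest.coverInjective hGp false
        simp only [localValue, hv, hv', if_true]
        refine le_of_eq (h1.trans ?_)
        simp only [a, pr, cond_true, cond_false]
        ring
      · intro q hq hqp
        rw [Set.indicator_of_notMem]
        intro hGq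
        apply hqp
        have := HasForest.eq hGq hGp (hpr q hq) (hpr p hp)
        exact Prod.ext (congrFun this true) (congrFun this false)
      · exact fun h => absurd hp h
    · rw [Finset.sum_eq_zero, add_zero]
      · have := norm_integral_le_of_norm_le_const (μ := Measure.pi fun _ : Fin n => D)
          (f := fun χ => (localValue R F v (G, χ) - m) * (localValue R F v' (G, χ) - m))
          (.of_forall fun χ => hprod (G, χ))
        rw [probReal_univ, mul_one] at this
        exact (le_abs_self _).trans this
      · intro p hp
        exact Set.indicator_of_notMem (fun h => hG ⟨p, hp, h⟩) _
  have hintZ : Integrable (fun ω => (localValue R F v ω - m) * (localValue R F v' ω - m))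
      (μ.prod (Measure.pi fun _ => D)) :=
    Integrable.of_bound ((hZm v).mul (hZm v')).aestronglyMeasurable (K ^ 2) (.of_forall hprod)
  have hfin : ∀ f : SimpleGraph (Fin n) → ℝ, Integrable f μ := fun f => Integrable.of_finite
  rw [randomFeaturedGraph, integral_prod _ hintZ]
  refine (integral_mono (hfin _) (hfin _) hptw).trans ?_
  rw [integral_add (hfin _) (hfin _), integral_const, probReal_univ, one_smul,
    integral_finsetSum _ fun p _ => hfin _]
  refine add_le_add le_rfl (Finset.sum_le_sum fun p hp => ?_)
  rw [integral_indicator_const _ (measurableSet_simpleGraph _), smul_eq_mul]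
  -- Lower bounds for the forest probabilities suffice, because they are multiplied by a nonpositive
  -- number.
  refine mul_le_mul_of_nonpos_right (hn p hp r hr) ?_
  have h1 : |a p.1 * a p.2| ≤ K ^ 2 := by
    rw [abs_mul, sq]
    exact mul_le_mul (haK _) (haK _) (abs_nonneg _) ((abs_nonneg _).trans (haK p.1))
  linarith [(abs_le.1 h1).2]

/-- The property `P n` holds in the random featured graph on `n` nodes with probability
tending to `1`. -/
def Whp (c : ℝ≥0) (D : Measure S) (P : ∀ n : ℕ, SimpleGraph (Fin n) × (Fin n → S) → Prop) : Prop :=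
  ∀ ε : ℝ, 0 < ε → ∀ᶠ n : ℕ in atTop, (randomFeaturedGraph c D n).real {ω | ¬ P n ω} ≤ ε

variable {D}

/-- No measurability of the events is needed here or in `Whp.and`: monotonicity and subadditivity
hold for outer measures. -/
lemma Whp.mono {P Q : ∀ n : ℕ, SimpleGraph (Fin n) × (Fin n → S) → Prop} (hP : Whp c D P)
    (h : ∀ᶠ n : ℕ in atTop, ∀ ω, P n ω → Q n ω) : Whp c D Q := by
  intro ε hε
  filter_upwards [hP ε hε, h] with n hn hPQ
  exact (measureReal_mono (show {ω | ¬ Q n ω} ⊆ {ω | ¬ P n ω} from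
    fun ω hω hP => hω (hPQ ω hP))).trans hn

lemma Whp.and {P Q : ∀ n : ℕ, SimpleGraph (Fin n) × (Fin n → S) → Prop} (hP : Whp c D P)
    (hQ : Whp c D Q) : Whp c D fun n ω => P n ω ∧ Q n ω := by
  intro ε hε
  filter_upwards [hP (ε / 2) (by positivity), hQ (ε / 2) (by positivity)] with n hPn hQn
  calc (randomFeaturedGraph c D n).real {ω | ¬ (P n ω ∧ Q n ω)}
      ≤ (randomFeaturedGraph c D n).real ({ω | ¬ P n ω} ∪ {ω | ¬ Q n ω}) :=
        measureReal_mono fun ω hω => not_and_or.1 hω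
    _ ≤ _ := (measureReal_union_le _ _).trans (by linarith)

lemma Whp.forall_finite {ι : Type*} [Finite ι]
    {P : ι → ∀ n : ℕ, SimpleGraph (Fin n) × (Fin n → S) → Prop} (hP : ∀ i, Whp c D (P i)) :
    Whp c D fun n ω => ∀ i, P i n ω := by
  classical
  have := Fintype.ofFinite ι
  have key : ∀ s : Finset ι, Whp c D fun n ω => ∀ i ∈ s, P i n ω := by
    intro s
    induction s using Finset.induction_on with
    | empty =>
      intro ε hε
      simp [hε.le]
    | insert i s _ ih =>
      exact ((hP i).and ih).mono (.of_forall fun n ω h => by simpa using h)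
  exact (key Finset.univ).mono (.of_forall fun n ω h i => h i (Finset.mem_univ i))

/-- Averages of local functions over the vertices of the random graph converge in probability. -/
theorem whp_average (hc : 0 < c) {R : ℕ} {F : (List ℕ → ℕ × S) → ℝ}
    (hF : DependsUpTo R F) (hFm : Measurable F) {B : ℝ} (hB : ∀ ω, |F ω| ≤ B) {δ : ℝ}
    (hδ : 0 < δ) :
    Whp c D fun n ω => |(∑ v, localValue R F v ω) / n - ∫ ω', F ω' ∂(fbpLaw c D)| < δ := by
  intro ε hε
  obtain ⟨s₀⟩ : Nonempty S := nonempty_of_isProbabilityMeasure D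
  have hB0 : 0 ≤ B := (abs_nonneg _).trans (hB fun _ => (0, s₀))
  set m := ∫ ω', F ω' ∂(fbpLaw c D) with hm
  have hmB : |m| ≤ B := by
    have := norm_integral_le_of_norm_le_const (μ := fbpLaw c D) (f := F) (.of_forall hB)
    simpa using this
  set K := 2 * B with hKdef
  have hlim : Tendsto (fun n : ℕ => K ^ 2 / n) atTop (𝓝 0) := tendsto_const_div_atTop_nhds_zero_nat _
  have hpos : 0 < ε * δ ^ 2 / 2 := by positivity
  -- Chebyshev's inequality: the budget `ε * δ ^ 2` is split evenly between the off-diagonal terms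
  -- and the `n` diagonal ones, which are negligible against `n ^ 2`.
  filter_upwards [eventually_integral_mul_le D hc hF hFm hB hpos, hlim.eventually (gt_mem_nhds hpos),
    eventually_gt_atTop 0] with n hn hKn hn0
  have hn0' : (0 : ℝ) < n := Nat.cast_pos.2 hn0
  let Z : Fin n → SimpleGraph (Fin n) × (Fin n → S) → ℝ := fun v ω => localValue R F v ω - m
  have hZ : ∀ v ω, |Z v ω| ≤ K := fun v ω =>
    (abs_sub _ _).trans (by have := abs_localValue_le (R := R) hB v ω; linarith)
  have hZm : ∀ v, Measurable (Z v) := fun v => (measurable_localValue R hFm v).sub_const m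
  have hprod : ∀ v v' ω, |Z v ω * Z v' ω| ≤ K ^ 2 := by
    intro v v' ω
    rw [abs_mul, sq]
    exact mul_le_mul (hZ v ω) (hZ v' ω) (abs_nonneg _) ((abs_nonneg _).trans (hZ v ω))
  have hint : ∀ v v', Integrable (fun ω => Z v ω * Z v' ω) (randomFeaturedGraph c D n) :=
    fun v v' => Integrable.of_bound ((hZm v).mul (hZm v')).aestronglyMeasurable (K ^ 2)
      (.of_forall (hprod v v'))
  have hterm : ∀ v v', ∫ ω, Z v ω * Z v' ω ∂(randomFeaturedGraph c D n) ≤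
      (if v = v' then K ^ 2 else 0) + ε * δ ^ 2 / 2 := by
    intro v v'
    split_ifs with h
    · have := norm_integral_le_of_norm_le_const (μ := randomFeaturedGraph c D n)
        (f := fun ω => Z v ω * Z v' ω) (.of_forall (hprod v v'))
      rw [probReal_univ, mul_one] at this
      linarith [(le_abs_self _).trans this]
    · rw [zero_add]
      exact hn v v' h
  have hsq : ∀ ω, (∑ v, Z v ω) ^ 2 = ∑ v, ∑ v', Z v ω * Z v' ω := fun ω => by
    rw [sq, Finset.sum_mul_sum]
  have hsecond : ∫ ω, (∑ v, Z v ω) ^ 2 ∂(randomFeaturedGraph c D n) ≤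
      n * K ^ 2 + n ^ 2 * (ε * δ ^ 2 / 2) := by
    simp only [hsq]
    rw [integral_finsetSum _ fun v _ => integrable_finsetSum _ fun v' _ => hint v v']
    simp only [integral_finsetSum _ fun v' _ => hint _ v']
    refine (Finset.sum_le_sum fun v _ => Finset.sum_le_sum fun v' _ => hterm v v').trans ?_
    refine le_of_eq ?_
    simp only [Finset.sum_add_distrib, Finset.sum_ite_eq, Finset.mem_univ, if_true,
      Finset.sum_const, Finset.card_univ, Fintype.card_fin, nsmul_eq_mul]
    ring
  have hintsq : Integrable (fun ω => (∑ v, Z v ω) ^ 2) (randomFeaturedGraph c D n) := by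
    simp only [hsq]
    exact integrable_finsetSum _ fun v _ => integrable_finsetSum _ fun v' _ => hint v v'
  have hmarkov := mul_meas_ge_le_integral_of_nonneg (μ := randomFeaturedGraph c D n)
    (f := fun ω => (∑ v, Z v ω) ^ 2) (.of_forall fun ω => sq_nonneg _) hintsq ((n * δ) ^ 2)
  have hsub : {ω : SimpleGraph (Fin n) × (Fin n → S) |
      ¬ |(∑ v, localValue R F v ω) / n - m| < δ} ⊆ {ω | (n * δ) ^ 2 ≤ (∑ v, Z v ω) ^ 2} := by
    intro ω hω
    rw [Set.mem_ofPred_eq, not_lt] at hω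
    have e : ∑ v, Z v ω = n * ((∑ v, localValue R F v ω) / n - m) := by
      simp only [Z, Finset.sum_sub_distrib, Finset.sum_const, Finset.card_univ, Fintype.card_fin,
        nsmul_eq_mul]
      field_simp
    rw [Set.mem_ofPred_eq, e, mul_pow, mul_pow]
    refine mul_le_mul_of_nonneg_left ?_ (by positivity)
    rw [← sq_abs ((∑ v, localValue R F v ω) / n - m)]
    exact pow_le_pow_left₀ hδ.le hω 2
  refine (measureReal_mono hsub).trans ?_
  have h1 := hmarkov.trans hsecond
  have h2 : n * K ^ 2 ≤ n ^ 2 * (ε * δ ^ 2 / 2) := by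
    rw [div_lt_iff₀ hn0'] at hKn
    nlinarith
  have h3 : (n * δ) ^ 2 * (randomFeaturedGraph c D n).real {ω | (n * δ) ^ 2 ≤ (∑ v, Z v ω) ^ 2} ≤
      (n * δ) ^ 2 * ε := by
    refine h1.trans ?_
    rw [mul_pow]
    nlinarith
  exact le_of_mul_le_mul_left h3 (by positivity)

end SecondMoment

/-! ### Proportions of vertices with a given local structure. -/

section LocalStatistics

variable {d : ℕ} {S : Set (Fin d → ℝ)}

lemma AgreeUpTo.mono {R R' : ℕ} (hR : R' ≤ R) {ω ω' : List ℕ → ℕ × S} (h : AgreeUpTo R ω ω') :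
    AgreeUpTo R' ω ω' := fun w hw hl =>
  ⟨(h w hw (hl.trans hR)).1, fun hlt => (h w hw (hl.trans hR)).2 (hlt.trans_le hR)⟩

lemma AgreeUpTo.mem_shapeSet {R : ℕ} {ω ω' : List ℕ → ℕ × S} (h : AgreeUpTo R ω ω')
    {t : List ℕ → ℕ} (hω : ω ∈ shapeSet S R t) : ω' ∈ shapeSet S R t := by
  intro w hw hR
  have hn : IsNode (fun w => (ω w).1) w :=
    (isNode_iff_of_eq_on (N' := fun w => (ω w).1) hω hR.le).2 hw
  rw [← (h w hn hR.le).2 hR]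
  exact hω w hw hR

variable {c : ℝ≥0} {D : Measure S} [IsProbabilityMeasure D]

open Classical in
lemma natCast_ncard_setOf {α : Type*} [Fintype α] (P : α → Prop) :
    ({x | P x}.ncard : ℝ) = ∑ x, if P x then 1 else 0 := by
  rw [Finset.sum_boole, ← Set.ncard_coe_finset]
  simp

/-- The proportion of vertices whose universal cover is injective and lies in a local event
converges in probability. -/
lemma whp_ncard (hc : 0 < c) {R : ℕ} {A : Set (List ℕ → ℕ × S)}
    (hA : ∀ ω ω', AgreeUpTo R ω ω' → ω ∈ A → ω' ∈ A) (hAm : MeasurableSet A) {δ : ℝ}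
    (hδ : 0 < δ) :
    Whp c D fun n ω => |({v : Fin n | CoverInjective ω.1.finNbrs v R ∧
      graphCover ω.1 ω.2 v ∈ A}.ncard : ℝ) / n - (fbpLaw c D).real A| < δ := by
  classical
  have hF : DependsUpTo R (A.indicator fun _ => (1 : ℝ)) := by
    intro ω ω' h
    by_cases hω : ω ∈ A
    · rw [Set.indicator_of_mem hω, Set.indicator_of_mem (hA _ _ h hω)]
    · rw [Set.indicator_of_notMem hω, Set.indicator_of_notMem fun h' => hω (hA _ _ h.symm h')]
  refine (whp_average (D := D) hc hF (measurable_const.indicator hAm) (B := 1) (fun ω => ?_)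
    hδ).mono (.of_forall fun n ω h => ?_)
  · by_cases hω : ω ∈ A <;> simp [hω]
  · rw [integral_indicator_const _ hAm, smul_eq_mul, mul_one] at h
    have e : ({v : Fin n | CoverInjective ω.1.finNbrs v R ∧ graphCover ω.1 ω.2 v ∈ A}.ncard : ℝ) =
        ∑ v, localValue R (A.indicator fun _ => (1 : ℝ)) v ω := by
      rw [natCast_ncard_setOf]
      refine Finset.sum_congr rfl fun v _ => ?_
      unfold localValue
      by_cases h1 : CoverInjective ω.1.finNbrs v R <;>
        by_cases h2 : graphCover ω.1 ω.2 v ∈ A <;> simp [h1, h2]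
    rwa [e]

lemma ncard_compl_le {n : ℕ} {s : Set (Fin n)} {a δ : ℝ} (h : |(s.ncard : ℝ) / n - a| < δ) :
    (sᶜ.ncard : ℝ) ≤ (1 - a + δ) * n := by
  have h1 : (s.ncard : ℝ) + sᶜ.ncard = n := by
    exact_mod_cast (Set.ncard_add_ncard_compl s).trans (by simp)
  rcases Nat.eq_zero_or_pos n with rfl | hn
  · have : (0 : ℝ) ≤ s.ncard := Nat.cast_nonneg _
    simp only [Nat.cast_zero] at h1
    simp only [Nat.cast_zero, mul_zero]
    linarith
  · have hn' : (0 : ℝ) < n := Nat.cast_pos.2 hn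
    have h2 : a - δ < (s.ncard : ℝ) / n := by linarith [(abs_lt.1 h).1]
    rw [lt_div_iff₀ hn'] at h2
    linarith

/-- With high probability all balls of a given radius are small. -/
lemma whp_ncard_walkBall_le (hc : 0 < c) (r : ℕ) {η : ℝ} (hη : 0 < η) :
    Whp c D fun n ω => ∀ x, ((ω.1.walkBall x r).ncard : ℝ) ≤ η * n := by
  classical
  -- A ball of radius `r` is contained in the ball of radius `r + r` around each of its points.
  set R := r + r with hR
  obtain ⟨𝒯, h𝒯, hsum⟩ := exists_finset_shapes (S := S) c D R (half_pos hη)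
  have hms : MeasurableSet (⋃ t ∈ 𝒯, shapeSet S R t) :=
    Finset.measurableSet_biUnion _ fun t _ => measurableSet_shapeSet R t
  have hP : (fbpLaw c D).real (⋃ t ∈ 𝒯, shapeSet S R t) =
      ∑ t ∈ 𝒯, (fbpLaw c D).real (shapeSet S R t) :=
    measureReal_biUnion_finset
      (fun t ht t' ht' hne => disjoint_shapeSet (h𝒯 t ht) (h𝒯 t' ht') hne)
      fun t _ => measurableSet_shapeSet R t
  rw [← hP] at hsum
  set M := ∑ t ∈ 𝒯, (innerNodes t (R + 1)).card with hM
  have hlarge : ∀ᶠ n : ℕ in atTop, (M : ℝ) ≤ η * n :=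
    (tendsto_natCast_atTop_atTop.const_mul_atTop hη).eventually_ge_atTop _
  refine (whp_ncard (D := D) (R := R) hc (A := ⋃ t ∈ 𝒯, shapeSet S R t) (fun ω ω' h hω => ?_) hms
    (half_pos hη)).mono ?_
  · simp only [Set.mem_iUnion] at hω ⊢
    obtain ⟨t, ht, hω⟩ := hω
    exact ⟨t, ht, h.mem_shapeSet hω⟩
  · filter_upwards [hlarge] with n hn ω hω x
    by_contra! hx
    have hlt := ((ncard_compl_le hω).trans
      (mul_le_mul_of_nonneg_right (by linarith) (Nat.cast_nonneg n))).trans_lt hx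
    -- A ball larger than the exceptional set contains a vertex whose cover has a listed shape. Its
    -- surroundings have at most `M` vertices, and they contain the ball.
    obtain ⟨y, hy, hyA⟩ := Set.exists_mem_notMem_of_ncard_lt_ncard (Nat.cast_lt.1 hlt)
    have hyA := (Set.notMem_compl_iff.1 hyA).2
    simp only [Set.mem_iUnion] at hyA
    obtain ⟨t, ht, hyt⟩ := hyA
    have hsub : ω.1.walkBall x r ⊆
        coverPos ω.1.finNbrs y '' (innerNodes t (R + 1) : Set (List ℕ)) := by
      intro z hz
      obtain ⟨w, hw, hl, rfl⟩ := exists_isCoverNode_of_mem_walkBall (nb := ω.1.finNbrs)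
        (fun _ _ => mem_finNbrs) (walkBall_trans (walkBall_symm hy) hz)
      refine ⟨w, ?_, rfl⟩
      rw [Finset.mem_coe, mem_innerNodes]
      exact ⟨(isNode_iff_of_eq_on (N' := fun w => (graphCover ω.1 ω.2 y w).1) hyt hl).1 hw,
        by omega⟩
    have h1 : (ω.1.walkBall x r).ncard ≤ M :=
      calc (ω.1.walkBall x r).ncard ≤ _ :=
            Set.ncard_le_ncard hsub ((Finset.finite_toSet _).image _)
        _ ≤ (innerNodes t (R + 1) : Set (List ℕ)).ncard := Set.ncard_image_le (Finset.finite_toSet _)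
        _ = (innerNodes t (R + 1)).card := Set.ncard_coe_finset _
        _ ≤ M := Finset.single_le_sum (f := fun t => (innerNodes t (R + 1)).card)
            (fun _ _ => Nat.zero_le _) ht
    have h2 : ((ω.1.walkBall x r).ncard : ℝ) ≤ M := Nat.cast_le.2 h1
    linarith

/-- The vertex `v` has an injective universal cover and is far from the vertices `u`. -/
def Isolated {n k : ℕ} (R : ℕ) (G : SimpleGraph (Fin n)) (u : Fin k → Fin n) (v : Fin n) : Prop :=
  CoverInjective G.finNbrs v (3 * R + 2) ∧ ∀ i, u i ∉ G.walkBall v (2 * R + 1)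

/-- With high probability all but a small proportion of the vertices are isolated from any given
`k` vertices. -/
lemma whp_ncard_not_isolated_le (hc : 0 < c) (k R : ℕ) {η : ℝ} (hη : 0 < η) :
    Whp c D fun n ω => ∀ u : Fin k → Fin n,
      ({v | ¬ Isolated R ω.1 u v}.ncard : ℝ) ≤ η * n := by
  have h1 := whp_ncard (D := D) hc (R := 3 * R + 2) (A := Set.univ) (fun _ _ _ _ => trivial)
    MeasurableSet.univ (half_pos hη)
  -- Smallness of all balls at once gives the bound uniformly in `u`: the vertices close to `u` lie
  -- in the union of `k` balls.
  have h2 := whp_ncard_walkBall_le (D := D) hc (2 * R + 1) (η := η / (2 * (k + 1))) (by positivity)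
  refine (h1.and h2).mono (.of_forall fun n ω h u => ?_)
  have hbad := ncard_compl_le h.1
  rw [probReal_univ] at hbad
  have hsub : {v | ¬ Isolated R ω.1 u v} ⊆
      {v : Fin n | CoverInjective ω.1.finNbrs v (3 * R + 2) ∧
        graphCover ω.1 ω.2 v ∈ Set.univ}ᶜ ∪ ⋃ i, ω.1.walkBall (u i) (2 * R + 1) := by
    intro v hv
    by_cases hv' : CoverInjective ω.1.finNbrs v (3 * R + 2)
    · obtain ⟨i, hi⟩ : ∃ i, u i ∈ ω.1.walkBall v (2 * R + 1) := by
        by_contra! hcon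
        exact hv ⟨hv', hcon⟩
      exact .inr (Set.mem_iUnion.2 ⟨i, walkBall_symm hi⟩)
    · exact .inl fun h => hv' h.1
  have hcard := (Set.ncard_le_ncard hsub).trans (Set.ncard_union_le _ _)
  have hsum : ((⋃ i, ω.1.walkBall (u i) (2 * R + 1)).ncard : ℝ) ≤ η / 2 * n := by
    refine (Nat.cast_le.2 (Set.ncard_iUnion_le_of_fintype _)).trans ?_
    rw [Nat.cast_sum]
    refine (Finset.sum_le_card_nsmul _ _ (η / (2 * (k + 1)) * n) fun i _ => h.2 (u i)).trans ?_
    rw [Finset.card_univ, Fintype.card_fin, nsmul_eq_mul, ← mul_assoc]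
    refine mul_le_mul_of_nonneg_right ?_ (Nat.cast_nonneg n)
    rw [mul_div_assoc', div_le_div_iff₀ (by positivity) two_pos]
    nlinarith [(Nat.cast_nonneg k : (0 : ℝ) ≤ k)]
  have hcard' := (Nat.cast_le (α := ℝ)).2 hcard
  rw [Nat.cast_add] at hcard'
  linarith

/-- An open set contains a cylinder over finitely many words, whose factors have positive mass by
full support of `D` and positivity of all Poisson weights. -/
lemma fbpLaw_pos_of_isOpen [D.IsOpenPosMeasure] (hc : 0 < c) {A : Set (List ℕ → ℕ × S)}
    (hA : IsOpen A) (hne : A.Nonempty) : 0 < (fbpLaw c D).real A := by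
  obtain ⟨ω, hω⟩ := hne
  obtain ⟨I, u, hu, hsub⟩ := isOpen_pi_iff.1 hA ω hω
  have : (poissonMeasure c).IsOpenPosMeasure :=
    ⟨fun U _ ⟨k, hk⟩ h0 => poissonMeasure_singleton_ne_zero hc k
      (measure_mono_null (Set.singleton_subset_iff.2 hk) h0)⟩
  have hpos : fbpLaw c D ((I : Set (List ℕ)).pi u) ≠ 0 := by
    rw [fbpLaw, Measure.infinitePi_pi _ fun w hw => (hu w hw).1.measurableSet,
      Finset.prod_ne_zero_iff]
    exact fun w hw => (hu w hw).1.measure_ne_zero _ ⟨ω w, (hu w hw).2⟩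
  exact ENNReal.toReal_pos (fun h => hpos (measure_mono_null hsub h)) (measure_ne_top _ _)

end LocalStatistics

/-! ### Concentration of terms around their controllers. -/

section Convergence

variable {d k : ℕ} {S : Set (Fin d → ℝ)}

namespace MRFG

/-- The featured graph with roots `u` given by a finite graph and its features. -/
def ofRoots {n : ℕ} (ω : SimpleGraph (Fin n) × (Fin n → S)) (u : Fin k → Fin n) : MRFG S k where
  V := Fin n
  graph := ω.1
  finite_nbrs _ := Set.toFinite _
  root := u
  feat := ω.2

lemma ofRoots_elim0 {n : ℕ} (ω : SimpleGraph (Fin n) × (Fin n → S)) :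
    ofRoots ω Fin.elim0 = ofFinite ω.1 ω.2 := rfl

lemma locallyEquiv_ofRoots_snoc {n : ℕ} {ω : SimpleGraph (Fin n) × (Fin n → S)}
    {u : Fin k → Fin n} {v : Fin n} {R : ℕ} (h : Isolated R ω.1 u v) :
    LocallyEquiv R (ofRoots ω (Fin.snoc u v : Fin (k + 1) → Fin n))
      ((ofRoots ω u).union (branchingTree (graphCover ω.1 ω.2 v))) :=
  locallyEquiv_addRoot_union_cover (G := ofRoots ω u) h.1 h.2

end MRFG

lemma nonempty_rootedFeaturedTree [Nonempty S] : Nonempty (RootedFeaturedTree S) :=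
  ⟨⟨⟨Unit, ⊥, fun _ => Set.toFinite _, fun _ => (), fun _ => Classical.arbitrary S⟩,
    .of_subsingleton⟩⟩

/-- With high probability, the value of `τ` is close to its controller, at all tuples of nodes. -/
def AggTerm.Concentrates (c : ℝ≥0) (D : Measure S) (τ : AggTerm d k) : Prop :=
  ∀ δ : ℝ, 0 < δ → Whp c D fun n ω => ∀ u : Fin k → Fin n,
    |τ.eval ω.1 (fun v => (ω.2 v : Fin d → ℝ)) u - τ.controller c D (ofRoots ω u)| ≤ δ

lemma AggTerm.Concentrates.of_eq {c : ℝ≥0} {D : Measure S} {τ : AggTerm d k}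
    (h : ∀ (n : ℕ) (ω : SimpleGraph (Fin n) × (Fin n → S)) (u : Fin k → Fin n),
      τ.eval ω.1 (fun v => (ω.2 v : Fin d → ℝ)) u = τ.controller c D (ofRoots ω u)) :
    τ.Concentrates c D := by
  intro δ hδ ε hε
  simp [h, hδ.le, hε.le]

variable (c : ℝ≥0) (D : Measure S)

/-- Depth `R` would do; `3 * R + 2` is the depth of injectivity in `Isolated`, so that `localValue`
takes its nontrivial value at isolated vertices. -/
lemma AggTerm.dependsUpTo_controller_union {R : ℕ} {π : AggTerm d (k + 1)}
    (hR : ∀ G H : MRFG S (k + 1), LocallyEquiv R G H → π.controller c D G = π.controller c D H)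
    (G : MRFG S k) :
    DependsUpTo (3 * R + 2) fun ω => π.controller c D (G.union (branchingTree ω)) :=
  fun _ _ h => hR _ _ ((h.mono (by omega : R ≤ 3 * R + 2)).locallyEquiv.union_left G)

variable [IsProbabilityMeasure D]

/-- The functions `T ↦ λ_π(G ⊔ T)` are, up to a given error, finite in number. -/
lemma AggTerm.exists_union_representatives (hS : IsCompact S) (π : AggTerm d (k + 1)) {ε : ℝ}
    (hε : 0 < ε) :
    ∃ (C : Type) (_ : Finite C) (H : C → MRFG S k), ∀ G : MRFG S k, Nonempty G.V →
      ∃ a, ∀ T : MRFG S 1,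
        |π.controller c D (G.union T) - π.controller c D ((H a).union T)| ≤ ε := by
  -- The roles are exchanged: the coloured component is the rooted graph, while the tree, with its
  -- root repeated, is the arbitrary other component. Hence the negated selector.
  obtain ⟨C, _, κ, hκ⟩ := π.exists_coloring hS c D
    (fun i => !(Fin.snoc (fun _ => true) false : Fin (k + 1) → Bool) i) ε hε
  obtain ⟨R, hR⟩ := π.exists_locality_radius c D
  let f : {G : MRFG S k // Nonempty G.V} → C := fun G => κ (G.1.addRoot (Classical.choice G.2))
  have key : ∀ (G : MRFG S k) (x : G.V) (T : MRFG S 1), π.controller c D (G.union T) =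
      π.controller c D (mix (fun i => !(Fin.snoc (fun _ => true) false : Fin (k + 1) → Bool) i)
        (T.repeatRoot (k + 1)) (G.addRoot x)) := by
    intro G x T
    rw [union_eq_mix G T x]
    exact hR _ _ (mix_swap _ _ _ R)
  refine ⟨Set.range f, inferInstance, fun a => a.2.choose.1, fun G hG => ?_⟩
  refine ⟨⟨f ⟨G, hG⟩, ⟨G, hG⟩, rfl⟩, fun T => ?_⟩
  set a : Set.range f := ⟨f ⟨G, hG⟩, ⟨G, hG⟩, rfl⟩
  rw [key G (Classical.choice hG), key a.2.choose.1 (Classical.choice a.2.choose.2)]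
  exact hκ _ _ hG a.2.choose.2 a.2.choose_spec.symm _ ⟨T.root 0⟩

variable {c D}

lemma AggTerm.Concentrates.app {m : ℕ} {F : (Fin m → ℝ) → ℝ} {hF : ∃ K : ℝ≥0, LipschitzWith K F}
    {π : Fin m → AggTerm d k} (h : ∀ l, (π l).Concentrates c D) :
    (AggTerm.app F hF π).Concentrates c D := by
  obtain ⟨K, hK⟩ := id hF
  intro δ hδ
  refine (Whp.forall_finite fun l => h l (δ / (K + 1)) (by positivity)).mono
    (.of_forall fun n ω hω u => ?_)
  have h1 := hK.dist_le_mul (fun l => (π l).eval ω.1 (fun v => (ω.2 v : Fin d → ℝ)) u)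
    (fun l => (π l).controller c D (ofRoots ω u))
  have h2 : dist (fun l => (π l).eval ω.1 (fun v => (ω.2 v : Fin d → ℝ)) u)
      (fun l => (π l).controller c D (ofRoots ω u)) ≤ δ / (K + 1) :=
    (dist_pi_le_iff (by positivity)).2 fun l => hω l u
  refine (h1.trans (mul_le_mul_of_nonneg_left h2 K.2)).trans ?_
  rw [mul_div_assoc', div_le_iff₀ (by positivity)]
  nlinarith [K.2]

lemma abs_sum_div_sub_sum_div_le {ι : Type*} {s : Finset ι} {f g : ι → ℝ} {m : ℕ} {δ : ℝ}
    (hs : s.card ≤ m) (hδ : 0 ≤ δ) (h : ∀ i ∈ s, |f i - g i| ≤ δ) :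
    |(∑ i ∈ s, f i) / m - (∑ i ∈ s, g i) / m| ≤ δ := by
  rw [← sub_div, ← Finset.sum_sub_distrib, abs_div, Nat.abs_cast]
  refine div_le_of_le_mul₀ (Nat.cast_nonneg _) hδ ?_
  refine (Finset.abs_sum_le_sum_abs _ _).trans ((Finset.sum_le_card_nsmul _ _ δ h).trans ?_)
  rw [nsmul_eq_mul, mul_comm]
  exact mul_le_mul_of_nonneg_left (Nat.cast_le.2 hs) hδ

/-- Uniformity over tuples is essential: the hypothesis on `π` applies to `u` extended by any
neighbour. -/
lemma AggTerm.Concentrates.lmean {i : Fin k} {π : AggTerm d (k + 1)} (h : π.Concentrates c D) :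
    (AggTerm.lmean i π).Concentrates c D := by
  classical
  intro δ hδ
  refine (h δ hδ).mono (.of_forall fun n ω hω u => ?_)
  have e : (ofRoots ω u).nbrs (u i) = ω.1.neighborFinset (u i) := by
    ext x
    exact (mem_nbrs (G := ofRoots ω u)).trans (mem_neighborFinset ω.1 (u i) x).symm
  have hc : (AggTerm.lmean i π).controller c D (ofRoots ω u) =
      (∑ v ∈ (ofRoots ω u).nbrs (u i), π.controller c D (ofRoots ω (Fin.snoc u v))) /
        ((ofRoots ω u).nbrs (u i)).card := rfl
  have he : (AggTerm.lmean i π).eval ω.1 (fun v => (ω.2 v : Fin d → ℝ)) u =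
      (∑ v ∈ ω.1.neighborFinset (u i), π.eval ω.1 (fun v => (ω.2 v : Fin d → ℝ)) (Fin.snoc u v)) /
        (ω.1.neighborFinset (u i)).card := by
    simp only [AggTerm.eval, card_neighborFinset_eq_degree]
  rw [hc, he, e]
  exact abs_sum_div_sub_sum_div_le le_rfl hδ.le fun v _ => hω _

lemma AggTerm.Concentrates.mean (hS : IsCompact S) (hc : 0 < c) {π : AggTerm d (k + 1)}
    (h : π.Concentrates c D) : (AggTerm.mean π).Concentrates c D := by
  classical
  intro δ hδ
  obtain ⟨R, hR⟩ := π.exists_locality_radius c D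
  obtain ⟨B, hB0, hB⟩ := π.exists_controller_bound hS c D
  have hε : 0 < δ / 5 := by positivity
  obtain ⟨C, _, H, hH⟩ := π.exists_union_representatives c D hS hε
  let F : C → (List ℕ → ℕ × S) → ℝ := fun a ω => π.controller c D ((H a).union (branchingTree ω))
  have hav : ∀ a, Whp c D fun n ω => |(∑ v, localValue (3 * R + 2) (F a) v ω) / n -
      ∫ ω', F a ω' ∂(fbpLaw c D)| < δ / 5 := fun a =>
    whp_average hc (π.dependsUpTo_controller_union c D hR (H a))
      (π.continuous_controller_union_branchingTree hS c D (H a)).measurable (fun _ => hB _) hε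
  -- Vertices that are not isolated contribute at most `2 * B` each, hence at most `δ / 5` on
  -- average. The other four errors are: the hypothesis on `π`, the representative under the average
  -- and under the integral, and the law of large numbers.
  have hη : 0 < δ / (10 * (B + 1)) := by positivity
  refine (((h _ hε).and (Whp.forall_finite hav)).and
    (whp_ncard_not_isolated_le hc k R hη)).mono ?_
  filter_upwards [eventually_gt_atTop 0] with n hn ω ⟨⟨hπ, hω⟩, hbad⟩ u
  have hn' : (0 : ℝ) < n := Nat.cast_pos.2 hn
  obtain ⟨a, ha⟩ := hH (ofRoots ω u) ⟨⟨0, hn⟩⟩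
  have he : (AggTerm.mean π).eval ω.1 (fun v => (ω.2 v : Fin d → ℝ)) u =
      (∑ v, π.eval ω.1 (fun v => (ω.2 v : Fin d → ℝ)) (Fin.snoc u v)) / n := by
    simp only [AggTerm.eval, Fintype.card_fin]
  have h1 : |(∑ v, π.eval ω.1 (fun v => (ω.2 v : Fin d → ℝ)) (Fin.snoc u v)) / n -
      (∑ v, π.controller c D (ofRoots ω (Fin.snoc u v))) / n| ≤ δ / 5 :=
    abs_sum_div_sub_sum_div_le (by simp) hε.le fun v _ => hπ _
  have h2 : |(∑ v, π.controller c D (ofRoots ω (Fin.snoc u v : Fin (k + 1) → Fin n))) / n -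
      (∑ v, localValue (3 * R + 2) (F a) v ω) / n| ≤ δ / 5 + δ / 5 := by
    rw [← sub_div, ← Finset.sum_sub_distrib, abs_div, Nat.abs_cast, div_le_iff₀ hn']
    have hterm : ∀ v, |π.controller c D (ofRoots ω (Fin.snoc u v : Fin (k + 1) → Fin n)) -
        localValue (3 * R + 2) (F a) v ω| ≤
          δ / 5 + if ¬ Isolated R ω.1 u v then 2 * B else 0 := by
      intro v
      by_cases hv : Isolated R ω.1 u v
      · rw [if_neg (not_not.2 hv), add_zero, hR _ _ (locallyEquiv_ofRoots_snoc hv)]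
        simp only [localValue, hv.1, if_true]
        exact ha _
      · rw [if_pos hv]
        refine (abs_sub _ _).trans ?_
        have h3 := hB (ofRoots ω (Fin.snoc u v : Fin (k + 1) → Fin n))
        have h4 := abs_localValue_le (R := 3 * R + 2) (F := F a) (fun _ => hB _) v ω
        linarith
    refine (Finset.abs_sum_le_sum_abs _ _).trans
      ((Finset.sum_le_sum fun v _ => hterm v).trans ?_)
    have h7 : ∑ v, (if ¬ Isolated R ω.1 u v then 2 * B else 0) =
        ({v | ¬ Isolated R ω.1 u v}.ncard : ℝ) * (2 * B) := by
      rw [natCast_ncard_setOf, Finset.sum_mul]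
      exact Finset.sum_congr rfl fun v _ => by split_ifs <;> simp
    rw [Finset.sum_add_distrib, h7, Finset.sum_const, Finset.card_univ, Fintype.card_fin,
      nsmul_eq_mul]
    have h5 := mul_le_mul_of_nonneg_right (hbad u) (by positivity : 0 ≤ 2 * B)
    have h6 : δ / (10 * (B + 1)) * n * (2 * B) ≤ δ / 5 * n := by
      rw [mul_right_comm]
      refine mul_le_mul_of_nonneg_right ?_ hn'.le
      rw [div_mul_eq_mul_div, div_le_div_iff₀ (by positivity) (by norm_num)]
      nlinarith
    linarith
  have h3 := hω a
  have h4 : |∫ ω', F a ω' ∂(fbpLaw c D) -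
      ∫ ω', π.controller c D ((ofRoots ω u).union (branchingTree ω')) ∂(fbpLaw c D)| ≤ δ / 5 := by
    rw [← integral_sub (π.integrable_controller_union_branchingTree hS c D _)
      (π.integrable_controller_union_branchingTree hS c D _)]
    have := norm_integral_le_of_norm_le_const (μ := fbpLaw c D)
      (f := fun ω' => F a ω' - π.controller c D ((ofRoots ω u).union (branchingTree ω')))
      (.of_forall fun ω' => (abs_sub_comm _ _).trans_le (ha (branchingTree ω')))
    rwa [probReal_univ, mul_one] at this
  rw [he]
  change |_ - ∫ ω', π.controller c D ((ofRoots ω u).union (branchingTree ω')) ∂(fbpLaw c D)| ≤ δ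
  rw [abs_le] at h1 h2 h4 ⊢
  rw [abs_lt] at h3
  constructor <;> linarith [h1.1, h1.2, h2.1, h2.2, h3.1, h3.2, h4.1, h4.2]

lemma AggTerm.Concentrates.sup [D.IsOpenPosMeasure] (hS : IsCompact S) (hc : 0 < c)
    {π : AggTerm d (k + 1)} (h : π.Concentrates c D) : (AggTerm.sup π).Concentrates c D := by
  classical
  intro δ hδ
  have : Nonempty S := nonempty_of_isProbabilityMeasure D
  have : Nonempty (RootedFeaturedTree S) := nonempty_rootedFeaturedTree
  obtain ⟨R, hR⟩ := π.exists_locality_radius c D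
  obtain ⟨B, hB0, hB⟩ := π.exists_controller_bound hS c D
  have hε : 0 < δ / 5 := by positivity
  obtain ⟨C, _, H, hH⟩ := π.exists_union_representatives c D hS hε
  have hbdd : ∀ a, BddAbove (Set.range fun T : RootedFeaturedTree S =>
      π.controller c D ((H a).union T.1)) := by
    rintro a
    refine ⟨B, ?_⟩
    rintro _ ⟨T, rfl⟩
    exact (abs_le.1 (hB _)).2
  let A : C → Set (List ℕ → ℕ × S) := fun a =>
    {ω | (⨆ T : RootedFeaturedTree S, π.controller c D ((H a).union T.1)) - δ / 5 <
      π.controller c D ((H a).union (branchingTree ω))}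
  have hAo : ∀ a, IsOpen (A a) := fun a =>
    isOpen_lt continuous_const (π.continuous_controller_union_branchingTree hS c D (H a))
  have hApos : ∀ a, 0 < (fbpLaw c D).real (A a) := by
    intro a
    refine fbpLaw_pos_of_isOpen hc (hAo a) ?_
    obtain ⟨T, hT⟩ := exists_lt_of_lt_ciSup (sub_lt_self
      (⨆ T : RootedFeaturedTree S, π.controller c D ((H a).union T.1)) hε)
    -- An arbitrary tree is locally equivalent to a branching tree, so the nearly optimal trees
    -- include one in the range of the branching process.
    refine ⟨T.1.cover (T.1.root 0), ?_⟩
    rw [hR _ _ ((locallyEquiv_cover_of_isTree T.2 R).union_left (H a))] at hT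
    exact hT
  have hcard : ∀ a, Whp c D fun n ω => ∀ u : Fin k → Fin n, 0 < n → ∃ v, Isolated R ω.1 u v ∧
      graphCover ω.1 ω.2 v ∈ A a := by
    intro a
    have h1 := whp_ncard (D := D) hc (R := 3 * R + 2) (A := A a) (fun ω ω' hω hmem => by
      have := π.dependsUpTo_controller_union c D hR (H a) ω ω' hω
      simp only [A, Set.mem_ofPred_eq] at hmem ⊢
      exact hmem.trans_eq this) (hAo a).measurableSet (half_pos (hApos a))
    -- Fewer vertices fail to be isolated than have a nearly optimal cover, so some vertex has such
    -- a cover and is isolated from `u`.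
    have h2 := whp_ncard_not_isolated_le (D := D) hc k R (half_pos (half_pos (hApos a)))
    refine (h1.and h2).mono (.of_forall fun n ω hω u hn => ?_)
    have hn' : (0 : ℝ) < n := Nat.cast_pos.2 hn
    have h3 : (fbpLaw c D).real (A a) / 2 < ({v : Fin n |
        CoverInjective ω.1.finNbrs v (3 * R + 2) ∧ graphCover ω.1 ω.2 v ∈ A a}.ncard : ℝ) / n := by
      linarith [(abs_lt.1 hω.1).1]
    rw [lt_div_iff₀ hn'] at h3
    have h4 := hω.2 u
    have h5 : (fbpLaw c D).real (A a) / 2 / 2 * n ≤ (fbpLaw c D).real (A a) / 2 * n :=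
      mul_le_mul_of_nonneg_right (by linarith [hApos a]) hn'.le
    obtain ⟨v, hv, hv'⟩ := Set.exists_mem_notMem_of_ncard_lt_ncard
      (Nat.cast_lt.1 ((h4.trans h5).trans_lt h3))
    exact ⟨v, not_not.1 hv', hv.2⟩
  refine ((h _ hε).and (Whp.forall_finite hcard)).mono ?_
  filter_upwards [eventually_gt_atTop 0] with n hn ω ⟨hπ, hω⟩ u
  have : Nonempty (Fin n) := ⟨⟨0, hn⟩⟩
  obtain ⟨a, ha⟩ := hH (ofRoots ω u) ⟨⟨0, hn⟩⟩
  obtain ⟨v₀, hv₀, hv₀A⟩ := hω a u hn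
  change |(⨆ v, π.eval ω.1 (fun v => (ω.2 v : Fin d → ℝ)) (Fin.snoc u v)) -
    sSup ((Set.range fun v : Fin n => π.controller c D (ofRoots ω (Fin.snoc u v))) ∪
      (Set.range fun T : RootedFeaturedTree S => π.controller c D ((ofRoots ω u).union T.1)))| ≤ δ
  have hle : ∀ v : Fin n, π.controller c D (ofRoots ω (Fin.snoc u v : Fin (k + 1) → Fin n)) ≤
      (⨆ v, π.eval ω.1 (fun v => (ω.2 v : Fin d → ℝ)) (Fin.snoc u v)) + δ / 5 := by
    intro v
    have h1 := le_ciSup (f := fun v : Fin n =>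
      π.eval ω.1 (fun v => (ω.2 v : Fin d → ℝ)) (Fin.snoc u v)) (Set.finite_range _).bddAbove v
    have h2 := (abs_le.1 (hπ (Fin.snoc u v))).1
    linarith
  rw [abs_le]
  constructor
  · suffices hs : sSup ((Set.range fun v : Fin n => π.controller c D (ofRoots ω (Fin.snoc u v))) ∪
        (Set.range fun T : RootedFeaturedTree S => π.controller c D ((ofRoots ω u).union T.1))) ≤
        (⨆ v, π.eval ω.1 (fun v => (ω.2 v : Fin d → ℝ)) (Fin.snoc u v)) + δ by linarith
    refine csSup_le ((Set.range_nonempty _).inl) ?_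
    rintro _ (⟨v, rfl⟩ | ⟨T, rfl⟩)
    · linarith [hle v]
    -- A tree is compared with the cover at `v₀` through the representative `H a`. The two changes
    -- of graph, near-optimality and the hypothesis on `π` cost `δ / 5` each.
    · have h1 := (abs_le.1 (ha T.1)).2
      have h2 := le_ciSup (hbdd a) T
      have h3 := (abs_le.1 (ha (branchingTree (graphCover ω.1 ω.2 v₀)))).1
      have h4 := hle v₀
      rw [hR _ _ (locallyEquiv_ofRoots_snoc hv₀)] at h4
      simp only [A, Set.mem_ofPred_eq] at hv₀A
      simp only at h2 ⊢
      linarith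
  · rw [sub_le_iff_le_add]
    refine ciSup_le fun v => ?_
    have h1 := (abs_le.1 (hπ (Fin.snoc u v))).2
    have h2 : π.controller c D (ofRoots ω (Fin.snoc u v : Fin (k + 1) → Fin n)) ≤
        sSup ((Set.range fun v : Fin n => π.controller c D (ofRoots ω (Fin.snoc u v))) ∪
          (Set.range fun T : RootedFeaturedTree S =>
            π.controller c D ((ofRoots ω u).union T.1))) := by
      refine le_csSup ⟨B, ?_⟩ (.inl ⟨v, rfl⟩)
      rintro _ (⟨v, rfl⟩ | ⟨T, rfl⟩) <;> exact (abs_le.1 (hB _)).2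
    linarith

theorem AggTerm.concentrates [D.IsOpenPosMeasure] (hS : IsCompact S) (hc : 0 < c)
    (τ : AggTerm d k) : τ.Concentrates c D := by
  induction τ with
  | val i j => exact .of_eq fun _ _ _ => rfl
  | const a => exact .of_eq fun _ _ _ => rfl
  | edge i j => exact .of_eq fun _ _ _ => rfl
  | equal i j => exact .of_eq fun _ _ _ => rfl
  | app F hF π ih => exact .app ih
  | mean π ih => exact ih.mean hS hc
  | lmean i π ih => exact ih.lmean
  | sup π ih => exact ih.sup hS hc

end Convergence

theorem mainTheorem7 {d : ℕ} (S : Set (Fin d → ℝ)) (hS : IsCompact S)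
    (D : Measure S) [IsProbabilityMeasure D] [D.IsOpenPosMeasure]
    (c : ℝ≥0) (hc : 0 < c) (τ : AggTerm d 0) :
    ∀ δ : ℝ, 0 < δ →
      Tendsto
        (fun n : ℕ => randomFeaturedGraph c D n
          {ω | δ ≤ |τ.eval ω.1 (fun v => (ω.2 v : Fin d → ℝ)) Fin.elim0
                  - τ.controller c D (MRFG.ofFinite ω.1 ω.2)|})
        atTop (𝓝 0) := by
  intro δ hδ
  rw [← ENNReal.tendsto_toReal_iff (fun n => measure_ne_top _ _) ENNReal.zero_ne_top,
    ENNReal.toReal_zero, tendsto_order]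
  refine ⟨fun a ha => .of_forall fun n => ha.trans_le ENNReal.toReal_nonneg, fun a ha => ?_⟩
  -- Halving turns the weak inequalities of `Concentrates` and `Whp` into the strict ones needed
  -- here.
  filter_upwards [τ.concentrates (D := D) hS hc (δ / 2) (half_pos hδ) (a / 2) (half_pos ha)]
    with n hn
  refine lt_of_le_of_lt ?_ (half_lt_self ha)
  refine le_trans (measureReal_mono ?_) hn
  intro ω hω h
  have h1 := h Fin.elim0
  rw [ofRoots_elim0] at h1
  simp only [Set.mem_ofPred_eq] at hω
  linarith
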